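/- Let $K$ be a totally real number field with ring of integers $\mathcal O_K$, and let $\mathcal A=\left(\frac{a,b}{K}\right)=K\oplus K\mathbf i\oplus K\mathbf j\oplus K\mathbf k$ ($\mathbf i^2=a$, $\mathbf j^2=b$, $\mathbf k=\mathbf i\mathbf j=-\mathbf j\mathbf i$) be a totally definite quaternion algebra, i.e. one whose reduced norm $\operatorname{nrd}(\mathbf q)=\mathbf q\overline{\mathbf q}$ is totally positive at every $\mathbf q\ne0$. An order of $\mathcal A$ is a subring that is a finitely generated $\mathcal O_K$-submodule spanning $\mathcal A$ over $K$. For an order $\mathcal G$ put $\mathcal G^1=\{\mathbf u\in\mathcal G:\operatorname{nrd}(\mathbf u)=1\}$ and $r_{\mathcal G}(\alpha)=\#\{\mathbf q\in\mathcal G:\operatorname{nrd}(\mathbf q)=\alpha\}$. The class number of an order $\mathcal H$ is the number of classes of lattices $L\subset\mathcal A$ with right order $\{\mathbf x\in\mathcal A: L\mathbf x\subseteq L\}$ equal to $\mathcal H$, where $L\sim M$ if $L=\mathbf xM$ for some $\mathbf x\in\mathcal A^\times$. The index $[\mathcal H:\mathcal G]_{\mathcal O_K}$ is the fractional ideal generated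 by the determinants of the $K$-linear maps $\mathcal A\to\mathcal A$ that send $\mathcal H$ into $\mathcal G$, and the reduced discriminant $\operatorname{discrd}\mathcal H$ is the ideal generated by all $\operatorname{trd}((\mathbf x\mathbf y-\mathbf y\mathbf x)\overline{\mathbf z})$, $\mathbf x,\mathbf y,\mathbf z\in\mathcal H$, where $\operatorname{trd}(\mathbf q)=\mathbf q+\overline{\mathbf q}$. An order $\mathcal G\subseteq\mathcal H$ is perceptive in $\mathcal H$ if for every $\mathbf q\in\mathcal H$ there is $\mathbf u\in\mathcal H^1$ with $\mathbf u\mathbf q\in\mathcal G$. **Theorem.** (1) Let $\mathcal H$ be a maximal order of $\mathcal A$ with class number $1$ and $\operatorname{discrd}\mathcal H=\mathfrak D$. Let $\mathfrak p$ be a prime ideal of $\mathcal O_K$ dividing $\mathfrak D$, and let $\mathcal G\subseteq\mathcal H$ be an order that is perceptive in $\mathcal H$ with $[\mathcal H:\mathcal G]_{\mathcal O_K}=\mathfrak p$. Then for every totally positive $\alpha\in\mathcal O_K$ the number $r_{\mathcal G}(\alpha)$ is finite and $$r_{\mathcal G}(\alpha)=\#\mathcal G^1\cdot\sum_{\delta\mathcal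 O_K}\operatorname{Nm}(\delta\mathcal O_K),$$ where the sum runs over the principal ideals $\delta\mathcal O_K$ that divide $\alpha\mathcal O_K$ and are divisible neither by $\mathfrak p^2$ nor by any prime divisor of $\mathfrak D$ other than $\mathfrak p$. (2) In $\left(\frac{-1,-1}{\mathbb Q}\right)$, which is totally definite, the Hurwitz order $\mathcal H=\mathbb Z\oplus\mathbb Z\mathbf i\oplus\mathbb Z\mathbf j\oplus\mathbb Z\frac{1+\mathbf i+\mathbf j+\mathbf k}2$ is a maximal order of class number $1$ and reduced discriminant $2\mathbb Z$; the Lipschitz order $\mathcal G=\mathbb Z\oplus\mathbb Z\mathbf i\oplus\mathbb Z\mathbf j\oplus\mathbb Z\mathbf k$ is perceptive in it, with $[\mathcal H:\mathcal G]=2\mathbb Z$ (a prime ideal) and $\#\mathcal G^1=8$. Hence one recovers Jacobi's four-square theorem: for every positive integer $n$, the equation $t^2+x^2+y^2+z^2=n$ has exactly $8\sum_{d\mid n,\ 4\nmid d}d$ integer solutions. -/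

import Mathlib

open NumberField Quaternion

namespace QuatOrder

noncomputable section

/-- `α` is totally positive: its image under every real embedding of the field is positive. -/
def IsTotallyPositive {K : Type*} [Field K] (α : K) : Prop :=
  ∀ σ : K →+* ℝ, 0 < σ α

section Algebra

variable {K : Type*} [Field K] {a b : K}

/-- The reduced norm `q * star q`, which is a scalar (see `algebraMap_nrd`). -/
def nrd (q : ℍ[K,a,b]) : K := (q * star q).re

/-- The reduced trace `q + star q`, which is a scalar (see `algebraMap_trd`). -/
def trd (q : ℍ[K,a,b]) : K := (q + star q).re

theorem algebraMap_nrd (q : ℍ[K,a,b]) : algebraMap K ℍ[K,a,b] (nrd q) = q * star q :=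
  (QuaternionAlgebra.mul_star_eq_coe q).symm

theorem algebraMap_trd (q : ℍ[K,a,b]) : algebraMap K ℍ[K,a,b] (trd q) = q + star q := by
  rw [QuaternionAlgebra.algebraMap_eq]
  ext <;> simp [trd]

theorem nrd_eq (q : ℍ[K,a,b]) :
    nrd q = q.re ^ 2 - a * q.imI ^ 2 - b * q.imJ ^ 2 + a * b * q.imK ^ 2 := by
  simp [nrd]; ring

end Algebra

/-- The quaternion algebra `(a, b / K)` is (totally) definite: its norm form is totally positive
definite. -/
def IsDefinite {K : Type*} [Field K] (a b : K) : Prop :=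
  ∀ q : ℍ[K,a,b], q ≠ 0 → IsTotallyPositive (nrd q)

section Orders

variable {K : Type*} [Field K] {a b : K}

/-- The `𝓞 K`-algebra structure of a quaternion algebra, by restriction of scalars from `K`. Mathlib
has several definitionally equal instances; this one is preferred so that all terms agree. -/
instance instAlgebraIntegers : Algebra (𝓞 K) ℍ[K,a,b] := QuaternionAlgebra.instAlgebra

theorem algebraMap_integers (r : 𝓞 K) :
    algebraMap (𝓞 K) ℍ[K,a,b] r = algebraMap K ℍ[K,a,b] (r : K) := rfl

/-- An `𝓞 K`-order: a subring that is also an `𝓞 K`-lattice, i.e. finitely generated over `𝓞 K`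
and spanning the algebra over `K`. -/
def IsOrder (H : Subalgebra (𝓞 K) ℍ[K,a,b]) : Prop :=
  Submodule.IsLattice K (Subalgebra.toSubmodule H)

/-- A maximal order: inclusion-maximal among the orders. -/
def IsMaximalOrder (H : Subalgebra (𝓞 K) ℍ[K,a,b]) : Prop :=
  Maximal IsOrder H

/-- The right order `{x | L x ⊆ L}` of a lattice `L`. -/
def rightOrder (L : Submodule (𝓞 K) ℍ[K,a,b]) : Subalgebra (𝓞 K) ℍ[K,a,b] where
  carrier := {x | ∀ y ∈ L, y * x ∈ L}
  mul_mem' := by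
    intro x x' hx hx' y hy
    rw [← mul_assoc]
    exact hx' _ (hx y hy)
  add_mem' := by
    intro x x' hx hx' y hy
    rw [mul_add]
    exact L.add_mem (hx y hy) (hx' y hy)
  algebraMap_mem' := by
    intro r y hy
    rw [← Algebra.commutes, ← Algebra.smul_def]
    exact L.smul_mem r hy

/-- The left multiple `x L` of a lattice. -/
def leftMul (x : ℍ[K,a,b]) (L : Submodule (𝓞 K) ℍ[K,a,b]) : Submodule (𝓞 K) ℍ[K,a,b] :=
  L.map (LinearMap.mulLeft (𝓞 K) x)

theorem leftMul_one (L : Submodule (𝓞 K) ℍ[K,a,b]) : leftMul 1 L = L := by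
  ext y; simp [leftMul]

theorem leftMul_mul (x y : ℍ[K,a,b]) (L : Submodule (𝓞 K) ℍ[K,a,b]) :
    leftMul (x * y) L = leftMul x (leftMul y L) := by
  ext z; simp [leftMul]

/-- The lattices whose right order is exactly `H`. -/
def RightLattice (H : Subalgebra (𝓞 K) ℍ[K,a,b]) : Type _ :=
  {L : Submodule (𝓞 K) ℍ[K,a,b] // Submodule.IsLattice K L ∧ rightOrder L = H}

/-- Right equivalence of lattices: `L = x M` for an invertible `x` of the algebra. -/
def rightEquiv (H : Subalgebra (𝓞 K) ℍ[K,a,b]) : Setoid (RightLattice H) where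
  r L M := ∃ x : (ℍ[K,a,b])ˣ, L.1 = leftMul (x : ℍ[K,a,b]) M.1
  iseqv :=
    { refl := fun L => ⟨1, by simp [leftMul_one]⟩
      symm := by
        rintro L M ⟨x, hx⟩
        exact ⟨x⁻¹, by rw [hx, ← leftMul_mul, Units.inv_mul, leftMul_one]⟩
      trans := by
        rintro L M N ⟨x, hx⟩ ⟨y, hy⟩
        exact ⟨x * y, by rw [hx, hy, Units.val_mul, leftMul_mul]⟩ }

/-- The (right) class set of `H`. -/
def ClassSet (H : Subalgebra (𝓞 K) ℍ[K,a,b]) : Type _ := Quotient (rightEquiv H)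

/-- The class number of `H`. -/
def classNumber (H : Subalgebra (𝓞 K) ℍ[K,a,b]) : ℕ := Nat.card (ClassSet H)

/-- The `𝓞 K`-index `[L : M]` of two lattices: the fractional ideal generated by the determinants
of the `K`-linear endomorphisms of the algebra that map `L` into `M`. -/
def latticeIndex (L M : Submodule (𝓞 K) ℍ[K,a,b]) : Submodule (𝓞 K) K :=
  Submodule.span (𝓞 K)
    {d | ∃ δ : ℍ[K,a,b] →ₗ[K] ℍ[K,a,b], (∀ x ∈ L, δ x ∈ M) ∧ LinearMap.det δ = d}

/-- The reduced discriminant of a lattice: the fractional ideal generated by all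
`trd ((x y - y x) z̄)` with `x`, `y`, `z` in the lattice. -/
def discrd (L : Submodule (𝓞 K) ℍ[K,a,b]) : Submodule (𝓞 K) K :=
  Submodule.span (𝓞 K)
    {d | ∃ x ∈ L, ∃ y ∈ L, ∃ z ∈ L, trd ((x * y - y * x) * star z) = d}

/-- `discrd H = 𝔇` for an integral ideal `𝔇`. -/
def HasDiscrd (H : Subalgebra (𝓞 K) ℍ[K,a,b]) (𝔇 : Ideal (𝓞 K)) : Prop :=
  discrd (Subalgebra.toSubmodule H) = IsLocalization.coeSubmodule K 𝔇

/-- `[H : G] = I` for an integral ideal `I`. -/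
def HasIndex (H G : Subalgebra (𝓞 K) ℍ[K,a,b]) (I : Ideal (𝓞 K)) : Prop :=
  latticeIndex (Subalgebra.toSubmodule H) (Subalgebra.toSubmodule G) =
    IsLocalization.coeSubmodule K I

/-- The elements of `H` of reduced norm `α`. -/
def normSet (H : Subalgebra (𝓞 K) ℍ[K,a,b]) (α : K) : Set ℍ[K,a,b] :=
  {q | q ∈ H ∧ nrd q = α}

/-- The number `r_H(α)` of elements of `H` of reduced norm `α`. -/
def repCount (H : Subalgebra (𝓞 K) ℍ[K,a,b]) (α : K) : ℕ := (normSet H α).ncard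

/-- The suborder `G` of `H` is `H`-perceptive: every orbit of the group of elements of reduced
norm `1` of `H`, acting on `H` by left multiplication, meets `G`. -/
def IsPerceptive (G H : Subalgebra (𝓞 K) ℍ[K,a,b]) : Prop :=
  G ≤ H ∧ ∀ q ∈ H, ∃ u ∈ normSet H 1, u * q ∈ G

end Orders

/-- The principal ideals `δ` dividing `α 𝓞 K` that are divisible neither by `𝔭 ^ 2` nor by any
prime divisor of `𝔇` other than `𝔭`. -/
def admissibleDivisors {K : Type*} [Field K] (𝔇 𝔭 : Ideal (𝓞 K)) (α : 𝓞 K) :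
    Set (Ideal (𝓞 K)) :=
  {δ | δ.IsPrincipal ∧ δ ∣ Ideal.span {α} ∧ ¬ 𝔭 ^ 2 ∣ δ ∧
    ∀ 𝔮 : Ideal (𝓞 K), 𝔮.IsPrime → 𝔮 ∣ 𝔇 → 𝔮 ≠ 𝔭 → ¬ 𝔮 ∣ δ}

theorem finite_admissibleDivisors {K : Type*} [Field K] [NumberField K] (𝔇 𝔭 : Ideal (𝓞 K))
    {α : 𝓞 K} (hα : α ≠ 0) : (admissibleDivisors 𝔇 𝔭 α).Finite := by
  have h : Ideal.span {α} ≠ ⊥ := by simpa using hα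
  have : {δ : Ideal (𝓞 K) | δ ∣ Ideal.span {α}}.Finite := by
    have := UniqueFactorizationMonoid.fintypeSubtypeDvd (Ideal.span {α}) h
    exact Set.finite_coe_iff.1 (Finite.of_fintype {δ : Ideal (𝓞 K) // δ ∣ Ideal.span {α}})
  exact this.subset fun δ hδ => hδ.2.1

/-- The sum of the absolute norms of the ideals in `admissibleDivisors 𝔇 𝔭 α`; it is a finite sum
for `α ≠ 0` by `finite_admissibleDivisors`. -/
def divisorSum {K : Type*} [Field K] [NumberField K] (𝔇 𝔭 : Ideal (𝓞 K)) (α : 𝓞 K) : ℕ :=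
  ∑ᶠ δ ∈ admissibleDivisors 𝔇 𝔭 α, Ideal.absNorm δ

section HurwitzLipschitz

/-- A spanning set containing `1` whose pairwise products stay in the span gives a subring. -/
def spanSubalgebra (s : Set ℍ[ℚ,-1,-1]) (h1 : 1 ∈ Submodule.span (𝓞 ℚ) s)
    (h : ∀ x ∈ s, ∀ y ∈ s, x * y ∈ Submodule.span (𝓞 ℚ) s) :
    Subalgebra (𝓞 ℚ) ℍ[ℚ,-1,-1] :=
  (Submodule.span (𝓞 ℚ) s).toSubalgebra h1 (by
    intro x y hx hy
    have := Submodule.mul_mem_mul hx hy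
    rw [Submodule.span_mul_span] at this
    refine Submodule.span_le.2 ?_ this
    rintro _ ⟨x, hx, y, hy, rfl⟩
    exact h x hx y hy)

theorem int_comb_mem {v₁ v₂ v₃ v₄ : ℍ[ℚ,-1,-1]} (w : ℍ[ℚ,-1,-1]) (c₁ c₂ c₃ c₄ : ℤ)
    (h : w = c₁ • v₁ + c₂ • v₂ + c₃ • v₃ + c₄ • v₄) :
    w ∈ Submodule.span (𝓞 ℚ) ({v₁, v₂, v₃, v₄} : Set ℍ[ℚ,-1,-1]) := by
  subst h
  refine add_mem (add_mem (add_mem ?_ ?_) ?_) ?_ <;>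
    exact zsmul_mem (Submodule.subset_span (by simp)) _

/-- The basis `1, i, j, k` of the Lipschitz order. -/
def lipschitzBasis : Set ℍ[ℚ,-1,-1] :=
  {⟨1, 0, 0, 0⟩, ⟨0, 1, 0, 0⟩, ⟨0, 0, 1, 0⟩, ⟨0, 0, 0, 1⟩}

/-- The basis `1, i, j, (1 + i + j + k) / 2` of the Hurwitz order. -/
def hurwitzBasis : Set ℍ[ℚ,-1,-1] :=
  {⟨1, 0, 0, 0⟩, ⟨0, 1, 0, 0⟩, ⟨0, 0, 1, 0⟩, ⟨1 / 2, 1 / 2, 1 / 2, 1 / 2⟩}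

theorem exists_of_mem_lipschitzBasis {q : ℍ[ℚ,-1,-1]} (hq : q ∈ lipschitzBasis) :
    ∃ t x y z : ℤ, q = ⟨t, x, y, z⟩ := by
  rcases hq with rfl | rfl | rfl | rfl
  · exact ⟨1, 0, 0, 0, by simp⟩
  · exact ⟨0, 1, 0, 0, by simp⟩
  · exact ⟨0, 0, 1, 0, by simp⟩
  · exact ⟨0, 0, 0, 1, by simp⟩

theorem exists_of_mem_hurwitzBasis {q : ℍ[ℚ,-1,-1]} (hq : q ∈ hurwitzBasis) :
    ∃ t x y z : ℤ, q = ⟨t + z / 2, x + z / 2, y + z / 2, z / 2⟩ := by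
  rcases hq with rfl | rfl | rfl | rfl
  · exact ⟨1, 0, 0, 0, by simp⟩
  · exact ⟨0, 1, 0, 0, by simp⟩
  · exact ⟨0, 0, 1, 0, by simp⟩
  · exact ⟨0, 0, 0, 1, by simp⟩

/-- The Lipschitz order `ℤ ⊕ ℤ i ⊕ ℤ j ⊕ ℤ k` in `(-1, -1 / ℚ)`. -/
def lipschitzOrder : Subalgebra (𝓞 ℚ) ℍ[ℚ,-1,-1] :=
  spanSubalgebra lipschitzBasis
    (Submodule.subset_span (Or.inl rfl))
    (by
      intro p hp q hq
      obtain ⟨t, x, y, z, rfl⟩ := exists_of_mem_lipschitzBasis hp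
      obtain ⟨t', x', y', z', rfl⟩ := exists_of_mem_lipschitzBasis hq
      refine int_comb_mem _ (t * t' - x * x' - y * y' - z * z')
        (t * x' + x * t' + y * z' - z * y') (t * y' - x * z' + y * t' + z * x')
        (t * z' + x * y' - y * x' + z * t') ?_
      ext <;> simp <;> ring)

/-- The Hurwitz order `ℤ ⊕ ℤ i ⊕ ℤ j ⊕ ℤ (1 + i + j + k) / 2` in `(-1, -1 / ℚ)`. -/
def hurwitzOrder : Subalgebra (𝓞 ℚ) ℍ[ℚ,-1,-1] :=
  spanSubalgebra hurwitzBasis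
    (Submodule.subset_span (Or.inl rfl))
    (by
      intro p hp q hq
      obtain ⟨t, x, y, z, rfl⟩ := exists_of_mem_hurwitzBasis hp
      obtain ⟨t', x', y', z', rfl⟩ := exists_of_mem_hurwitzBasis hq
      refine int_comb_mem _
        (t * t' - x * x' - y * y' - x * y' + y * x' - x * z' - z * y' - z * z')
        (t * x' + x * t' - x * y' + y * x' + z * x' + y * z' - z * y')
        (t * y' + y * t' - x * y' + y * x' - x * z' + y * z' + z * x')
        (t * z' + z * t' + z * z' + 2 * x * y' - 2 * y * x' + x * z' + z * y' - y * z' - z * x') ?_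
      ext <;> simp <;> ring)

end HurwitzLipschitz

end

end QuatOrder

/-!
The counting takes place in an abstract `𝓞 K`-algebra `H` with a standard involution
(`StandardInvolution`), free of rank four, definite, and in which every right ideal is principal
(`StandardInvolution.IsDefinitePrincipal`); a maximal order of class number one is such an algebra
(`isDefinitePrincipal`).

Elements of given norm in `H`. Call a prime `q` ramified when the norm form of `H / q H` has a
nonzero vector in its radical; these are the primes dividing the reduced discriminant
(`isRamified_iff`). At an unramified prime with residue field of `N` elements, `H / q H` is a ring
of two by two matrices over the residue field. Its `N + 1` minimal right ideals lift to right
ideals of `H`, which are generated by elements of norm `q`, and an element of norm divisible by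
`q` outside `q H` lies in exactly one of them (`exists_split`). At a ramified prime there is a
single such ideal (`exists_ramified`). Hence every ideal of `𝓞 K` has a totally positive
generator, and it follows that totally positive units are squares
(`exists_sq_eq_of_totallyPositive`), so that the generators of these right ideals can be chosen to
have any prescribed totally positive generator `ϖ` of `q` as their norm. Writing `r` for the
number of elements of given norm, the count of the pairs of an element of norm `ϖ α` and one of
these ideals containing it gives `r (ϖ α) = r α` in the ramified case and
`r (ϖ α) + N * r (α / ϖ) = (N + 1) * r α` in the unramified case, with `r (α / ϖ) = 0` unless `ϖ`
divides `α`. The sum of the norms of the divisors of `α` prime to the discriminant obeys the same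
recursion, and so `r α = r 1 * ∑ Nm δ` over these divisors (`IsDefinitePrincipal.count_eq`).

The suborder `G`. If the index of `G` in `H` is a ramified prime `q`, then `G` contains `q H`, and
the image of `G` in `H / q H` has codimension at most one (`two_lt_finrank_barSubmodule`). Let `P`
be the ideal of the elements of norm divisible by `q`, of codimension two. If `G + P` were `H`,
then, since `G` contains a generator of `P` by perceptivity, `G` would contain `P`, hence be `H`;
so `G` has codimension one and `P ⊆ G` (`IsDefinitePrincipal.suborder_structure`). When `q`
divides `α`, therefore, `G` contains all the elements of norm `α` of `H`. When it does not, for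
every `x` of norm `α` the units `u` of norm one with `u x ∈ G` form a coset of `G¹`
(`ncard_unit_mul_mem`), so that the elements of norm `α` of `G` have the proportion `#G¹ / #H¹`
among those of `H`. The same argument in `H / q H`, applied to the complement of `P`, shows that
this proportion is `1 / (N + 1)`. And `N + 1` is the factor by which allowing the divisors that
are divisible by `q` exactly once enlarges the sum (`normSum_isAdmissible_mul`), and both cases
take the stated form (`IsDefinitePrincipal.ncard_suborder`).

For the Hurwitz order, class number one comes from Euclidean division, and maximality from the
integrality of traces and norms; over `ℚ` the admissible divisors are those not divisible by four.
-/

namespace QuatOrder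

/-! ### Standard involutions -/

/-- A standard involution on an `R`-algebra `S`, together with its reduced trace and reduced norm:
an `R`-linear anti-automorphism `conj` such that `x + conj x` and `x * conj x` are scalars. -/
structure StandardInvolution (R S : Type*) [CommRing R] [Ring S] [Algebra R S] where
  conj : S →ₗ[R] S
  conj_one : conj 1 = 1
  conj_mul : ∀ x y, conj (x * y) = conj y * conj x
  tr : S → R
  algebraMap_tr : ∀ x, algebraMap R S (tr x) = x + conj x
  nm : S → R
  algebraMap_nm : ∀ x, algebraMap R S (nm x) = x * conj x

namespace StandardInvolution

section Basic

variable {R S : Type*} [CommRing R] [Ring S] [Algebra R S] (D : StandardInvolution R S)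

theorem conj_algebraMap (r : R) : D.conj (algebraMap R S r) = algebraMap R S r := by
  rw [Algebra.algebraMap_eq_smul_one, map_smul, D.conj_one]

theorem conj_eq (x : S) : D.conj x = algebraMap R S (D.tr x) - x := by
  rw [D.algebraMap_tr]; abel

@[simp] theorem conj_conj (x : S) : D.conj (D.conj x) = x := by
  rw [D.conj_eq x, map_sub, D.conj_algebraMap, D.conj_eq x]; abel

theorem conj_mul_self (x : S) : D.conj x * x = algebraMap R S (D.nm x) := by
  rw [D.algebraMap_nm, D.conj_eq, sub_mul, mul_sub, Algebra.commutes]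

theorem mul_self (x : S) : x * x = D.tr x • x - algebraMap R S (D.nm x) := by
  rw [D.algebraMap_nm, D.conj_eq, mul_sub, Algebra.smul_def, Algebra.commutes]; abel

theorem isUnit_of_nm {x : S} (hx : IsUnit (D.nm x)) : IsUnit x := by
  obtain ⟨u, hu⟩ := hx
  have h1 : x * (((u⁻¹ : Rˣ) : R) • D.conj x) = 1 := by
    rw [mul_smul_comm, ← D.algebraMap_nm, ← hu, Algebra.smul_def, ← map_mul, Units.inv_mul, map_one]
  have h2 : (((u⁻¹ : Rˣ) : R) • D.conj x) * x = 1 := by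
    rw [smul_mul_assoc, conj_mul_self, ← hu, Algebra.smul_def, ← map_mul, Units.inv_mul, map_one]
  exact ⟨⟨x, _, h1, h2⟩, rfl⟩

theorem conj_mem (G : Subalgebra R S) {x : S} (hx : x ∈ G) : D.conj x ∈ G := by
  rw [D.conj_eq]
  exact sub_mem (G.algebraMap_mem _) hx

variable {D} in
theorem conj_mul_self_of_nm_eq_one {u : S} (hu : D.nm u = 1) : D.conj u * u = 1 := by
  rw [D.conj_mul_self, hu, map_one]

variable {D} in
theorem mul_conj_self_of_nm_eq_one {u : S} (hu : D.nm u = 1) : u * D.conj u = 1 := by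
  rw [← D.algebraMap_nm, hu, map_one]

variable [FaithfulSMul R S]

theorem inj {r s : R} (h : algebraMap R S r = algebraMap R S s) : r = s :=
  FaithfulSMul.algebraMap_injective R S h

@[simp] theorem tr_add (x y : S) : D.tr (x + y) = D.tr x + D.tr y :=
  inj (S := S) (by simp only [map_add, D.algebraMap_tr]; abel)

@[simp] theorem tr_smul (r : R) (x : S) : D.tr (r • x) = r * D.tr x :=
  inj (S := S) (by rw [map_mul, D.algebraMap_tr, D.algebraMap_tr, map_smul, ← smul_add,
    Algebra.smul_def])

@[simp] theorem tr_zero : D.tr 0 = 0 := by simpa using D.tr_smul 0 0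

@[simp] theorem tr_neg (x : S) : D.tr (-x) = -D.tr x := by
  simpa using D.tr_smul (-1) x

@[simp] theorem tr_sub (x y : S) : D.tr (x - y) = D.tr x - D.tr y := by
  rw [sub_eq_add_neg, tr_add, tr_neg, sub_eq_add_neg]

@[simp] theorem tr_conj (x : S) : D.tr (D.conj x) = D.tr x :=
  inj (S := S) (by rw [D.algebraMap_tr, D.algebraMap_tr, conj_conj, add_comm])

@[simp] theorem nm_one : D.nm 1 = 1 :=
  inj (S := S) (by rw [D.algebraMap_nm, D.conj_one, mul_one, map_one])

@[simp] theorem nm_zero : D.nm 0 = 0 :=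
  inj (S := S) (by rw [D.algebraMap_nm, zero_mul, map_zero])

@[simp] theorem nm_mul (x y : S) : D.nm (x * y) = D.nm x * D.nm y := by
  refine inj (S := S) ?_
  rw [D.algebraMap_nm, D.conj_mul, mul_assoc, ← mul_assoc y, ← D.algebraMap_nm,
    Algebra.commutes, ← mul_assoc, ← D.algebraMap_nm, map_mul]

@[simp] theorem nm_conj (x : S) : D.nm (D.conj x) = D.nm x :=
  inj (S := S) (by rw [D.algebraMap_nm, conj_conj, conj_mul_self])

@[simp] theorem nm_algebraMap (r : R) : D.nm (algebraMap R S r) = r ^ 2 :=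
  inj (S := S) (by rw [D.algebraMap_nm, conj_algebraMap, map_pow, sq])

@[simp] theorem nm_smul (r : R) (x : S) : D.nm (r • x) = r ^ 2 * D.nm x := by
  rw [Algebra.smul_def, nm_mul, nm_algebraMap]

theorem nm_neg (x : S) : D.nm (-x) = D.nm x := by
  simpa using D.nm_smul (-1) x

theorem nm_add (x y : S) : D.nm (x + y) = D.nm x + D.nm y + D.tr (x * D.conj y) := by
  refine inj (S := S) ?_
  simp only [map_add, D.algebraMap_nm, D.algebraMap_tr, D.conj_mul, conj_conj, add_mul, mul_add]
  abel

theorem tr_mul_comm (x y : S) : D.tr (x * y) = D.tr (y * x) := by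
  have key : ∀ x y, D.tr (x * D.conj y) = D.tr (D.conj x * y) := by
    intro x y
    have h := D.nm_conj (x + y)
    rw [map_add, D.nm_add, D.nm_add, nm_conj, nm_conj, conj_conj] at h
    linear_combination -h
  have h := key x (D.conj y)
  rw [conj_conj] at h
  rw [h, ← D.tr_conj, D.conj_mul, conj_conj, conj_conj]

end Basic

/-! ### Four-dimensional algebras with a standard involution over a finite field -/

section FiniteField

open Module

variable {F B : Type*} [Field F] [Finite F] [Ring B] [Algebra F B]
  (D : StandardInvolution F B)

/-- The norm form has a nonzero vector in its radical: this is what happens modulo the primes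
dividing the reduced discriminant. -/
def IsDegenerate : Prop := ∃ w, w ≠ 0 ∧ D.nm w = 0 ∧ ∀ y, D.tr (w * y) = 0

variable [Nontrivial B]

/-- In a nondegenerate algebra the trace form is nondegenerate, in characteristic two as well. If
the unit `x` were orthogonal to everything, the trace would vanish and the norm would be additive;
being defined on a larger group than `F`, it would have a nonzero kernel, made of radical
vectors. -/
theorem exists_tr_mul_ne_zero (hB : finrank F B = 4) (hD : ¬ D.IsDegenerate) {x : B}
    (hx : x ≠ 0) : ∃ y, D.tr (x * y) ≠ 0 := by
  by_contra! h
  have hnx : D.nm x ≠ 0 := fun h0 => hD ⟨x, hx, h0, h⟩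
  obtain ⟨u, rfl⟩ := D.isUnit_of_nm (isUnit_iff_ne_zero.2 hnx)
  have htr : ∀ y, D.tr y = 0 := fun y => by simpa using h (((u⁻¹ : Bˣ) : B) * y)
  let f : B →+ F :=
    { toFun := D.nm
      map_zero' := D.nm_zero
      map_add' := fun x y => by rw [D.nm_add, htr, add_zero] }
  have : ¬ Function.Injective f := by
    intro hf
    have : Module.Finite F B := Module.finite_of_finrank_pos (by omega)
    have h1 := Nat.card_le_card_of_injective f hf
    rw [Module.natCard_eq_pow_finrank (K := F) (V := B), hB] at h1
    have h2 : 1 < Nat.card F := Finite.one_lt_card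
    have h3 := Nat.pow_lt_pow_right h2 (show 1 < 4 by norm_num)
    rw [pow_one] at h3
    omega
  rw [injective_iff_map_eq_zero] at this
  push Not at this
  obtain ⟨w, hw, hw0⟩ := this
  exact hD ⟨w, hw0, hw, fun y => htr _⟩

/-- A finite division algebra is a field, generated by one element, and each element is quadratic
over `F`; so an anisotropic norm form is impossible in dimension four. -/
theorem exists_nm_eq_zero (hB : finrank F B = 4) : ∃ x, x ≠ 0 ∧ D.nm x = 0 := by
  by_contra! h
  have hfin : Module.Finite F B := Module.finite_of_finrank_pos (by omega)
  have : Finite B := Module.finite_of_finite F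
  have hdom : NoZeroDivisors B := ⟨by
    intro x y hxy
    by_contra! hne
    obtain ⟨u, rfl⟩ := D.isUnit_of_nm (isUnit_iff_ne_zero.2 (h x hne.1))
    exact hne.2 (by simpa using hxy)⟩
  have : IsDomain B := NoZeroDivisors.to_isDomain B
  have hfield : IsField B := Finite.isDomain_to_isField B
  let _ : Field B := { hfield.toField with toRing := ‹Ring B› }
  obtain ⟨α, hα⟩ := Field.exists_primitive_element_of_finite_top F B
  have hint : IsIntegral F α := Algebra.IsIntegral.isIntegral α
  have h1 := IntermediateField.adjoin.finrank hint
  rw [hα, IntermediateField.finrank_top', hB] at h1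
  have h2 : (minpoly F α).degree ≤ (Polynomial.X ^ 2 - Polynomial.C (D.tr α) * Polynomial.X
      + Polynomial.C (D.nm α) : Polynomial F).degree := by
    apply minpoly.min
    · monicity!
    · simp only [map_add, map_sub, map_mul, map_pow, Polynomial.aeval_X, Polynomial.aeval_C]
      rw [sq, D.mul_self, Algebra.smul_def]
      ring
  have h3 : (Polynomial.X ^ 2 - Polynomial.C (D.tr α) * Polynomial.X
      + Polynomial.C (D.nm α) : Polynomial F).degree ≤ 2 := by compute_degree
  have h4 := Polynomial.natDegree_le_of_degree_le (n := 2) (h2.trans h3)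
  omega

/-- Matrix units: a nondegenerate algebra contains a nontrivial idempotent `e` whose two corners are
exchanged by elements `u` and `v`. -/
theorem exists_matrix_units (hB : finrank F B = 4) (hD : ¬ D.IsDegenerate) :
    ∃ (e u v : B) (c : F), c ≠ 0 ∧ e * e = e ∧ D.conj e = 1 - e ∧ e * u = u ∧ u * e = 0 ∧
      v * e = v ∧ u * v = c • e ∧ v * u = c • (1 - e) ∧ (∀ b, ∃ d : F, e * b * e = d • e) ∧
      e ≠ 0 := by
  have corner : ∀ e : B, e * e = e → D.conj e = 1 - e → ∀ b, e * b * e = D.tr (b * e) • e := by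
    intro e he hce b
    have h1 := D.algebraMap_tr (e * b * e)
    rw [D.tr_mul_comm, ← mul_assoc, he, D.tr_mul_comm e b, D.conj_mul, D.conj_mul,
      hce] at h1
    have h2 : e * ((1 - e) * (D.conj b * (1 - e))) = 0 := by
      rw [← mul_assoc, mul_sub, he, mul_one, sub_self, zero_mul]
    have h3 : algebraMap F B (D.tr (b * e)) * e = e * (algebraMap F B (D.tr (b * e))) :=
      Algebra.commutes _ _
    rw [Algebra.smul_def, h3, h1, mul_add, h2, add_zero, ← mul_assoc,
      ← mul_assoc, he]
  -- One nonzero off-diagonal element `v` suffices: nondegeneracy provides its partner `u`.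
  have build : ∀ e v : B, e * e = e → D.conj e = 1 - e → v ≠ 0 → v * e = v → e * v = 0 →
      ∃ (e u v : B) (c : F), c ≠ 0 ∧ e * e = e ∧ D.conj e = 1 - e ∧ e * u = u ∧ u * e = 0 ∧
      v * e = v ∧ u * v = c • e ∧ v * u = c • (1 - e) ∧ (∀ b, ∃ d : F, e * b * e = d • e) ∧
      e ≠ 0 := by
    intro e v he hce hv hve hev
    obtain ⟨y, hy⟩ := D.exists_tr_mul_ne_zero hB hD hv
    have he1 : (1 - e) * (1 - e) = 1 - e := by
      rw [mul_sub, sub_mul, sub_mul, he]; simp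
    have hce1 : D.conj (1 - e) = 1 - (1 - e) := by
      rw [map_sub, D.conj_one, hce]
    have h1v : (1 - e) * v = v := by rw [sub_mul, hev, one_mul, sub_zero]
    refine ⟨e, e * y * (1 - e), v, D.tr (v * y), hy, he, hce, ?_, ?_, hve, ?_, ?_,
      fun b => ⟨_, corner e he hce b⟩, ?_⟩
    · rw [← mul_assoc, ← mul_assoc, he]
    · rw [mul_assoc, sub_mul, he, one_mul, sub_self, mul_zero]
    · rw [mul_assoc, h1v]
      have := corner e he hce (y * v)
      rw [mul_assoc, mul_assoc, hve, D.tr_mul_comm y] at this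
      rw [mul_assoc, this]
    · have := corner (1 - e) he1 hce1 (v * y)
      rw [← mul_assoc, ← mul_assoc, hve]
      rw [← mul_assoc, h1v, D.tr_mul_comm, ← mul_assoc, h1v] at this
      exact this
    · rintro rfl
      exact hv (by simpa using hve.symm)
  -- A multiple of an isotropic vector, scaled to have trace one, is idempotent.
  obtain ⟨x, hx, hnx⟩ := D.exists_nm_eq_zero hB
  obtain ⟨y, hy⟩ := D.exists_tr_mul_ne_zero hB hD hx
  set t := D.tr (x * y) with ht
  set e : B := t⁻¹ • (x * y) with hedef
  have hte : D.tr e = 1 := by rw [hedef, D.tr_smul, ← ht, inv_mul_cancel₀ hy]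
  have hne : D.nm e = 0 := by simp [hedef, hnx]
  have he : e * e = e := by rw [D.mul_self, hte, hne]; simp
  have hce : D.conj e = 1 - e := by rw [D.conj_eq, hte, map_one]
  have he1 : (1 - e) * (1 - e) = 1 - e := by
    rw [mul_sub, sub_mul, sub_mul, he]; simp
  have hce1 : D.conj (1 - e) = 1 - (1 - e) := by
    rw [map_sub, D.conj_one, hce]
  by_cases h1 : ∃ b, (1 - e) * b * e ≠ 0
  · obtain ⟨b, hb⟩ := h1
    refine build e _ he hce hb ?_ ?_
    · rw [mul_assoc, he]
    · rw [← mul_assoc, ← mul_assoc, mul_sub, he]; simp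
  by_cases h2 : ∃ b, e * b * (1 - e) ≠ 0
  · obtain ⟨b, hb⟩ := h2
    refine build (1 - e) _ he1 hce1 hb ?_ ?_
    · rw [mul_assoc, he1]
    · rw [← mul_assoc, ← mul_assoc, sub_mul, he]; simp
  -- If both off-diagonal corners vanished, `e` and `1 - e` would span the algebra.
  push Not at h1 h2
  exfalso
  have htop : Submodule.span F (Set.range ![e, 1 - e]) = ⊤ := by
    rw [eq_top_iff]
    intro b _
    have hb : b = e * b * e + (1 - e) * b * (1 - e) := by
      have h3 : b = e * b * e + e * b * (1 - e) + (1 - e) * b * e + (1 - e) * b * (1 - e) := by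
        noncomm_ring
      rw [h1, h2, add_zero, add_zero] at h3
      exact h3
    rw [hb, corner e he hce, corner (1 - e) he1 hce1]
    refine add_mem (Submodule.smul_mem _ _ (Submodule.subset_span ⟨0, rfl⟩))
      (Submodule.smul_mem _ _ (Submodule.subset_span ⟨1, rfl⟩))
  have := finrank_range_le_card (R := F) ![e, 1 - e]
  rw [Set.finrank, htop, finrank_top, hB] at this
  simp at this

end FiniteField

end StandardInvolution

namespace StandardInvolution

open Module
open scoped LinearAlgebra.Projectivization

variable {F B : Type*} [Field F] [Finite F] [Ring B] [Algebra F B]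
  (D : StandardInvolution F B) [Nontrivial B]

/-- A nondegenerate algebra acts faithfully on a plane `L`, so that it is a matrix algebra; the
right ideals listed are those of the elements mapping `L` into a given line. -/
theorem exists_rightIdeals (hB : finrank F B = 4) (hD : ¬ D.IsDegenerate) :
    ∃ I : Fin (Nat.card F + 1) → Submodule F B,
      (∀ l, ∀ x ∈ I l, ∀ b, x * b ∈ I l) ∧
      (∀ l, ∀ x ∈ I l, D.nm x = 0) ∧
      (∀ l, ∃ x ∈ I l, x ≠ 0) ∧
      (∀ x, x ≠ 0 → D.nm x = 0 → ∃! l, x ∈ I l) := by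
  obtain ⟨e, u, v, c, hc, he, hce, heu, hue, hve, huv, hvu, hcorner, he0⟩ :=
    D.exists_matrix_units hB hD
  have hfin : Module.Finite F B := Module.finite_of_finrank_pos (by omega)
  -- The plane is `L = B e`, with basis `e`, `v`.
  let L : Submodule B B := Submodule.span B {e}
  have memL : ∀ y, y ∈ L ↔ y * e = y := by
    intro y
    rw [Submodule.mem_span_singleton]
    constructor
    · rintro ⟨a, rfl⟩
      rw [smul_eq_mul, mul_assoc, he]
    · intro h
      exact ⟨y, h⟩
  have heL : e ∈ L := (memL e).2 he
  have hvL : v ∈ L := (memL v).2 hve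
  -- Multiplication by `u` and by `v` exchanges `B e` and `B (1 - e)`, up to scalars.
  have hL : finrank F L = 2 := by
    let f : B →ₗ[F] B := LinearMap.mulRight F e
    let g : B →ₗ[F] B := LinearMap.mulRight F u
    let h : B →ₗ[F] B := LinearMap.mulRight F v
    have hrange : L.restrictScalars F = LinearMap.range f := by
      ext y
      rw [Submodule.restrictScalars_mem, memL]
      constructor
      · intro h
        exact ⟨y, h⟩
      · rintro ⟨a, rfl⟩
        simp [f, mul_assoc, he]
    have hsum := LinearMap.finrank_range_add_finrank_ker f
    have hle1 : finrank F (LinearMap.range f) ≤ finrank F (LinearMap.ker f) := by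
      let φ : LinearMap.range f →ₗ[F] LinearMap.ker f :=
        (g.comp (LinearMap.range f).subtype).codRestrict _ (by
          rintro ⟨_, a, rfl⟩
          simp [f, g, mul_assoc, hue])
      refine LinearMap.finrank_le_finrank_of_injective (f := φ) ?_
      rw [injective_iff_map_eq_zero]
      rintro ⟨_, a, rfl⟩ h0
      have h1 : a * e * u = 0 := congrArg Subtype.val h0
      have h2 : c • (a * e) = 0 := by
        calc c • (a * e) = a * (c • e) * 1 := by simp
          _ = a * (e * u * v) * 1 := by rw [heu, huv]
          _ = (a * e * u) * v := by noncomm_ring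
          _ = 0 := by rw [h1, zero_mul]
      exact Subtype.ext ((smul_eq_zero.1 h2).resolve_left hc)
    have hle2 : finrank F (LinearMap.ker f) ≤ finrank F (LinearMap.range f) := by
      let φ : LinearMap.ker f →ₗ[F] LinearMap.range f :=
        (h.comp (LinearMap.ker f).subtype).codRestrict _ (by
          rintro ⟨a, ha⟩
          exact ⟨a * v, by simp [f, h, mul_assoc, hve]⟩)
      refine LinearMap.finrank_le_finrank_of_injective (f := φ) ?_
      rw [injective_iff_map_eq_zero]
      rintro ⟨a, ha⟩ h0
      have h1 : a * v = 0 := congrArg Subtype.val h0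
      have h2 : a * e = 0 := ha
      have h3 : c • a = 0 := by
        calc c • a = a * (c • (1 - e)) + c • (a * e) := by
              rw [mul_smul_comm, ← smul_add, mul_sub, mul_one, sub_add_cancel]
          _ = 0 := by rw [← hvu, ← mul_assoc, h1, h2]; simp
      exact Subtype.ext ((smul_eq_zero.1 h3).resolve_left hc)
    have : finrank F L = finrank F (L.restrictScalars F) := rfl
    rw [this, hrange]
    omega
  have hLfin : Module.Finite F L := Module.finite_of_finrank_pos (by omega)
  let φ : B →ₐ[F] Module.End F L := Algebra.lsmul F F L
  have hφ : ∀ b (y : L), ((φ b y : L) : B) = b * y := fun b y => rfl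
  have faithful : ∀ b, φ b = 0 → b = 0 := by
    intro b hb
    have h1 : b * e = 0 := by
      have := hφ b ⟨e, heL⟩
      rw [hb] at this
      exact this.symm
    have h2 : b * v = 0 := by
      have := hφ b ⟨v, hvL⟩
      rw [hb] at this
      exact this.symm
    have h3 : c • b = 0 := by
      calc c • b = b * (c • (1 - e)) + c • (b * e) := by
            rw [mul_smul_comm, ← smul_add, mul_sub, mul_one, sub_add_cancel]
        _ = 0 := by rw [← hvu, ← mul_assoc, h1, h2]; simp
    exact (smul_eq_zero.1 h3).resolve_left hc
  let I' : ℙ F L → Submodule F B := fun l =>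
    { carrier := {b | LinearMap.range (φ b) ≤ l.submodule}
      add_mem' := by
        rintro a b ha hb _ ⟨y, rfl⟩
        rw [map_add, LinearMap.add_apply]
        exact add_mem (ha ⟨y, rfl⟩) (hb ⟨y, rfl⟩)
      zero_mem' := by
        rintro _ ⟨y, rfl⟩
        simp
      smul_mem' := by
        rintro r b hb _ ⟨y, rfl⟩
        rw [map_smul, LinearMap.smul_apply]
        exact Submodule.smul_mem _ _ (hb ⟨y, rfl⟩) }
  have memI : ∀ l b, b ∈ I' l ↔ LinearMap.range (φ b) ≤ l.submodule := fun l b => Iff.rfl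
  have : Finite L := Module.finite_of_finite F
  have hcard : Nat.card (ℙ F L) = Nat.card F + 1 := Projectivization.card_of_finrank_two F L hL
  have hfP : Finite (ℙ F L) := Nat.finite_of_card_ne_zero (by omega)
  let E : Fin (Nat.card F + 1) ≃ ℙ F L := (Finite.equivFinOfCardEq hcard).symm
  refine ⟨fun l => I' (E l), ?_, ?_, ?_, ?_⟩
  · intro l x hx b
    rw [memI] at hx ⊢
    rw [map_mul]
    exact (LinearMap.range_comp_le_range _ _).trans hx
  · intro l x hx
    rw [memI] at hx
    by_contra hne
    obtain ⟨⟨x, x', h1, h2⟩, rfl⟩ := D.isUnit_of_nm (isUnit_iff_ne_zero.2 hne)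
    have htop : LinearMap.range (φ x) = ⊤ := by
      rw [LinearMap.range_eq_top]
      intro y
      refine ⟨φ x' y, ?_⟩
      rw [← Module.End.mul_apply, ← map_mul, h1, map_one, Module.End.one_apply]
    rw [htop, top_le_iff] at hx
    have := (E l).finrank_submodule
    rw [hx, finrank_top, hL] at this
    omega
  · intro l
    obtain ⟨w, hw0, hw⟩ : ∃ w : L, w ≠ 0 ∧ (E l).submodule = F ∙ w :=
      ⟨(E l).rep, (E l).rep_nonzero, (E l).submodule_eq⟩
    refine ⟨w, ?_, by simpa using hw0⟩
    rw [memI, hw]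
    rintro _ ⟨y, rfl⟩
    obtain ⟨d, hd⟩ := hcorner y
    rw [Submodule.mem_span_singleton]
    refine ⟨d, Subtype.ext ?_⟩
    rw [hφ, Submodule.coe_smul_of_tower]
    have h1 := (memL w).1 w.2
    have h2 := (memL y).1 y.2
    calc d • (w : B) = (w : B) * (d • e) := by rw [mul_smul_comm, h1]
      _ = (w * e) * (y * e) := by rw [← hd]; noncomm_ring
      _ = w * y := by rw [h1, h2]
  · intro x hx hnx
    have hcx : φ (D.conj x) ≠ 0 := by
      intro h
      apply hx
      rw [← D.conj_conj x, faithful _ h, map_zero]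
    have hx' : φ x ≠ 0 := fun h => hx (faithful _ h)
    have hlt : finrank F (LinearMap.range (φ x)) < 2 := by
      by_contra! hge
      have htop : LinearMap.range (φ x) = ⊤ := by
        apply Submodule.eq_top_of_finrank_eq
        have := (LinearMap.range (φ x)).finrank_le
        omega
      apply hcx
      ext y
      obtain ⟨z, rfl⟩ := LinearMap.range_eq_top.1 htop y
      rw [← Module.End.mul_apply, ← map_mul, D.conj_mul_self, hnx]
      simp
    obtain ⟨y, hy⟩ : ∃ y, φ x y ≠ 0 := by
      by_contra! h
      exact hx' (LinearMap.ext h)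
    have hspan : LinearMap.range (φ x) = F ∙ (φ x y) := by
      symm
      apply Submodule.eq_of_le_of_finrank_le
      · rw [Submodule.span_singleton_le_iff_mem]
        exact ⟨y, rfl⟩
      · rw [finrank_span_singleton hy]
        omega
    have key : ∀ l, x ∈ I' l ↔ l = Projectivization.mk F (φ x y) hy := by
      intro l
      rw [memI, hspan]
      constructor
      · intro h
        apply Projectivization.submodule_injective
        rw [Projectivization.submodule_mk]
        symm
        apply Submodule.eq_of_le_of_finrank_le h
        rw [finrank_span_singleton hy, l.finrank_submodule]
      · rintro rfl
        rw [Projectivization.submodule_mk]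
    refine ⟨E.symm (Projectivization.mk F (φ x y) hy), ?_, ?_⟩
    · change x ∈ I' _
      rw [key, E.apply_symm_apply]
    · intro l hl
      rw [← (key _).1 hl, E.symm_apply_apply]

end StandardInvolution

namespace StandardInvolution

/-! ### Reduction modulo a prime of the base ring -/

section Map

variable {R S F B : Type*} [CommRing R] [Ring S] [Algebra R S] [CommRing F] [Ring B] [Algebra F B]
  (D : StandardInvolution R S)

/-- The standard involution induced on a quotient of `S` by a `conj`-stable ideal. -/
noncomputable def map (f : R →+* F) (g : S →+* B) (hf : Function.Surjective f)
    (hg : Function.Surjective g)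
    (hfg : ∀ r, g (algebraMap R S r) = algebraMap F B (f r))
    (hker : ∀ x, g x = 0 → g (D.conj x) = 0) : StandardInvolution F B :=
  have key : ∀ x, g (D.conj (Function.surjInv hg (g x))) = g (D.conj x) := by
    intro x
    rw [← sub_eq_zero, ← map_sub, ← map_sub]
    apply hker
    rw [map_sub, Function.surjInv_eq hg, sub_self]
  { conj :=
      { toFun := fun b => g (D.conj (Function.surjInv hg b))
        map_add' := by
          intro a b
          obtain ⟨a, rfl⟩ := hg a
          obtain ⟨b, rfl⟩ := hg b
          rw [← map_add, key, key, key, map_add, map_add]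
        map_smul' := by
          intro r a
          obtain ⟨a, rfl⟩ := hg a
          obtain ⟨r, rfl⟩ := hf r
          have h : ∀ y, f r • g y = g (r • y) := by
            intro y
            rw [Algebra.smul_def, Algebra.smul_def, map_mul, hfg]
          rw [RingHom.id_apply, h, key, key, h, map_smul] }
    conj_one := by
      change g (D.conj (Function.surjInv hg 1)) = 1
      rw [← map_one g, key, D.conj_one]
    conj_mul := by
      intro a b
      obtain ⟨a, rfl⟩ := hg a
      obtain ⟨b, rfl⟩ := hg b
      change g (D.conj (Function.surjInv hg _)) = g (D.conj (Function.surjInv hg _)) *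
        g (D.conj (Function.surjInv hg _))
      rw [← map_mul, key, key, key, D.conj_mul, map_mul]
    tr := fun b => f (D.tr (Function.surjInv hg b))
    algebraMap_tr := by
      intro b
      rw [← hfg, D.algebraMap_tr, map_add, Function.surjInv_eq hg]
      rfl
    nm := fun b => f (D.nm (Function.surjInv hg b))
    algebraMap_nm := by
      intro b
      rw [← hfg, D.algebraMap_nm, map_mul, Function.surjInv_eq hg]
      rfl }

variable {f : R →+* F} {g : S →+* B} (hf : Function.Surjective f)
    (hg : Function.Surjective g)
    (hfg : ∀ r, g (algebraMap R S r) = algebraMap F B (f r))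
    (hker : ∀ x, g x = 0 → g (D.conj x) = 0)

theorem map_conj (x : S) : (D.map f g hf hg hfg hker).conj (g x) = g (D.conj x) := by
  change g (D.conj (Function.surjInv hg (g x))) = g (D.conj x)
  rw [← sub_eq_zero, ← map_sub, ← map_sub]
  apply hker
  rw [map_sub, Function.surjInv_eq hg, sub_self]

variable [FaithfulSMul F B]

theorem map_tr (x : S) : (D.map f g hf hg hfg hker).tr (g x) = f (D.tr x) := by
  refine inj (S := B) ?_
  rw [algebraMap_tr, map_conj, ← hfg, D.algebraMap_tr, map_add]

theorem map_nm (x : S) : (D.map f g hf hg hfg hker).nm (g x) = f (D.nm x) := by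
  refine inj (S := B) ?_
  rw [algebraMap_nm, map_conj, ← hfg, D.algebraMap_nm, map_mul]

end Map

section Reduction

variable {R : Type*} (H : Type*) [CommRing R] [Ring H] [Algebra R H] (q : Ideal R)

/-- The two-sided ideal `q H`. -/
def extIdeal : Ideal H where
  carrier := (q • (⊤ : Submodule R H) : Submodule R H)
  add_mem' := fun ha hb => add_mem ha hb
  zero_mem' := zero_mem _
  smul_mem' := by
    intro h x hx
    have hx' : x ∈ q • (⊤ : Submodule R H) := hx
    change h * x ∈ q • (⊤ : Submodule R H)
    refine Submodule.smul_induction_on hx' (fun r hr n _ => ?_) (fun a b ha hb => ?_)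
    · rw [mul_smul_comm]
      exact Submodule.smul_mem_smul hr Submodule.mem_top
    · rw [mul_add]
      exact add_mem ha hb

theorem mem_extIdeal {x : H} : x ∈ extIdeal H q ↔ x ∈ q • (⊤ : Submodule R H) := Iff.rfl

instance : (extIdeal H q).IsTwoSided where
  mul_mem_of_left := by
    intro x h hx
    have hx' : x ∈ q • (⊤ : Submodule R H) := hx
    change x * h ∈ q • (⊤ : Submodule R H)
    refine Submodule.smul_induction_on hx' (fun r hr n _ => ?_) (fun a b ha hb => ?_)
    · rw [smul_mul_assoc]
      exact Submodule.smul_mem_smul hr Submodule.mem_top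
    · rw [add_mul]
      exact add_mem ha hb

theorem smul_mem_extIdeal {r : R} (hr : r ∈ q) (x : H) : r • x ∈ extIdeal H q :=
  (mem_extIdeal H q).2 (Submodule.smul_mem_smul hr Submodule.mem_top)

theorem algebraMap_mem_extIdeal {r : R} (hr : r ∈ q) : algebraMap R H r ∈ extIdeal H q := by
  rw [Algebra.algebraMap_eq_smul_one]
  exact smul_mem_extIdeal H q hr 1

instance : Algebra (R ⧸ q) (H ⧸ extIdeal H q) :=
  RingHom.toAlgebra' (Ideal.Quotient.lift q
    ((Ideal.Quotient.mk (extIdeal H q)).comp (algebraMap R H)) (fun r hr => by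
      rw [RingHom.comp_apply, Ideal.Quotient.eq_zero_iff_mem]
      exact algebraMap_mem_extIdeal H q hr)) (by
    intro r x
    obtain ⟨r, rfl⟩ := Ideal.Quotient.mk_surjective r
    obtain ⟨x, rfl⟩ := Ideal.Quotient.mk_surjective x
    rw [Ideal.Quotient.lift_mk, RingHom.comp_apply, ← map_mul, ← map_mul, Algebra.commutes])

theorem mk_algebraMap (r : R) : Ideal.Quotient.mk (extIdeal H q) (algebraMap R H r) =
    algebraMap (R ⧸ q) (H ⧸ extIdeal H q) (Ideal.Quotient.mk q r) := rfl

theorem mk_smul_mk (r : R) (x : H) : Ideal.Quotient.mk q r • Ideal.Quotient.mk (extIdeal H q) x =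
    Ideal.Quotient.mk (extIdeal H q) (r • x) := by
  rw [Algebra.smul_def, Algebra.smul_def, map_mul, mk_algebraMap]

theorem mem_extIdeal_of_smul_mem {q : Ideal R} (hq : q.IsMaximal) {r : R} (hr : r ∉ q) {x : H}
    (hx : r • x ∈ extIdeal H q) : x ∈ extIdeal H q := by
  obtain ⟨s, hs⟩ := hq.exists_inv hr
  obtain ⟨t, ht, h⟩ := hs
  have : x = s • (r • x) + t • x := by
    rw [smul_smul, ← add_smul, h, one_smul]
  rw [this]
  refine add_mem ?_ (smul_mem_extIdeal H q ht x)
  rw [mem_extIdeal] at hx ⊢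
  exact Submodule.smul_mem _ _ hx

section Finrank

variable [IsDomain R] [Module.Flat R H] [Module.Finite R H] [q.IsMaximal]

open TensorProduct in
theorem card_quotient_extIdeal :
    Nat.card (H ⧸ extIdeal H q) = Nat.card (R ⧸ q) ^ Module.finrank R H := by
  let k := q.ResidueField
  let e1 : (R ⧸ q) ≃ₗ[R] k := (AlgEquiv.ofBijective (IsScalarTower.toAlgHom R (R ⧸ q) k)
    q.bijective_algebraMap_quotient_residueField).toLinearEquiv
  let e2 : (R ⧸ q) ⊗[R] H ≃ₗ[R] k ⊗[R] H := TensorProduct.congr e1 (LinearEquiv.refl R H)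
  have h1 : Nat.card (H ⧸ extIdeal H q) = Nat.card (H ⧸ q • (⊤ : Submodule R H)) := rfl
  rw [h1, ← Nat.card_congr (TensorProduct.quotTensorEquivQuotSMul H q).toEquiv,
    Nat.card_congr e2.toEquiv, Nat.card_congr e1.toEquiv, ← Ideal.finrank_fiber_eq_finrank q]
  exact Module.natCard_eq_pow_finrank (K := k) (V := k ⊗[R] H)

theorem finrank_quotient_extIdeal [Finite (R ⧸ q)] :
    letI := Ideal.Quotient.field q
    Module.finrank (R ⧸ q) (H ⧸ extIdeal H q) = Module.finrank R H := by
  let _ := Ideal.Quotient.field q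
  have h1 := card_quotient_extIdeal H q
  have h3 : 1 < Nat.card (R ⧸ q) := Finite.one_lt_card
  have : Finite (H ⧸ extIdeal H q) := by
    apply Nat.finite_of_card_ne_zero
    rw [h1]
    positivity
  have h2 := Module.natCard_eq_pow_finrank (K := R ⧸ q) (V := H ⧸ extIdeal H q)
  exact Nat.pow_right_injective h3 (by simpa using h2.symm.trans h1)

end Finrank

end Reduction

end StandardInvolution

namespace StandardInvolution

/-! ### Orders whose right ideals are principal, at a prime of the base ring -/

/-- Every nonzero right ideal is principal. -/
def IsRightPrincipal (R H : Type*) [CommRing R] [Ring H] [Algebra R H] : Prop :=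
  ∀ I : Submodule R H, (∀ x ∈ I, ∀ h, x * h ∈ I) → I ≠ ⊥ → ∃ x, ∀ y, y ∈ I ↔ ∃ h, y = x * h

/-- If `I = (c, d)` then `I ^ 3 = (c ^ 2, d ^ 2) I`, whence `I ^ 2` is generated by squares. -/
theorem dvd_sq_of_forall_sq_mem {R : Type*} [CommRing R] [IsDedekindDomain R] {I J : Ideal R}
    (hI : I ≠ ⊥) (h : ∀ c ∈ I, c ^ 2 ∈ J) : J ∣ I ^ 2 := by
  obtain ⟨c, hc, hc0⟩ := Submodule.exists_mem_ne_zero_of_ne_bot hI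
  obtain ⟨d, rfl⟩ := IsDedekindDomain.exists_eq_span_pair hc hc0
  set I : Ideal R := Ideal.span {c, d} with hIdef
  have hd : d ∈ I := Ideal.subset_span (by simp)
  have key : I ^ 2 * I ≤ J * I := by
    have h1 : ∀ x ∈ I, c ^ 2 * x ∈ J * I := fun x hx => Ideal.mul_mem_mul (h c hc) hx
    have h2 : ∀ x ∈ I, d ^ 2 * x ∈ J * I := fun x hx => Ideal.mul_mem_mul (h d hd) hx
    have h3 : ∀ x ∈ I, c * d * x ∈ J * I := by
      intro x hx
      obtain ⟨a, b, rfl⟩ := Ideal.mem_span_pair.1 hx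
      have := add_mem (Ideal.mul_mem_left _ a (h1 d hd)) (Ideal.mul_mem_left _ b (h2 c hc))
      convert! this using 1
      ring
    rw [sq, mul_assoc, Ideal.mul_le]
    intro r hr s hs
    refine Submodule.mul_induction_on hs (fun m hm x hx => ?_) (fun u v hu hv => ?_)
    · obtain ⟨a, b, rfl⟩ := Ideal.mem_span_pair.1 hr
      obtain ⟨a', b', rfl⟩ := Ideal.mem_span_pair.1 hm
      have := add_mem (add_mem (Ideal.mul_mem_left _ (a * a') (h1 x hx))
        (Ideal.mul_mem_left _ (b * b') (h2 x hx)))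
        (Ideal.mul_mem_left _ (a * b' + b * a') (h3 x hx))
      convert! this using 1
      ring
    · rw [mul_add]
      exact add_mem hu hv
  rw [← Ideal.dvd_iff_le] at key
  exact (mul_dvd_mul_iff_right hI).1 key

variable {R H : Type*} [CommRing R] [Ring H] [Algebra R H] (D : StandardInvolution R H)
  (q : Ideal R)

theorem conj_mem_extIdeal {x : H} (hx : x ∈ extIdeal H q) : D.conj x ∈ extIdeal H q := by
  rw [mem_extIdeal] at hx ⊢
  refine Submodule.smul_induction_on hx (fun r hr n _ => ?_) (fun a b ha hb => ?_)
  · rw [map_smul]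
    exact Submodule.smul_mem_smul hr Submodule.mem_top
  · rw [map_add]
    exact add_mem ha hb

/-- The reduction of a standard involution modulo an ideal of the base ring. -/
noncomputable def reduce : StandardInvolution (R ⧸ q) (H ⧸ extIdeal H q) :=
  D.map (Ideal.Quotient.mk q) (Ideal.Quotient.mk (extIdeal H q)) Ideal.Quotient.mk_surjective
    Ideal.Quotient.mk_surjective (mk_algebraMap H q) (fun x hx => by
      rw [Ideal.Quotient.eq_zero_iff_mem] at hx ⊢
      exact D.conj_mem_extIdeal q hx)

/-- A prime is ramified when the norm form modulo it has a nonzero vector in its radical; for orders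
with principal right ideals these are the divisors of the reduced discriminant, by
`isRamified_iff`. -/
def IsRamified : Prop := ∃ w, w ∉ extIdeal H q ∧ D.nm w ∈ q ∧ ∀ y, D.tr (w * y) ∈ q

section Reduce

variable [FaithfulSMul (R ⧸ q) (H ⧸ extIdeal H q)]

theorem reduce_nm (x : H) :
    (D.reduce q).nm (Ideal.Quotient.mk _ x) = Ideal.Quotient.mk q (D.nm x) := map_nm ..

theorem reduce_tr (x : H) :
    (D.reduce q).tr (Ideal.Quotient.mk _ x) = Ideal.Quotient.mk q (D.tr x) := map_tr ..

theorem isDegenerate_reduce_iff [q.IsMaximal] :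
    letI := Ideal.Quotient.field q
    (D.reduce q).IsDegenerate ↔ D.IsRamified q := by
  let _ := Ideal.Quotient.field q
  constructor
  · rintro ⟨w, hw, hn, ht⟩
    obtain ⟨w, rfl⟩ := Ideal.Quotient.mk_surjective w
    refine ⟨w, ?_, ?_, fun y => ?_⟩
    · rwa [ne_eq, Ideal.Quotient.eq_zero_iff_mem] at hw
    · rwa [reduce_nm, Ideal.Quotient.eq_zero_iff_mem] at hn
    · have := ht (Ideal.Quotient.mk _ y)
      rwa [← map_mul, reduce_tr, Ideal.Quotient.eq_zero_iff_mem] at this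
  · rintro ⟨w, hw, hn, ht⟩
    refine ⟨Ideal.Quotient.mk _ w, ?_, ?_, fun y => ?_⟩
    · rwa [ne_eq, Ideal.Quotient.eq_zero_iff_mem]
    · rwa [reduce_nm, Ideal.Quotient.eq_zero_iff_mem]
    · obtain ⟨y, rfl⟩ := Ideal.Quotient.mk_surjective y
      rw [← map_mul, reduce_tr, Ideal.Quotient.eq_zero_iff_mem]
      exact ht y

end Reduce

variable [FaithfulSMul R H]

theorem nm_mem_of_mem_extIdeal {x : H} (hx : x ∈ extIdeal H q) :
    D.nm x ∈ q ∧ ∀ y, D.tr (x * y) ∈ q := by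
  rw [mem_extIdeal] at hx
  refine Submodule.smul_induction_on hx (fun r hr n _ => ?_) (fun a b ha hb => ?_)
  · refine ⟨?_, fun y => ?_⟩
    · rw [D.nm_smul, sq, mul_assoc]
      exact q.mul_mem_right _ hr
    · rw [smul_mul_assoc, D.tr_smul]
      exact q.mul_mem_right _ hr
  · refine ⟨?_, fun y => ?_⟩
    · rw [D.nm_add]
      exact add_mem (add_mem ha.1 hb.1) (ha.2 _)
    · rw [add_mul, D.tr_add]
      exact add_mem (ha.2 y) (hb.2 y)

section Dedekind

variable [IsDedekindDomain R] {q}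

/-- If `z H` contains `q H`, then the norm of `z` divides `q ^ 2`, so that it generates `q` as soon
as it lies in `q` and not in `q ^ 2`. -/
theorem span_nm_eq_of_extIdeal_le (hq : q.IsPrime) (hq0 : q ≠ ⊥) {z : H}
    (hz : ∀ c ∈ q, ∃ h, algebraMap R H c = z * h) (h1 : D.nm z ∈ q) (h2 : D.nm z ∉ q ^ 2) :
    Ideal.span {D.nm z} = q := by
  have hdvd : Ideal.span {D.nm z} ∣ q ^ 2 := by
    apply dvd_sq_of_forall_sq_mem hq0
    intro c hc
    obtain ⟨h, hh⟩ := hz c hc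
    rw [Ideal.mem_span_singleton]
    refine ⟨D.nm h, ?_⟩
    rw [← D.nm_mul, ← hh, D.nm_algebraMap]
  have hqp := Ideal.prime_of_isPrime hq0 hq
  obtain ⟨i, hi, h⟩ := (dvd_prime_pow hqp 2).1 hdvd
  rw [associated_iff_eq] at h
  interval_cases i
  · exfalso
    rw [pow_zero, Ideal.one_eq_top] at h
    refine hq.ne_top (top_le_iff.1 ?_)
    rw [← h, Ideal.span_singleton_le_iff_mem]
    exact h1
  · simpa using h
  · exfalso
    apply h2
    rw [← h]
    exact Ideal.mem_span_singleton_self _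

variable [Module.Flat R H] [Module.Finite R H]

/-- The `N + 1` minimal right ideals of `H / q H`, at an unramified prime `q` of norm `N`, lift to
right ideals generated by elements of norm `q`; an element of norm divisible by `q` and not in `q H`
has exactly one of these generators as a left divisor. -/
theorem exists_split (hq : q.IsPrime) (hq0 : q ≠ ⊥) (hfin : Finite (R ⧸ q))
    (hrank : Module.finrank R H = 4)
    (hP : IsRightPrincipal R H) (hram : ¬ D.IsRamified q) :
    ∃ π : Fin (Nat.card (R ⧸ q) + 1) → H, (∀ l, Ideal.span {D.nm (π l)} = q) ∧
      (∀ x ∈ extIdeal H q, ∀ l, ∃ h, x = π l * h) ∧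
      (∀ x ∉ extIdeal H q, D.nm x ∈ q → ∃! l, ∃ h, x = π l * h) := by
  have : q.IsMaximal := hq.isMaximal hq0
  let _ := Ideal.Quotient.field q
  have hr : Module.finrank (R ⧸ q) (H ⧸ extIdeal H q) = 4 :=
    (finrank_quotient_extIdeal H q).trans hrank
  have hnt : Nontrivial (H ⧸ extIdeal H q) :=
    Module.nontrivial_of_finrank_pos (R := R ⧸ q) (by rw [hr]; norm_num)
  have hdeg : ¬ (D.reduce q).IsDegenerate := by
    rwa [D.isDegenerate_reduce_iff]
  obtain ⟨I, hmul, hI0, hIne, huniq⟩ := (D.reduce q).exists_rightIdeals hr hdeg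
  let J : Fin (Nat.card (R ⧸ q) + 1) → Submodule R H := fun l =>
    { carrier := {x | Ideal.Quotient.mk (extIdeal H q) x ∈ I l}
      add_mem' := by
        intro a b ha hb
        simp only [Set.mem_ofPred_eq] at *
        rw [map_add]
        exact add_mem ha hb
      zero_mem' := by
        simp
      smul_mem' := by
        intro r x hx
        simp only [Set.mem_ofPred_eq] at *
        rw [← mk_smul_mk]
        exact Submodule.smul_mem _ _ hx }
  have memJ : ∀ l x, x ∈ J l ↔ Ideal.Quotient.mk (extIdeal H q) x ∈ I l := fun _ _ => Iff.rfl
  have hext : ∀ l, ∀ x ∈ extIdeal H q, x ∈ J l := by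
    intro l x hx
    rw [memJ, Ideal.Quotient.eq_zero_iff_mem.2 hx]
    exact zero_mem _
  have hJnm : ∀ l, ∀ x ∈ J l, D.nm x ∈ q := by
    intro l x hx
    rw [memJ] at hx
    have := hI0 l _ hx
    rwa [reduce_nm, Ideal.Quotient.eq_zero_iff_mem] at this
  have hJne : ∀ l, ∃ x ∈ J l, x ∉ extIdeal H q := by
    intro l
    obtain ⟨x, hx, hx0⟩ := hIne l
    obtain ⟨x, rfl⟩ := Ideal.Quotient.mk_surjective x
    refine ⟨x, hx, ?_⟩
    rwa [ne_eq, Ideal.Quotient.eq_zero_iff_mem] at hx0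
  have hex : ∀ l, ∃ z, ∀ y, y ∈ J l ↔ ∃ h, y = z * h := by
    intro l
    refine hP (J l) ?_ ?_
    · intro x hx h
      rw [memJ] at hx ⊢
      rw [map_mul]
      exact hmul l _ hx _
    · obtain ⟨x, hx, hx0⟩ := hJne l
      intro h
      rw [h, Submodule.mem_bot] at hx
      exact hx0 (hx ▸ zero_mem _)
  choose π hπ using hex
  have hnm2 : ∀ l, ∃ x ∈ J l, D.nm x ∉ q ^ 2 := by
    intro l
    obtain ⟨x, hx, hx0⟩ := hJne l
    by_cases hx2 : D.nm x ∈ q ^ 2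
    swap
    · exact ⟨x, hx, hx2⟩
    -- Moving `x` inside `x + q H` changes its norm by any prescribed class of `q / q ^ 2`.
    rw [← Ideal.Quotient.eq_zero_iff_mem] at hx0
    obtain ⟨y, hy⟩ := (D.reduce q).exists_tr_mul_ne_zero hr hdeg hx0
    obtain ⟨y, rfl⟩ := Ideal.Quotient.mk_surjective y
    rw [← map_mul, reduce_tr, ne_eq, Ideal.Quotient.eq_zero_iff_mem] at hy
    obtain ⟨c, hc, hc2⟩ := SetLike.exists_of_lt (Ideal.pow_lt_self q hq0 hq.ne_top 2 le_rfl)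
    refine ⟨x + c • D.conj y, add_mem hx (hext l _ (smul_mem_extIdeal H q hc _)), ?_⟩
    rw [D.nm_add, map_smul, D.conj_conj, D.nm_smul, mul_smul_comm, D.tr_smul]
    intro h
    have h3 : c ^ 2 * D.nm (D.conj y) ∈ q ^ 2 := Ideal.mul_mem_right _ _ (Ideal.pow_mem_pow hc 2)
    have h4 : c * D.tr (x * y) ∈ q ^ 2 := by
      have := sub_mem h (add_mem hx2 h3)
      rwa [add_sub_cancel_left] at this
    rcases (Ideal.IsPrime.mul_mem_pow q (mul_comm c _ ▸ h4)) with h5 | h5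
    · exact hy h5
    · exact hc2 h5
  refine ⟨π, fun l => ?_, fun x hx l => (hπ l x).1 (hext l x hx), fun x hx hnx => ?_⟩
  · refine D.span_nm_eq_of_extIdeal_le hq hq0 ?_ ?_ ?_
    · intro c hc
      exact (hπ l _).1 (hext l _ (algebraMap_mem_extIdeal H q hc))
    · exact hJnm l _ ((hπ l _).2 ⟨1, by rw [mul_one]⟩)
    · intro h
      obtain ⟨x, hx, hx2⟩ := hnm2 l
      obtain ⟨y, rfl⟩ := (hπ l x).1 hx
      rw [D.nm_mul] at hx2
      exact hx2 (Ideal.mul_mem_right _ _ h)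
  · rw [← Ideal.Quotient.eq_zero_iff_mem] at hx
    obtain ⟨l, hl, hl'⟩ := huniq _ hx (by rw [reduce_nm, Ideal.Quotient.eq_zero_iff_mem.2 hnx])
    refine ⟨l, (hπ l x).1 hl, fun l' h => hl' l' ((hπ l' x).2 h)⟩

end Dedekind

end StandardInvolution

namespace StandardInvolution

section Ramified

variable {R H : Type*} [CommRing R] [IsDedekindDomain R] [Ring H] [Algebra R H] [FaithfulSMul R H]
  (D : StandardInvolution R H) {q : Ideal R}

/-- At a ramified prime the elements of norm divisible by `q` form a principal right ideal, with a
generator of norm `q`. The radical of the norm form modulo `q` is a right ideal; a generator of it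
has norm `q`, and every element of norm divisible by `q` lies in it. -/
theorem exists_ramified (hq : q.IsPrime) (hq0 : q ≠ ⊥)
    (hP : IsRightPrincipal R H) (hram : D.IsRamified q) :
    (∃ π : H, Ideal.span {D.nm π} = q ∧ ∀ x, D.nm x ∈ q ↔ ∃ h, x = π * h) ∧
      ∀ x, D.nm x ∈ q → ∀ y, D.tr (x * y) ∈ q := by
  have hqm : q.IsMaximal := hq.isMaximal hq0
  have hqp := Ideal.prime_of_isPrime hq0 hq
  let J : Submodule R H :=
    { carrier := {x | D.nm x ∈ q ∧ ∀ y, D.tr (x * y) ∈ q}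
      add_mem' := by
        rintro a b ⟨ha, ha'⟩ ⟨hb, hb'⟩
        refine ⟨?_, fun y => ?_⟩
        · rw [D.nm_add]
          exact add_mem (add_mem ha hb) (ha' _)
        · rw [add_mul, D.tr_add]
          exact add_mem (ha' y) (hb' y)
      zero_mem' := by simp
      smul_mem' := by
        rintro r x ⟨hx, hx'⟩
        refine ⟨?_, fun y => ?_⟩
        · rw [D.nm_smul]
          exact q.mul_mem_left _ hx
        · rw [smul_mul_assoc, D.tr_smul]
          exact q.mul_mem_left _ (hx' y) }
  have memJ : ∀ x, x ∈ J ↔ D.nm x ∈ q ∧ ∀ y, D.tr (x * y) ∈ q := fun x => Iff.rfl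
  have hJmul : ∀ x ∈ J, ∀ h, x * h ∈ J := by
    rintro x ⟨hx, hx'⟩ h
    refine ⟨?_, fun y => ?_⟩
    · rw [D.nm_mul]
      exact q.mul_mem_right _ hx
    · rw [mul_assoc]
      exact hx' _
  have hext : ∀ x ∈ extIdeal H q, x ∈ J := fun x hx => D.nm_mem_of_mem_extIdeal q hx
  obtain ⟨w, hw, hwn, hwt⟩ := hram
  have hwJ : w ∈ J := ⟨hwn, hwt⟩
  have hJne : J ≠ ⊥ := by
    intro h
    rw [h, Submodule.mem_bot] at hwJ
    exact hw (hwJ ▸ zero_mem _)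
  obtain ⟨π, hπ⟩ := hP J hJmul hJne
  have hπJ : π ∈ J := (hπ π).2 ⟨1, by rw [mul_one]⟩
  have hπ2 : D.nm π ∉ q ^ 2 := by
    intro h2
    -- Otherwise `π` would be a local generator of `q H`.
    obtain ⟨c, hc, hc2⟩ := SetLike.exists_of_lt (Ideal.pow_lt_self q hq0 hq.ne_top 2 le_rfl)
    obtain ⟨y, hy⟩ := (hπ _).1 (hext _ (algebraMap_mem_extIdeal H q hc))
    have hcy : c ^ 2 = D.nm π * D.nm y := by rw [← D.nm_mul, ← hy, D.nm_algebraMap]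
    have hny : D.nm y ∉ q := by
      intro hny
      have h3 : c ^ 2 ∈ q ^ 2 * q := by
        rw [hcy]
        exact Ideal.mul_mem_mul h2 hny
      rw [← Ideal.span_singleton_le_iff_mem, ← Ideal.dvd_iff_le, ← Ideal.span_singleton_pow] at h3
      rw [← Ideal.span_singleton_le_iff_mem, ← Ideal.dvd_iff_le] at hc hc2
      obtain ⟨𝔠, h𝔠⟩ := hc
      rw [h𝔠, mul_pow] at h3
      have h4 := hqp.dvd_of_dvd_pow ((mul_dvd_mul_iff_left (pow_ne_zero 2 hq0)).1 h3)
      apply hc2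
      rw [h𝔠, sq]
      exact mul_dvd_mul_left _ h4
    apply hw
    refine mem_extIdeal_of_smul_mem H hqm hny ?_
    obtain ⟨h, rfl⟩ := (hπ w).1 hwJ
    have : D.nm y • (π * h) = c • (D.conj y * h) := by
      rw [Algebra.smul_def, Algebra.smul_def, hy, ← mul_assoc, Algebra.commutes, D.algebraMap_nm]
      noncomm_ring
    rw [this]
    exact smul_mem_extIdeal H q hc _
  have hnm : Ideal.span {D.nm π} = q := by
    refine D.span_nm_eq_of_extIdeal_le hq hq0 (fun c hc => ?_) hπJ.1 hπ2
    exact (hπ _).1 (hext _ (algebraMap_mem_extIdeal H q hc))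
  have hall : ∀ y, D.nm y ∈ q → y ∈ J := by
    intro y hy
    -- The right ideal generated by `y` and `J` is either `J` or everything.
    let N : Submodule R H := LinearMap.range (LinearMap.mulLeft R y) ⊔ J
    have hyN : y ∈ N := Submodule.mem_sup_left ⟨1, by simp⟩
    obtain ⟨z, hz⟩ := hP N (by
      intro x hx h
      obtain ⟨_, ⟨a, rfl⟩, b, hb, rfl⟩ := Submodule.mem_sup.1 hx
      rw [add_mul]
      refine add_mem (Submodule.mem_sup_left ⟨a * h, ?_⟩) (Submodule.mem_sup_right (hJmul b hb h))
      simp [mul_assoc]) (fun h => hJne (le_bot_iff.1 (h ▸ le_sup_right)))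
    obtain ⟨u, hu⟩ := (hz π).1 (Submodule.mem_sup_right hπJ)
    have hfac : q = Ideal.span {D.nm z} * Ideal.span {D.nm u} := by
      rw [Ideal.span_singleton_mul_span_singleton, ← D.nm_mul, ← hu, hnm]
    rcases hqp.irreducible.isUnit_or_isUnit hfac with h | h
    · rw [Ideal.isUnit_iff, Ideal.span_singleton_eq_top] at h
      exfalso
      obtain ⟨⟨z, z', hzz, _⟩, rfl⟩ := D.isUnit_of_nm h
      obtain ⟨_, ⟨a, rfl⟩, b, hb, hab⟩ := Submodule.mem_sup.1 ((hz 1).2 ⟨z', hzz.symm⟩)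
      have h1 : y * a = 1 - b := by rw [← hab]; simp
      have h2 : D.nm (1 - b) ∈ q := by
        rw [← h1, D.nm_mul]
        exact q.mul_mem_right _ hy
      rw [sub_eq_add_neg, D.nm_add, D.nm_one, D.nm_neg, ← D.tr_conj, one_mul, D.conj_conj,
        D.tr_neg] at h2
      have h3 := hb.2 1
      rw [mul_one] at h3
      apply hq.ne_top
      rw [Ideal.eq_top_iff_one]
      have h4 := add_mem (sub_mem h2 hb.1) h3
      convert! h4 using 1
      ring
    · rw [Ideal.isUnit_iff, Ideal.span_singleton_eq_top] at h
      obtain ⟨⟨u, u', huu, _⟩, rfl⟩ := D.isUnit_of_nm h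
      obtain ⟨a, rfl⟩ := (hz y).1 hyN
      have : z * a = π * (u' * a) := by
        rw [hu]
        change z * a = z * u * (u' * a)
        rw [mul_assoc, ← mul_assoc u, huu, one_mul]
      rw [this]
      exact hJmul _ hπJ _
  exact ⟨⟨π, hnm, fun x => ⟨fun h => (hπ x).1 (hall x h), fun h => ((hπ x).2 h).1⟩⟩,
    fun x hx => (hall x hx).2⟩

/-- The elements whose norm is divisible by a ramified prime. -/
theorem exists_ramifiedIdeal (hq : q.IsPrime) (hq0 : q ≠ ⊥)
    (hP : IsRightPrincipal R H) (hram : D.IsRamified q) :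
    ∃ P : Ideal H, P.IsTwoSided ∧ ∀ x, x ∈ P ↔ D.nm x ∈ q := by
  obtain ⟨-, htr⟩ := D.exists_ramified hq hq0 hP hram
  let P : Ideal H :=
    { carrier := {x | D.nm x ∈ q}
      add_mem' := by
        intro a b ha hb
        change D.nm (a + b) ∈ q
        rw [D.nm_add]
        exact add_mem (add_mem ha hb) (htr a ha _)
      zero_mem' := by simp
      smul_mem' := by
        intro h x hx
        change D.nm (h * x) ∈ q
        rw [D.nm_mul]
        exact q.mul_mem_left _ hx }
  refine ⟨P, ⟨fun {a} b ha => ?_⟩, fun x => Iff.rfl⟩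
  change D.nm (a * b) ∈ q
  rw [D.nm_mul]
  exact q.mul_mem_right _ ha

/-- The set of elements of norm divisible by a ramified prime, as a submodule. -/
theorem exists_ramifiedSubmodule (hq : q.IsPrime) (hq0 : q ≠ ⊥) (hR : IsRightPrincipal R H)
    (hram : D.IsRamified q) : ∃ P : Submodule R H, ∀ x, x ∈ P ↔ D.nm x ∈ q := by
  obtain ⟨P, -, hP⟩ := D.exists_ramifiedIdeal hq hq0 hR hram
  refine ⟨{ carrier := P, add_mem' := P.add_mem, zero_mem' := P.zero_mem, smul_mem' := ?_ }, hP⟩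
  intro r x hx
  rw [Algebra.smul_def]
  exact P.mul_mem_left _ hx

variable [Module.Flat R H] [Module.Finite R H]

/-- The residue ring at a ramified prime is a finite division ring, hence commutative. -/
theorem nm_commutator_mem (hq : q.IsPrime) (hq0 : q ≠ ⊥) (hfin : Finite (R ⧸ q))
    (hP : IsRightPrincipal R H) (hram : D.IsRamified q) (x y : H) :
    D.nm (x * y - y * x) ∈ q := by
  obtain ⟨P, hPt, hPm⟩ := D.exists_ramifiedIdeal hq hq0 hP hram
  have hqm : q.IsMaximal := hq.isMaximal hq0
  have hfq : Finite (H ⧸ extIdeal H q) := by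
    apply Nat.finite_of_card_ne_zero
    rw [card_quotient_extIdeal H q]
    have : 0 < Nat.card (R ⧸ q) := Nat.card_pos
    positivity
  have hfP : Finite (H ⧸ P) := by
    refine Finite.of_surjective (Ideal.Quotient.factor (S := extIdeal H q) (T := P) ?_)
      (Ideal.Quotient.factor_surjective _)
    intro x hx
    rw [hPm]
    exact (D.nm_mem_of_mem_extIdeal q hx).1
  have h1 : NoZeroDivisors (H ⧸ P) := ⟨by
    intro a b hab
    obtain ⟨a, rfl⟩ := Ideal.Quotient.mk_surjective a
    obtain ⟨b, rfl⟩ := Ideal.Quotient.mk_surjective b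
    rw [← map_mul, Ideal.Quotient.eq_zero_iff_mem, hPm, D.nm_mul] at hab
    rw [Ideal.Quotient.eq_zero_iff_mem, Ideal.Quotient.eq_zero_iff_mem, hPm, hPm]
    exact hq.mem_or_mem hab⟩
  have h2 : Nontrivial (H ⧸ P) := by
    refine ⟨⟨1, 0, ?_⟩⟩
    rw [← map_one (Ideal.Quotient.mk P), ne_eq, Ideal.Quotient.eq_zero_iff_mem, hPm, D.nm_one,
      ← Ideal.eq_top_iff_one]
    exact hq.ne_top
  have h3 : IsDomain (H ⧸ P) := NoZeroDivisors.to_isDomain _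
  have h4 := (Finite.isDomain_to_isField (H ⧸ P)).mul_comm (Ideal.Quotient.mk P x)
    (Ideal.Quotient.mk P y)
  rw [← hPm, ← Ideal.Quotient.eq_zero_iff_mem, map_sub, map_mul, map_mul, h4, sub_self]

/-- The ramified primes are those dividing the reduced discriminant. -/
theorem isRamified_iff (hq : q.IsPrime) (hq0 : q ≠ ⊥) (hfin : Finite (R ⧸ q))
    (hrank : Module.finrank R H = 4) (hP : IsRightPrincipal R H) :
    D.IsRamified q ↔ ∀ x y z, D.tr ((x * y - y * x) * z) ∈ q := by
  constructor
  · intro h x y z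
    exact (D.exists_ramified hq hq0 hP h).2 _ (D.nm_commutator_mem hq hq0 hfin hP h x y) z
  · intro h
    by_contra hram
    have : q.IsMaximal := hq.isMaximal hq0
    let _ := Ideal.Quotient.field q
    have hr : Module.finrank (R ⧸ q) (H ⧸ extIdeal H q) = 4 :=
      (finrank_quotient_extIdeal H q).trans hrank
    have hnt : Nontrivial (H ⧸ extIdeal H q) :=
      Module.nontrivial_of_finrank_pos (R := R ⧸ q) (by rw [hr]; norm_num)
    have hdeg : ¬ (D.reduce q).IsDegenerate := by
      rwa [D.isDegenerate_reduce_iff]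
    obtain ⟨e, u, v, c, hc, he, -, -, -, -, huv, hvu, -, he0⟩ :=
      (D.reduce q).exists_matrix_units hr hdeg
    have hne : u * v - v * u ≠ 0 := by
      intro h0
      rw [huv, hvu, ← smul_sub, smul_eq_zero] at h0
      have h1 := h0.resolve_left hc
      have h2 : e * (e - (1 - e)) = e := by
        rw [mul_sub, mul_sub, he]; simp
      rw [h1, mul_zero] at h2
      exact he0 h2.symm
    obtain ⟨z, hz⟩ := (D.reduce q).exists_tr_mul_ne_zero hr hdeg hne
    obtain ⟨u, rfl⟩ := Ideal.Quotient.mk_surjective u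
    obtain ⟨v, rfl⟩ := Ideal.Quotient.mk_surjective v
    obtain ⟨z, rfl⟩ := Ideal.Quotient.mk_surjective z
    rw [← map_mul, ← map_mul, ← map_sub, ← map_mul, reduce_tr, ne_eq,
      Ideal.Quotient.eq_zero_iff_mem] at hz
    exact hz (h u v z)

end Ramified

end StandardInvolution

/-! ### Totally positive generators and totally positive units -/

section NumberField

open NumberField.InfinitePlace

theorem IsTotallyPositive.mul {K : Type*} [Field K] {x y : K} (hx : IsTotallyPositive x)
    (hy : IsTotallyPositive y) : IsTotallyPositive (x * y) := fun σ => by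
  rw [map_mul]; exact mul_pos (hx σ) (hy σ)

theorem IsTotallyPositive.of_mul_left {K : Type*} [Field K] {x y : K} (hx : IsTotallyPositive x)
    (hy : IsTotallyPositive (x * y)) : IsTotallyPositive y := fun σ => by
  have h := hy σ
  rw [map_mul] at h
  exact pos_of_mul_pos_right h (hx σ).le

theorem isTotallyPositive_one {K : Type*} [Field K] : IsTotallyPositive (1 : K) := fun σ => by
  rw [map_one]; exact one_pos

variable {K : Type*} [Field K] [NumberField K]

/-- Products of totally positive generators of prime ideals are totally positive generators. -/
theorem exists_totallyPositive_generator
    (h : ∀ q : Ideal (𝓞 K), q.IsPrime → q ≠ ⊥ →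
      ∃ ϖ : 𝓞 K, IsTotallyPositive (ϖ : K) ∧ Ideal.span {ϖ} = q)
    (I : Ideal (𝓞 K)) (hI : I ≠ ⊥) :
    ∃ α : 𝓞 K, IsTotallyPositive (α : K) ∧ Ideal.span {α} = I := by
  induction I using UniqueFactorizationMonoid.induction_on_prime with
  | h₁ => exact absurd rfl hI
  | h₂ x hx =>
    refine ⟨1, isTotallyPositive_one, ?_⟩
    rw [Ideal.isUnit_iff.1 hx, Ideal.span_singleton_one]
  | h₃ a p ha hp ih =>
    obtain ⟨α, hα, hα'⟩ := ih ha
    obtain ⟨ϖ, hϖ, hϖ'⟩ := h p (Ideal.isPrime_of_prime hp) hp.ne_zero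
    refine ⟨ϖ * α, hϖ.mul hα, ?_⟩
    rw [← Ideal.span_singleton_mul_span_singleton, hα', hϖ']

/-- Weak approximation: there are algebraic integers with prescribed signs at the real places. -/
theorem exists_pos_mul_embedding [IsTotallyReal K] (t : InfinitePlace K → ℤˣ) :
    ∃ x : 𝓞 K, x ≠ 0 ∧ ∀ v : InfinitePlace K,
      0 < ((t v : ℤ) : ℝ) * embedding_of_isReal (IsTotallyReal.isReal v) (x : K) := by
  obtain ⟨x, hx⟩ : ∃ x : K, ∀ v : InfinitePlace K,
      0 < ((t v : ℤ) : ℝ) * embedding_of_isReal (IsTotallyReal.isReal v) x := by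
    let y : (v : InfinitePlace K) → WithAbs v.1 := fun v => WithAbs.toAbs v.1 ((t v : ℤ) : K)
    obtain ⟨x, hx⟩ := Metric.denseRange_iff.1 (denseRange_algebraMap_pi K) y 1 one_pos
    refine ⟨x, fun v => ?_⟩
    have h1 := (dist_pi_lt_iff one_pos).1 hx v
    rw [dist_eq_norm, WithAbs.norm_eq_apply_ofAbs] at h1
    have h2 : v.1 (((t v : ℤ) : K) - x) < 1 := h1
    have h3 : |embedding_of_isReal (IsTotallyReal.isReal v) (((t v : ℤ) : K) - x)| < 1 := by
      rw [← Real.norm_eq_abs, norm_embedding_of_isReal]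
      exact h2
    rw [map_sub, map_intCast, abs_lt] at h3
    rcases Int.units_eq_one_or (t v) with h | h <;> rw [h] at h3 ⊢ <;> push_cast at h3 ⊢ <;>
      linarith [h3.1, h3.2]
  obtain ⟨n, d, hd, rfl⟩ := IsFractionRing.div_surjective (A := 𝓞 K) x
  have hd0 : d ≠ 0 := nonZeroDivisors.ne_zero hd
  have hd0' : algebraMap (𝓞 K) K d ≠ 0 := by
    rwa [ne_eq, FaithfulSMul.algebraMap_eq_zero_iff]
  -- `n * d` has the same signs as `n / d`.
  have key : ∀ v : InfinitePlace K,
      0 < ((t v : ℤ) : ℝ) * embedding_of_isReal (IsTotallyReal.isReal v) ((n * d : 𝓞 K) : K) := by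
    intro v
    have h1 : ((n * d : 𝓞 K) : K) = algebraMap (𝓞 K) K n / algebraMap (𝓞 K) K d *
        algebraMap (𝓞 K) K d ^ 2 := by
      change algebraMap (𝓞 K) K (n * d) = _
      rw [map_mul]
      field_simp
    rw [h1, map_mul, ← mul_assoc, map_pow]
    have h2 : embedding_of_isReal (IsTotallyReal.isReal v) (algebraMap (𝓞 K) K d) ≠ 0 :=
      (map_ne_zero _).2 hd0'
    exact mul_pos (hx v) (by positivity)
  refine ⟨n * d, fun h => ?_, key⟩
  obtain ⟨v⟩ : Nonempty (InfinitePlace K) := inferInstance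
  have := key v
  rw [h, RingOfIntegers.coe_eq_algebraMap, map_zero, map_zero, mul_zero] at this
  exact this.false

/-- If every ideal has a totally positive generator, then units have all signatures; since there are
as many signatures as units modulo squares, totally positive units are squares. -/
theorem exists_sq_eq_of_totallyPositive [IsTotallyReal K]
    (h : ∀ I : Ideal (𝓞 K), I ≠ ⊥ → ∃ α : 𝓞 K, IsTotallyPositive (α : K) ∧ Ideal.span {α} = I)
    (u : (𝓞 K)ˣ) (hu : IsTotallyPositive ((u : 𝓞 K) : K)) : ∃ v : (𝓞 K)ˣ, u = v ^ 2 := by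
  classical
  let σ : InfinitePlace K → K →+* ℝ := fun v => embedding_of_isReal (IsTotallyReal.isReal v)
  let sg : ℝˣ →* SignTypeˣ := Units.map (signHom : ℝ →*₀ SignType).toMonoidHom
  let f : (𝓞 K)ˣ →* (InfinitePlace K → SignTypeˣ) := MonoidHom.pi fun v =>
    sg.comp (Units.map ((σ v).comp (algebraMap (𝓞 K) K)).toMonoidHom)
  have hf : ∀ x v, ((f x v : SignTypeˣ) : SignType) = SignType.sign (σ v ((x : 𝓞 K) : K)) :=
    fun x v => rfl
  have hsq : ∀ s : SignTypeˣ, s ^ 2 = 1 := by decide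
  have hfsq : ∀ x, f x ^ 2 = 1 := fun x => funext fun v => hsq _
  -- Divide an integer of the given signature by a totally positive generator of the same ideal.
  have hsurj : Function.Surjective f := by
    intro t
    obtain ⟨x, hx0, hx⟩ := exists_pos_mul_embedding (K := K) (fun v => if t v = 1 then 1 else -1)
    obtain ⟨β, hβ, hβx⟩ := h (Ideal.span {x}) (by simpa using hx0)
    obtain ⟨w, hw⟩ := Ideal.span_singleton_eq_span_singleton.1 hβx
    refine ⟨w, ?_⟩
    funext v
    ext
    rw [hf]
    have h1 := hx v
    rw [← hw, RingOfIntegers.coe_eq_algebraMap, map_mul, map_mul, mul_left_comm] at h1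
    have h2 := pos_of_mul_pos_right h1 (hβ (σ v)).le
    rcases (show ∀ s : SignTypeˣ, s = 1 ∨ s = -1 by decide) (t v) with h3 | h3
    · rw [h3] at h2 ⊢
      simp only [if_true, Units.val_one, Int.cast_one, one_mul] at h2
      rw [sign_pos h2]
      rfl
    · rw [h3, if_neg (by decide)] at h2
      rw [h3]
      simp only [Units.val_neg, Units.val_one, Int.cast_neg, Int.cast_one, neg_mul, one_mul,
        Left.neg_pos_iff] at h2
      rw [sign_neg h2]
      rfl
  have hr : Units.rank K + 1 = Fintype.card (InfinitePlace K) := by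
    have : 0 < Fintype.card (InfinitePlace K) := Fintype.card_pos
    rw [Units.rank]
    omega
  -- By Dirichlet's theorem these products represent all classes of units modulo squares.
  let g : (Fin 2 × (Fin (Units.rank K) → Fin 2)) → (𝓞 K)ˣ := fun p =>
    (-1) ^ (p.1 : ℕ) * ∏ i, Units.fundSystem K i ^ (p.2 i : ℕ)
  have hg : ∀ x : (𝓞 K)ˣ, ∃ p y, x = g p * y ^ 2 := by
    intro x
    obtain ⟨⟨⟨ζ, hζ⟩, n⟩, hx, -⟩ := Units.exist_unique_eq_mul_prod K x
    have hζ1 : ∃ b : Fin 2, ζ = (-1) ^ (b : ℕ) := by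
      obtain ⟨v⟩ : Nonempty (InfinitePlace K) := inferInstance
      have h1 := (Units.mem_torsion K).1 hζ v
      rw [← norm_embedding_of_isReal (IsTotallyReal.isReal v), Real.norm_eq_abs] at h1
      have inj : ∀ a b : 𝓞 K, σ v (a : K) = σ v (b : K) → a = b := fun a b hab =>
        RingOfIntegers.ext ((σ v).injective hab)
      rcases eq_or_eq_neg_of_abs_eq h1 with h2 | h2
      · refine ⟨0, Units.ext (inj _ _ ?_)⟩
        refine h2.trans ?_
        simp
      · refine ⟨1, Units.ext (inj _ _ ?_)⟩
        refine h2.trans ?_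
        simp
    obtain ⟨b, rfl⟩ := hζ1
    refine ⟨(b, fun i => ⟨(n i % 2).toNat, by omega⟩),
      ∏ i, Units.fundSystem K i ^ (n i / 2), ?_⟩
    rw [hx]
    simp only [g]
    rw [← Finset.prod_pow, mul_assoc, ← Finset.prod_mul_distrib]
    congr 1
    refine Finset.prod_congr rfl fun i _ => ?_
    rw [← zpow_natCast, ← zpow_natCast, ← zpow_mul, ← zpow_add]
    congr 1
    omega
  have hbij : Function.Bijective (f ∘ g) := by
    rw [Fintype.bijective_iff_surjective_and_card]
    constructor
    · intro t
      obtain ⟨x, rfl⟩ := hsurj t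
      obtain ⟨p, y, rfl⟩ := hg x
      refine ⟨p, ?_⟩
      rw [map_mul, map_pow, hfsq, mul_one]
      rfl
    · rw [Fintype.card_prod, Fintype.card_fun, Fintype.card_fun, Fintype.card_fin, Fintype.card_fin,
        ← hr, pow_succ', show Fintype.card SignTypeˣ = 2 from rfl]
  obtain ⟨p, y, rfl⟩ := hg u
  have h1 : f (g p * y ^ 2) = 1 := by
    funext v
    ext
    rw [hf, sign_pos (hu _)]
    rfl
  rw [map_mul, map_pow, hfsq, mul_one] at h1
  have h2 : p = 0 := by
    apply hbij.1
    change f (g p) = f (g 0)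
    rw [h1]
    simp [g]
  refine ⟨y, ?_⟩
  rw [h2]
  simp [g]

end NumberField

/-! ### Divisor sums over ideals -/

section DivisorSum

variable {K : Type*} [Field K] [NumberField K]

/-- The sum of the absolute norms of the divisors of `I` with the property `c`. -/
noncomputable def normSum (c : Ideal (𝓞 K) → Prop) (I : Ideal (𝓞 K)) : ℕ :=
  ∑ᶠ δ ∈ {δ : Ideal (𝓞 K) | δ ∣ I ∧ c δ}, Ideal.absNorm δ

theorem finite_dvd {I : Ideal (𝓞 K)} (hI : I ≠ ⊥) (c : Ideal (𝓞 K) → Prop) :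
    {δ : Ideal (𝓞 K) | δ ∣ I ∧ c δ}.Finite := by
  have : {δ : Ideal (𝓞 K) | δ ∣ I}.Finite := by
    have := UniqueFactorizationMonoid.fintypeSubtypeDvd I hI
    exact Set.finite_coe_iff.1 (Finite.of_fintype {δ : Ideal (𝓞 K) // δ ∣ I})
  exact this.subset fun δ hδ => hδ.1

theorem normSum_congr {c c' : Ideal (𝓞 K) → Prop} {I : Ideal (𝓞 K)}
    (h : ∀ δ, δ ∣ I → (c δ ↔ c' δ)) : normSum c I = normSum c' I := by
  have : {δ : Ideal (𝓞 K) | δ ∣ I ∧ c δ} = {δ : Ideal (𝓞 K) | δ ∣ I ∧ c' δ} := by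
    ext δ
    exact and_congr_right (h δ)
  rw [normSum, this, normSum]

theorem normSum_false {c : Ideal (𝓞 K) → Prop} {I : Ideal (𝓞 K)}
    (h : ∀ δ, δ ∣ I → ¬ c δ) : normSum c I = 0 := by
  rw [normSum_congr (c' := fun _ => False) (fun δ hδ => iff_of_false (h δ hδ) id)]
  simp [normSum]

theorem normSum_one {c : Ideal (𝓞 K) → Prop} (h : c 1) : normSum c 1 = 1 := by
  have : {δ : Ideal (𝓞 K) | δ ∣ 1 ∧ c δ} = {1} := by
    ext δ
    constructor
    · rintro ⟨h1, -⟩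
      exact isUnit_iff_eq_one.1 (isUnit_of_dvd_one h1)
    · rintro rfl
      exact ⟨dvd_rfl, h⟩
  rw [normSum, this, finsum_mem_singleton, map_one]

/-- The divisors of `q I` are the divisors of `I` prime to `q` and the products of `q` with the
divisors of `I`. -/
theorem normSum_prime_mul (c : Ideal (𝓞 K) → Prop) {q I : Ideal (𝓞 K)} (hq : Prime q)
    (hI : I ≠ ⊥) :
    normSum c (q * I) = normSum (fun δ => c δ ∧ ¬ q ∣ δ) I +
      Ideal.absNorm q * normSum (fun δ => c (q * δ)) I := by
  have hset : {δ : Ideal (𝓞 K) | δ ∣ q * I ∧ c δ} = {δ | δ ∣ I ∧ (c δ ∧ ¬ q ∣ δ)} ∪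
      (fun δ => q * δ) '' {δ | δ ∣ I ∧ c (q * δ)} := by
    ext δ
    constructor
    · rintro ⟨h1, h2⟩
      by_cases hqδ : q ∣ δ
      · obtain ⟨δ', rfl⟩ := hqδ
        exact Or.inr ⟨δ', ⟨(mul_dvd_mul_iff_left hq.ne_zero).1 h1, h2⟩, rfl⟩
      · refine Or.inl ⟨?_, h2, hqδ⟩
        have hmax : q.IsMaximal := (Ideal.isPrime_of_prime hq).isMaximal hq.ne_zero
        have hcop : IsCoprime δ q := by
          rw [Ideal.isCoprime_iff_sup_eq, sup_comm]
          refine hmax.1.2 _ (lt_of_le_of_ne le_sup_left fun h => hqδ ?_)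
          rw [Ideal.dvd_iff_le]
          exact le_sup_right.trans h.ge
        exact hcop.dvd_of_dvd_mul_left h1
    · rintro (⟨h1, h2, -⟩ | ⟨δ', ⟨h1, h2⟩, rfl⟩)
      · exact ⟨h1.mul_left q, h2⟩
      · exact ⟨mul_dvd_mul_left q h1, h2⟩
  have hdisj : Disjoint {δ | δ ∣ I ∧ (c δ ∧ ¬ q ∣ δ)}
      ((fun δ => q * δ) '' {δ | δ ∣ I ∧ c (q * δ)}) := by
    rw [Set.disjoint_left]
    rintro _ ⟨-, -, h⟩ ⟨δ', -, rfl⟩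
    exact h (dvd_mul_right q δ')
  rw [normSum, hset, finsum_mem_union hdisj (finite_dvd hI _) ((finite_dvd hI _).image _),
    finsum_mem_image ((mul_right_injective₀ hq.ne_zero).injOn)]
  congr 1
  rw [normSum, finsum_mem_eq_finite_toFinset_sum _ (finite_dvd hI _),
    finsum_mem_eq_finite_toFinset_sum _ (finite_dvd hI _), Finset.mul_sum]
  simp only [map_mul]

/-- `δ` is divisible by no prime divisor of `𝔇`. -/
def CoprimeTo {K : Type*} [Field K] (𝔇 δ : Ideal (𝓞 K)) : Prop :=
  ∀ 𝔮 : Ideal (𝓞 K), 𝔮.IsPrime → 𝔮 ∣ 𝔇 → ¬ 𝔮 ∣ δ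

theorem coprimeTo_one {K : Type*} [Field K] (𝔇 : Ideal (𝓞 K)) : CoprimeTo 𝔇 1 := fun 𝔮 h𝔮 _ h =>
  h𝔮.ne_top (by rw [← Ideal.one_eq_top]; exact isUnit_iff_eq_one.1 (isUnit_of_dvd_one h))

theorem coprimeTo_prime_mul {𝔇 q δ : Ideal (𝓞 K)} (hq : Prime q) (hq𝔇 : ¬ q ∣ 𝔇)
    (h𝔇 : 𝔇 ≠ ⊥) : CoprimeTo 𝔇 (q * δ) ↔ CoprimeTo 𝔇 δ := by
  constructor
  · exact fun h 𝔮 h1 h2 h3 => h 𝔮 h1 h2 (h3.mul_left q)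
  · intro h 𝔮 h1 h2 h3
    have h0 : 𝔮 ≠ ⊥ := by
      rintro rfl
      exact h𝔇 (zero_dvd_iff.1 h2)
    have hp := Ideal.prime_of_isPrime h0 h1
    rcases hp.dvd_or_dvd h3 with h4 | h4
    · rw [associated_iff_eq.1 (hp.associated_of_dvd hq h4)] at h2
      exact hq𝔇 h2
    · exact h 𝔮 h1 h2 h4

theorem normSum_coprimeTo_mul_of_dvd {𝔇 q I : Ideal (𝓞 K)} (hq : Prime q) (hq𝔇 : q ∣ 𝔇)
    (hI : I ≠ ⊥) : normSum (CoprimeTo 𝔇) (q * I) = normSum (CoprimeTo 𝔇) I := by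
  rw [normSum_prime_mul _ hq hI,
    normSum_false (c := fun δ => CoprimeTo 𝔇 (q * δ)), mul_zero, add_zero]
  · exact normSum_congr fun δ _ =>
      ⟨fun h => h.1, fun h => ⟨h, h q (Ideal.isPrime_of_prime hq) hq𝔇⟩⟩
  · exact fun δ _ h => h q (Ideal.isPrime_of_prime hq) hq𝔇 (dvd_mul_right q δ)

theorem normSum_coprimeTo_mul {𝔇 q I : Ideal (𝓞 K)} (hq : Prime q) (hq𝔇 : ¬ q ∣ 𝔇)
    (h𝔇 : 𝔇 ≠ ⊥) (hI : I ≠ ⊥) : normSum (CoprimeTo 𝔇) (q * I) =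
      normSum (fun δ => CoprimeTo 𝔇 δ ∧ ¬ q ∣ δ) I +
      Ideal.absNorm q * normSum (CoprimeTo 𝔇) I := by
  rw [normSum_prime_mul _ hq hI]
  congr 2
  exact normSum_congr fun δ _ => coprimeTo_prime_mul hq hq𝔇 h𝔇

/-- The Hecke recursion for divisor sums, at the square of a prime. -/
theorem normSum_coprimeTo_mul_mul {𝔇 q I : Ideal (𝓞 K)} (hq : Prime q) (hq𝔇 : ¬ q ∣ 𝔇)
    (h𝔇 : 𝔇 ≠ ⊥) (hI : I ≠ ⊥) : normSum (CoprimeTo 𝔇) (q * (q * I)) +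
      Ideal.absNorm q * normSum (CoprimeTo 𝔇) I =
      (Ideal.absNorm q + 1) * normSum (CoprimeTo 𝔇) (q * I) := by
  have h1 := normSum_coprimeTo_mul hq hq𝔇 h𝔇 (mul_ne_zero hq.ne_zero hI)
  have h2 := normSum_coprimeTo_mul hq hq𝔇 h𝔇 hI
  have h3 : normSum (fun δ => CoprimeTo 𝔇 δ ∧ ¬ q ∣ δ) (q * I) =
      normSum (fun δ => CoprimeTo 𝔇 δ ∧ ¬ q ∣ δ) I := by
    rw [normSum_prime_mul _ hq hI, normSum_false (c := fun δ => _ ∧ ¬ q ∣ q * δ), mul_zero,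
      add_zero]
    · exact normSum_congr fun δ _ => by tauto
    · exact fun δ _ h => h.2 (dvd_mul_right q δ)
  rw [h1, h3, add_mul, one_mul, h2]
  ring

/-- The Hecke recursion for divisor sums, at a prime to the first power. -/
theorem normSum_coprimeTo_mul_of_not_dvd {𝔇 q I : Ideal (𝓞 K)} (hq : Prime q) (hq𝔇 : ¬ q ∣ 𝔇)
    (h𝔇 : 𝔇 ≠ ⊥) (hI : I ≠ ⊥) (hqI : ¬ q ∣ I) : normSum (CoprimeTo 𝔇) (q * I) =
      (Ideal.absNorm q + 1) * normSum (CoprimeTo 𝔇) I := by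
  rw [normSum_coprimeTo_mul hq hq𝔇 h𝔇 hI, normSum_congr (c' := CoprimeTo 𝔇)]
  · ring
  · exact fun δ hδ => ⟨fun h => h.1, fun h => ⟨h, fun h' => hqI (h'.trans hδ)⟩⟩

/-- The condition on divisors that defines `admissibleDivisors`, apart from principality, which is
automatic in class number one. -/
def IsAdmissible {K : Type*} [Field K] (𝔇 𝔭 δ : Ideal (𝓞 K)) : Prop :=
  ¬ 𝔭 ^ 2 ∣ δ ∧ ∀ 𝔮 : Ideal (𝓞 K), 𝔮.IsPrime → 𝔮 ∣ 𝔇 → 𝔮 ≠ 𝔭 → ¬ 𝔮 ∣ δ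

theorem divisorSum_eq_normSum (hprin : ∀ I : Ideal (𝓞 K), I ≠ ⊥ → I.IsPrincipal)
    (𝔇 𝔭 : Ideal (𝓞 K)) {α : 𝓞 K} (hα : α ≠ 0) :
    divisorSum 𝔇 𝔭 α = normSum (IsAdmissible 𝔇 𝔭) (Ideal.span {α}) := by
  have : admissibleDivisors 𝔇 𝔭 α = {δ | δ ∣ Ideal.span {α} ∧ IsAdmissible 𝔇 𝔭 δ} := by
    ext δ
    constructor
    · exact fun h => h.2
    · refine fun h => ⟨hprin δ ?_, h⟩
      rintro rfl
      exact hα (by simpa using zero_dvd_iff.1 h.1)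
  rw [divisorSum, this, normSum]

theorem normSum_isAdmissible_of_not_dvd {𝔇 𝔭 I : Ideal (𝓞 K)} (h𝔭I : ¬ 𝔭 ∣ I) :
    normSum (IsAdmissible 𝔇 𝔭) I = normSum (CoprimeTo 𝔇) I := by
  refine normSum_congr fun δ hδ => ⟨fun h 𝔮 h1 h2 h3 => ?_, fun h => ⟨fun h' => ?_, ?_⟩⟩
  · by_cases h4 : 𝔮 = 𝔭
    · exact h𝔭I (h4 ▸ h3.trans hδ)
    · exact h.2 𝔮 h1 h2 h4 h3
  · exact h𝔭I ((dvd_pow_self 𝔭 two_ne_zero).trans (h'.trans hδ))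
  · exact fun 𝔮 h1 h2 _ => h 𝔮 h1 h2

theorem normSum_isAdmissible_mul {𝔇 𝔭 I : Ideal (𝓞 K)} (h𝔭 : Prime 𝔭) (h𝔭𝔇 : 𝔭 ∣ 𝔇)
    (h𝔇 : 𝔇 ≠ ⊥) (hI : I ≠ ⊥) :
    normSum (IsAdmissible 𝔇 𝔭) (𝔭 * I) =
      (Ideal.absNorm 𝔭 + 1) * normSum (CoprimeTo 𝔇) (𝔭 * I) := by
  have h1 : ∀ δ, IsAdmissible 𝔇 𝔭 δ ∧ ¬ 𝔭 ∣ δ ↔ CoprimeTo 𝔇 δ := by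
    refine fun δ => ⟨fun h 𝔮 h1 h2 h3 => ?_, fun h => ⟨⟨fun h' => ?_, ?_⟩, ?_⟩⟩
    · by_cases h4 : 𝔮 = 𝔭
      · exact h.2 (h4 ▸ h3)
      · exact h.1.2 𝔮 h1 h2 h4 h3
    · exact h 𝔭 (Ideal.isPrime_of_prime h𝔭) h𝔭𝔇 ((dvd_pow_self 𝔭 two_ne_zero).trans h')
    · exact fun 𝔮 h1 h2 _ => h 𝔮 h1 h2
    · exact h 𝔭 (Ideal.isPrime_of_prime h𝔭) h𝔭𝔇
  have h2 : ∀ δ, IsAdmissible 𝔇 𝔭 (𝔭 * δ) ↔ CoprimeTo 𝔇 δ := by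
    intro δ
    rw [← h1, IsAdmissible, IsAdmissible, sq, mul_dvd_mul_iff_left h𝔭.ne_zero]
    constructor
    · rintro ⟨h3, h4⟩
      exact ⟨⟨fun h => h3 ((dvd_mul_right 𝔭 𝔭).trans h),
        fun 𝔮 a b d e => h4 𝔮 a b d (e.mul_left 𝔭)⟩, h3⟩
    · rintro ⟨⟨h3, h4⟩, h5⟩
      refine ⟨h5, fun 𝔮 a b d e => ?_⟩
      have h0 : 𝔮 ≠ ⊥ := by
        rintro rfl
        exact h𝔇 (zero_dvd_iff.1 b)
      have hp := Ideal.prime_of_isPrime h0 a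
      rcases hp.dvd_or_dvd e with h6 | h6
      · exact d (associated_iff_eq.1 (hp.associated_of_dvd h𝔭 h6))
      · exact h4 𝔮 a b d h6
  rw [normSum_prime_mul _ h𝔭 hI, normSum_congr fun δ _ => h1 δ, normSum_congr fun δ _ => h2 δ,
    normSum_coprimeTo_mul_of_dvd h𝔭 h𝔭𝔇 hI]
  ring

end DivisorSum

namespace StandardInvolution

/-! ### Counting the elements of given norm -/

section Counting

theorem ne_zero_of_span_nm_eq {R H : Type*} [CommRing R] [Ring H] [Algebra R H] [FaithfulSMul R H]
    {D : StandardInvolution R H} {q : Ideal R} (hq0 : q ≠ ⊥) {π : H}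
    (hπ : Ideal.span {D.nm π} = q) : π ≠ 0 := by
  rintro rfl
  apply hq0
  rw [← hπ, D.nm_zero, Ideal.span_singleton_eq_bot]

variable {K : Type*} [Field K] [NumberField K] {H : Type*} [Ring H] [Algebra (𝓞 K) H]

/-- The properties of a definite order of class number one that the counting uses: rank four,
principal right ideals, totally positive norms of nonzero elements, and finiteness of the sets of
elements of given norm. -/
structure IsDefinitePrincipal (D : StandardInvolution (𝓞 K) H) : Prop where
  finrank_eq : Module.finrank (𝓞 K) H = 4
  principal : IsRightPrincipal (𝓞 K) H
  pos : ∀ x, x ≠ 0 → IsTotallyPositive (D.nm x : K)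
  finite : ∀ α, {x | D.nm x = α}.Finite

/-- The number of elements of norm `α`. -/
noncomputable def count (D : StandardInvolution (𝓞 K) H) (α : 𝓞 K) : ℕ := {x | D.nm x = α}.ncard

theorem IsDefinitePrincipal.exists_generator [FaithfulSMul (𝓞 K) H]
    [Module.Flat (𝓞 K) H] [Module.Finite (𝓞 K) H] {D : StandardInvolution (𝓞 K) H}
    (h : D.IsDefinitePrincipal) (I : Ideal (𝓞 K)) (hI : I ≠ ⊥) :
    ∃ α : 𝓞 K, IsTotallyPositive (α : K) ∧ Ideal.span {α} = I := by
  refine exists_totallyPositive_generator (fun q hq hq0 => ?_) I hI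
  have hfin : Finite (𝓞 K ⧸ q) := Ideal.finiteQuotientOfFreeOfNeBot q hq0
  have : ∃ π, Ideal.span {D.nm π} = q := by
    by_cases hram : D.IsRamified q
    · obtain ⟨⟨π, hπ, -⟩, -⟩ := D.exists_ramified hq hq0 h.principal hram
      exact ⟨π, hπ⟩
    · obtain ⟨π, hπ, -⟩ := D.exists_split hq hq0 hfin h.finrank_eq h.principal hram
      exact ⟨π 0, hπ 0⟩
  obtain ⟨π, hπ⟩ := this
  exact ⟨D.nm π, h.pos π (ne_zero_of_span_nm_eq hq0 hπ), hπ⟩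

theorem exists_real_embedding [IsTotallyReal K] : Nonempty (K →+* ℝ) :=
  ⟨InfinitePlace.embedding_of_isReal (IsTotallyReal.isReal (Classical.arbitrary _))⟩

theorem ne_zero_of_totallyPositive [IsTotallyReal K] {α : 𝓞 K}
    (hα : IsTotallyPositive (α : K)) : α ≠ 0 := by
  rintro rfl
  obtain ⟨σ⟩ := exists_real_embedding (K := K)
  have := hα σ
  rw [RingOfIntegers.coe_eq_algebraMap, map_zero, map_zero] at this
  exact this.false

variable [IsTotallyReal K] {D : StandardInvolution (𝓞 K) H}

theorem IsDefinitePrincipal.eq_zero (h : D.IsDefinitePrincipal) {x : H} (hx : D.nm x = 0) :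
    x = 0 := by
  by_contra hne
  exact ne_zero_of_totallyPositive (h.pos x hne) hx

variable [FaithfulSMul (𝓞 K) H]

theorem IsDefinitePrincipal.mul_left_cancel (h : D.IsDefinitePrincipal) {x y z : H} (hx : x ≠ 0)
    (hyz : x * y = x * z) : y = z := by
  rw [← sub_eq_zero]
  apply h.eq_zero
  have h1 : D.nm x * D.nm (y - z) = 0 := by
    rw [← D.nm_mul, mul_sub, hyz, sub_self, D.nm_zero]
  exact (mul_eq_zero.1 h1).resolve_left fun h0 => hx (h.eq_zero h0)

/-- Multiplication by an element of norm `ϖ`. -/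
theorem IsDefinitePrincipal.ncard_mul_left (h : D.IsDefinitePrincipal) {π : H} {ϖ α : 𝓞 K}
    (hπ : D.nm π = ϖ) (hϖ : ϖ ≠ 0) :
    {x | D.nm x = ϖ * α ∧ ∃ y, x = π * y}.ncard = D.count α := by
  have hπ0 : π ≠ 0 := by
    rintro rfl
    exact hϖ (by rw [← hπ, D.nm_zero])
  have : {x | D.nm x = ϖ * α ∧ ∃ y, x = π * y} = (fun y => π * y) '' {y | D.nm y = α} := by
    ext x
    constructor
    · rintro ⟨h1, y, rfl⟩
      rw [D.nm_mul, hπ] at h1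
      exact ⟨y, mul_left_cancel₀ hϖ h1, rfl⟩
    · rintro ⟨y, hy, rfl⟩
      refine ⟨?_, y, rfl⟩
      rw [D.nm_mul, hπ, hy]
  rw [this, Set.ncard_image_of_injective _ (fun y z hyz => h.mul_left_cancel hπ0 hyz), count]

variable [Module.Flat (𝓞 K) H] [Module.Finite (𝓞 K) H]

theorem IsDefinitePrincipal.exists_unit_sq (h : D.IsDefinitePrincipal) (u : (𝓞 K)ˣ)
    (hu : IsTotallyPositive ((u : 𝓞 K) : K)) : ∃ v : (𝓞 K)ˣ, u = v ^ 2 :=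
  exists_sq_eq_of_totallyPositive h.exists_generator u hu

/-- A generator of a right ideal can be normalized to have a given totally positive generator of the
norm ideal as its norm. -/
theorem IsDefinitePrincipal.exists_normalized (h : D.IsDefinitePrincipal) {q : Ideal (𝓞 K)}
    (hq0 : q ≠ ⊥) {π : H} (hπ : Ideal.span {D.nm π} = q) {ϖ : 𝓞 K}
    (hϖ : IsTotallyPositive (ϖ : K)) (hϖq : Ideal.span {ϖ} = q) :
    ∃ π', D.nm π' = ϖ ∧ ∀ x, (∃ y, x = π * y) ↔ ∃ y, x = π' * y := by
  obtain ⟨u, hu⟩ := Ideal.span_singleton_eq_span_singleton.1 (hπ.trans hϖq.symm)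
  have hpos := h.pos π (ne_zero_of_span_nm_eq hq0 hπ)
  obtain ⟨v, rfl⟩ := h.exists_unit_sq u (by
    rw [← hu] at hϖ
    exact hpos.of_mul_left hϖ)
  refine ⟨(v : 𝓞 K) • π, ?_, fun x => ⟨?_, ?_⟩⟩
  · rw [D.nm_smul, ← hu, Units.val_pow_eq_pow_val, mul_comm]
  · rintro ⟨y, rfl⟩
    refine ⟨((v⁻¹ : (𝓞 K)ˣ) : 𝓞 K) • y, ?_⟩
    rw [smul_mul_smul_comm, Units.mul_inv, one_smul]
  · rintro ⟨y, rfl⟩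
    exact ⟨(v : 𝓞 K) • y, by rw [smul_mul_assoc, mul_smul_comm]⟩

theorem IsDefinitePrincipal.count_mul_of_isRamified (h : D.IsDefinitePrincipal)
    {q : Ideal (𝓞 K)} (hq : q.IsPrime) (hq0 : q ≠ ⊥) (hram : D.IsRamified q) {ϖ : 𝓞 K}
    (hϖ : IsTotallyPositive (ϖ : K)) (hϖq : Ideal.span {ϖ} = q) (α : 𝓞 K) :
    D.count (ϖ * α) = D.count α := by
  obtain ⟨⟨π, hπ, hπ'⟩, -⟩ := D.exists_ramified hq hq0 h.principal hram
  obtain ⟨π', hn, hiff⟩ := h.exists_normalized hq0 hπ hϖ hϖq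
  rw [← h.ncard_mul_left (α := α) hn (ne_zero_of_totallyPositive hϖ), count]
  congr 1
  ext x
  refine ⟨fun hx => ⟨hx, ?_⟩, fun hx => hx.1⟩
  rw [← hiff, ← hπ']
  have hx' : D.nm x = ϖ * α := hx
  rw [hx', ← hϖq]
  exact Ideal.mul_mem_right _ _ (Ideal.mem_span_singleton_self ϖ)

/-- Double counting of the pairs consisting of `x` of norm `ϖ α` and of one of the `N + 1` right
ideals of norm `q` containing it. -/
theorem IsDefinitePrincipal.count_mul_add (h : D.IsDefinitePrincipal)
    {q : Ideal (𝓞 K)} (hq : q.IsPrime) (hq0 : q ≠ ⊥) (hram : ¬ D.IsRamified q) {ϖ : 𝓞 K}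
    (hϖ : IsTotallyPositive (ϖ : K)) (hϖq : Ideal.span {ϖ} = q) (α : 𝓞 K) :
    D.count (ϖ * α) + Ideal.absNorm q * {x | ϖ * D.nm x = α}.ncard =
      (Ideal.absNorm q + 1) * D.count α := by
  classical
  have hfin : Finite (𝓞 K ⧸ q) := Ideal.finiteQuotientOfFreeOfNeBot q hq0
  have hϖ0 := ne_zero_of_totallyPositive hϖ
  have hN : Ideal.absNorm q = Nat.card (𝓞 K ⧸ q) := rfl
  obtain ⟨π₀, hπ₀, hext₀, huniq₀⟩ := D.exists_split hq hq0 hfin h.finrank_eq h.principal hram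
  choose π hn hiff using fun l => h.exists_normalized hq0 (hπ₀ l) hϖ hϖq
  simp only [hiff] at hext₀ huniq₀
  set X : Finset H := (h.finite (ϖ * α)).toFinset with hX
  have memX : ∀ x, x ∈ X ↔ D.nm x = ϖ * α := fun x => by simp [X]
  let r : Fin (Nat.card (𝓞 K ⧸ q) + 1) → H → Prop := fun l x => ∃ y, x = π l * y
  have hcount := Finset.sum_card_bipartiteAbove_eq_sum_card_bipartiteBelow
    (s := (Finset.univ : Finset (Fin (Nat.card (𝓞 K ⧸ q) + 1)))) (t := X) r
  have hleft : ∀ l, (X.bipartiteAbove r l).card = D.count α := by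
    intro l
    rw [← h.ncard_mul_left (hn l) hϖ0, ← Set.ncard_coe_finset]
    congr 1
    ext x
    simp [Finset.bipartiteAbove, memX, r]
  have hright : ∀ x ∈ X, (Finset.univ.bipartiteBelow r x).card =
      1 + if x ∈ extIdeal H q then Nat.card (𝓞 K ⧸ q) else 0 := by
    intro x hx
    split_ifs with hxq
    · have : Finset.univ.bipartiteBelow r x = Finset.univ := by
        ext l
        simpa [Finset.bipartiteBelow, r] using hext₀ x hxq l
      rw [this, Finset.card_univ, Fintype.card_fin, add_comm]
    · obtain ⟨l, hl, hl'⟩ := huniq₀ x hxq (by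
        rw [(memX x).1 hx, ← hϖq]
        exact Ideal.mul_mem_right _ _ (Ideal.mem_span_singleton_self ϖ))
      have : Finset.univ.bipartiteBelow r x = {l} := by
        ext l'
        simp only [Finset.bipartiteBelow, Finset.mem_filter, Finset.mem_univ, true_and,
          Finset.mem_singleton]
        exact ⟨fun h => hl' l' h, fun h => h ▸ hl⟩
      rw [this, Finset.card_singleton]
  have hX0 : (X.filter (fun x => x ∈ extIdeal H q)).card = {x | ϖ * D.nm x = α}.ncard := by
    have hinj : Function.Injective (fun y : H => ϖ • y) := by
      intro y z hyz
      have h1 : algebraMap (𝓞 K) H ϖ * y = algebraMap (𝓞 K) H ϖ * z := by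
        simpa [Algebra.smul_def] using hyz
      refine h.mul_left_cancel ?_ h1
      rwa [ne_eq, FaithfulSMul.algebraMap_eq_zero_iff]
    rw [← Set.ncard_image_of_injective _ hinj, ← Set.ncard_coe_finset]
    congr 1
    ext x
    simp only [Finset.coe_filter, memX]
    constructor
    · rintro ⟨h1, h2⟩
      rw [mem_extIdeal, ← hϖq] at h2
      rw [Submodule.ideal_span_singleton_smul] at h2
      obtain ⟨y, -, rfl⟩ := (Submodule.mem_smul_pointwise_iff_exists _ _ _).1 h2
      refine ⟨y, ?_, rfl⟩
      rw [D.nm_smul, sq, mul_assoc] at h1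
      exact mul_left_cancel₀ hϖ0 h1
    · rintro ⟨y, hy, rfl⟩
      refine ⟨?_, smul_mem_extIdeal H q (hϖq ▸ Ideal.mem_span_singleton_self ϖ) y⟩
      have hy' : ϖ * D.nm y = α := hy
      rw [D.nm_smul, ← hy', sq, mul_assoc]
  have hXc : X.card = D.count (ϖ * α) := by
    rw [count, ← Set.ncard_coe_finset, hX, Set.Finite.coe_toFinset]
  rw [Finset.sum_congr rfl (fun l _ => hleft l), Finset.sum_congr rfl hright,
    Finset.sum_const, Finset.card_univ, Fintype.card_fin, smul_eq_mul, Finset.sum_add_distrib,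
    Finset.sum_const, smul_eq_mul, mul_one, ← Finset.sum_filter, Finset.sum_const, smul_eq_mul,
    hX0, hXc] at hcount
  rw [hN, hcount, mul_comm (Nat.card _)]

/-- The number of elements of norm `α` in a definite order of class number one: both sides satisfy
the same recursion along the prime factorization of `α`. -/
theorem IsDefinitePrincipal.count_eq (h : D.IsDefinitePrincipal) {𝔇 : Ideal (𝓞 K)} (h𝔇 : 𝔇 ≠ ⊥)
    (hram : ∀ q : Ideal (𝓞 K), q.IsPrime → q ≠ ⊥ → (D.IsRamified q ↔ q ∣ 𝔇))
    (α : 𝓞 K) (hα : IsTotallyPositive (α : K)) :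
    D.count α = D.count 1 * normSum (CoprimeTo 𝔇) (Ideal.span {α}) := by
  induction hn : Ideal.absNorm (Ideal.span {α}) using Nat.strong_induction_on generalizing α with
  | _ n ih =>
  subst hn
  have hα0 := ne_zero_of_totallyPositive hα
  by_cases hu : IsUnit α
  · obtain ⟨u, rfl⟩ := hu
    obtain ⟨v, rfl⟩ := h.exists_unit_sq u hα
    rw [Ideal.span_singleton_eq_top.2 (v ^ 2).isUnit, ← Ideal.one_eq_top,
      normSum_one (coprimeTo_one 𝔇), mul_one]
    rw [← h.ncard_mul_left (π := algebraMap _ H (v : 𝓞 K)) (ϖ := (v : 𝓞 K) ^ 2) (α := 1)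
      (D.nm_algebraMap _) (pow_ne_zero 2 v.ne_zero), count]
    congr 1
    ext x
    simp only [Set.mem_ofPred_eq, mul_one, Units.val_pow_eq_pow_val]
    refine ⟨fun hx => ⟨hx, algebraMap _ H ((v⁻¹ : (𝓞 K)ˣ) : 𝓞 K) * x, ?_⟩, fun hx => hx.1⟩
    rw [← mul_assoc, ← map_mul, Units.mul_inv, map_one, one_mul]
  obtain ⟨q, hqm, hq⟩ := Ideal.exists_le_maximal (Ideal.span {α})
    (by rwa [ne_eq, Ideal.span_singleton_eq_top])
  have hqp := hqm.isPrime
  have hq0 : q ≠ ⊥ := by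
    rintro rfl
    rw [le_bot_iff, Ideal.span_singleton_eq_bot] at hq
    exact hα0 hq
  have hqP := Ideal.prime_of_isPrime hq0 hqp
  obtain ⟨ϖ, hϖ, hϖq⟩ := h.exists_generator q hq0
  have hϖ0 := ne_zero_of_totallyPositive hϖ
  have hN1 : 1 < Ideal.absNorm q := by
    have h1 : Ideal.absNorm q ≠ 1 := by
      rw [ne_eq, Ideal.absNorm_eq_one_iff]
      exact hqp.ne_top
    have h2 : Ideal.absNorm q ≠ 0 := by rwa [ne_eq, Ideal.absNorm_eq_zero_iff]
    omega
  have hfac : ∀ β : 𝓞 K, Ideal.span {ϖ * β} = q * Ideal.span {β} := fun β => by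
    rw [← Ideal.span_singleton_mul_span_singleton, hϖq]
  have hlt : ∀ β : 𝓞 K, β ≠ 0 →
      Ideal.absNorm (Ideal.span {β}) < Ideal.absNorm (Ideal.span {ϖ * β}) := by
    intro β hβ
    rw [hfac, map_mul]
    have : 0 < Ideal.absNorm (Ideal.span {β}) := by
      rw [Nat.pos_iff_ne_zero, ne_eq, Ideal.absNorm_eq_zero_iff, Ideal.span_singleton_eq_bot]
      exact hβ
    nlinarith
  obtain ⟨β, rfl⟩ : ϖ ∣ α := by
    rw [← Ideal.span_singleton_le_span_singleton, hϖq]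
    exact hq
  have hβ := hϖ.of_mul_left hα
  have hβ0 := ne_zero_of_totallyPositive hβ
  have hβI : Ideal.span {β} ≠ ⊥ := by rwa [ne_eq, Ideal.span_singleton_eq_bot]
  have ihβ := ih _ (hlt β hβ0) β hβ rfl
  rw [hfac]
  by_cases hr : D.IsRamified q
  · rw [h.count_mul_of_isRamified hqp hq0 hr hϖ hϖq, ihβ,
      normSum_coprimeTo_mul_of_dvd hqP ((hram q hqp hq0).1 hr) hβI]
  have hq𝔇 : ¬ q ∣ 𝔇 := fun h => hr ((hram q hqp hq0).2 h)
  have hrec := h.count_mul_add hqp hq0 hr hϖ hϖq β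
  rw [ihβ] at hrec
  by_cases hdvd : ϖ ∣ β
  · obtain ⟨γ, rfl⟩ := hdvd
    have hγ := hϖ.of_mul_left hβ
    have hγ0 := ne_zero_of_totallyPositive hγ
    have hγI : Ideal.span {γ} ≠ ⊥ := by rwa [ne_eq, Ideal.span_singleton_eq_bot]
    have ihγ := ih _ ((hlt γ hγ0).trans (hlt _ hβ0)) γ hγ rfl
    have hset : {x | ϖ * D.nm x = ϖ * γ} = {x | D.nm x = γ} := by
      ext x
      exact mul_right_inj' hϖ0
    rw [hset, ← count, ihγ, hfac] at hrec
    have h1 := normSum_coprimeTo_mul_mul hqP hq𝔇 h𝔇 hγI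
    rw [hfac]
    have h2 : D.count 1 * (_ + _ * _) = D.count 1 * _ := congrArg (D.count 1 * ·) h1
    linarith
  · have hset : {x | ϖ * D.nm x = β} = ∅ := by
      rw [Set.eq_empty_iff_forall_notMem]
      exact fun x hx => hdvd ⟨_, hx.symm⟩
    rw [hset, Set.ncard_empty, mul_zero, add_zero] at hrec
    have h1 : ¬ q ∣ Ideal.span {β} := by
      rwa [Ideal.dvd_iff_le, ← hϖq, Ideal.span_singleton_le_span_singleton]
    rw [hrec, normSum_coprimeTo_mul_of_not_dvd hqP hq𝔇 h𝔇 hβI h1]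
    ring

end Counting

end StandardInvolution

/-! ### Suborders of prime index -/

section LinearAlgebra

/-- A four by four matrix of corank at least two has vanishing adjugate. -/
theorem adjugate_eq_zero_of_rank_le {F : Type*} [Field F] (A : Matrix (Fin 4) (Fin 4) F)
    (hA : A.rank ≤ 2) : A.adjugate = 0 := by
  ext i j
  rw [Matrix.zero_apply]
  by_contra h
  rw [Matrix.adjugate_apply] at h
  have h1 := Matrix.linearIndependent_rows_of_det_ne_zero h
  have h2 : LinearIndependent F (fun k : {k : Fin 4 // k ≠ j} => A k) := by
    have h3 := h1.comp (fun k : {k : Fin 4 // k ≠ j} => (k : Fin 4)) Subtype.val_injective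
    convert! h3 using 1
    funext k
    simp [Matrix.updateRow_ne k.2]
  have h4 := finrank_span_eq_card h2
  have h5 : Submodule.span F (Set.range fun k : {k : Fin 4 // k ≠ j} => A k) ≤
      Submodule.span F (Set.range A.row) := by
    apply Submodule.span_mono
    rintro _ ⟨k, rfl⟩
    exact ⟨k, rfl⟩
  have h6 := Submodule.finrank_mono h5
  rw [← Matrix.rank_eq_finrank_span_row] at h6
  have h7 : Fintype.card {k : Fin 4 // k ≠ j} = 3 := by simp
  omega

/-- If `M` has corank at least two modulo `p`, then `p ^ 2` divides its determinant, as one sees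
from `det (adjugate M) = det M ^ 3`. -/
theorem det_mem_sq_of_rank_le {R : Type*} [CommRing R] [IsDedekindDomain R] {p : Ideal R}
    [hpm : p.IsMaximal] (hp0 : p ≠ ⊥) (M : Matrix (Fin 4) (Fin 4) R)
    (hM : letI := Ideal.Quotient.field p; (M.map (Ideal.Quotient.mk p)).rank ≤ 2) :
    M.det ∈ p ^ 2 := by
  let _ := Ideal.Quotient.field p
  have hp := Ideal.prime_of_isPrime hp0 hpm.isPrime
  have h1 := adjugate_eq_zero_of_rank_le (M.map (Ideal.Quotient.mk p)) hM
  have h2 : ∀ i j, M.adjugate i j ∈ p := by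
    intro i j
    rw [← Ideal.Quotient.eq_zero_iff_mem]
    have h3 := congrFun (congrFun ((Ideal.Quotient.mk p).map_adjugate M) i) j
    rw [RingHom.mapMatrix_apply, RingHom.mapMatrix_apply, h1] at h3
    exact h3
  have h3 : M.det ^ 3 ∈ p ^ 4 := by
    have h4 := Matrix.det_adjugate M
    rw [Fintype.card_fin] at h4
    rw [← h4, Matrix.det_apply]
    refine Submodule.sum_mem _ fun τ _ => ?_
    have h5 : ∏ i, M.adjugate (τ i) i ∈ ∏ _i : Fin 4, p := Ideal.prod_mem_prod fun i _ => h2 _ _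
    rw [Finset.prod_const, Finset.card_univ, Fintype.card_fin] at h5
    rw [Units.smul_def]
    exact zsmul_mem h5 _
  rw [← Ideal.span_singleton_le_iff_mem, ← Ideal.dvd_iff_le, ← Ideal.span_singleton_pow] at h3
  rw [← Ideal.span_singleton_le_iff_mem, ← Ideal.dvd_iff_le]
  obtain ⟨J, hJ⟩ := hp.dvd_of_dvd_pow ((dvd_pow_self p (by norm_num)).trans h3)
  rw [hJ, mul_pow, pow_succ p 3] at h3
  rw [hJ, sq]
  exact mul_dvd_mul_left p
    (hp.dvd_of_dvd_pow ((mul_dvd_mul_iff_left (pow_ne_zero 3 hp0)).1 h3))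

/-- Counting the incidences of a set `s` with the translates of the points of `X` in two ways. -/
theorem card_mul_eq_of_translates {ι T : Type*} [Fintype ι] [DecidableEq T] (e : ι → Equiv.Perm T)
    (X : Finset T) (hX : ∀ u x, e u x ∈ X ↔ x ∈ X) (s : T → Prop) [DecidablePred s] (g : ℕ)
    (hg : ∀ x ∈ X, (Finset.univ.filter fun u => s (e u x)).card = g) :
    X.card * g = Fintype.card ι * (X.filter s).card := by
  have h := Finset.sum_card_bipartiteAbove_eq_sum_card_bipartiteBelow
    (s := (Finset.univ : Finset ι)) (t := X) (fun u x => s (e u x))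
  have h1 : ∀ u, (X.bipartiteAbove (fun u x => s (e u x)) u).card = (X.filter s).card := by
    intro u
    refine Finset.card_bij (fun x _ => e u x) ?_ ?_ ?_
    · intro x hx
      rw [Finset.bipartiteAbove, Finset.mem_filter] at hx
      rw [Finset.mem_filter, hX]
      exact hx
    · intro x _ y _ hxy
      exact (e u).injective hxy
    · intro y hy
      rw [Finset.mem_filter] at hy
      refine ⟨(e u).symm y, ?_, (e u).apply_symm_apply y⟩
      rw [Finset.bipartiteAbove, Finset.mem_filter, ← hX u, (e u).apply_symm_apply]
      exact hy
  have h2 : ∀ x ∈ X, (Finset.univ.bipartiteBelow (fun u x => s (e u x)) x).card = g := hg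
  rw [Finset.sum_congr rfl fun u _ => h1 u, Finset.sum_const, Finset.card_univ, smul_eq_mul,
    Finset.sum_congr rfl h2, Finset.sum_const, smul_eq_mul] at h
  exact h.symm

end LinearAlgebra

namespace StandardInvolution

section Suborder

variable {R H : Type*} [CommRing R] [Ring H] [Algebra R H]

/-- The image of a submodule of `H` in `H / q H`. -/
def barSubmodule (q : Ideal R) (S : Submodule R H) : Submodule (R ⧸ q) (H ⧸ extIdeal H q) where
  carrier := {b | ∃ x ∈ S, Ideal.Quotient.mk (extIdeal H q) x = b}
  add_mem' := by
    rintro _ _ ⟨x, hx, rfl⟩ ⟨y, hy, rfl⟩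
    exact ⟨x + y, add_mem hx hy, map_add _ _ _⟩
  zero_mem' := ⟨0, zero_mem _, map_zero _⟩
  smul_mem' := by
    rintro r _ ⟨x, hx, rfl⟩
    obtain ⟨r, rfl⟩ := Ideal.Quotient.mk_surjective r
    exact ⟨r • x, S.smul_mem r hx, (mk_smul_mk H q r x).symm⟩

theorem mk_mem_barSubmodule {q : Ideal R} {S : Submodule R H} (hS : ∀ x ∈ extIdeal H q, x ∈ S)
    {x : H} : Ideal.Quotient.mk (extIdeal H q) x ∈ barSubmodule q S ↔ x ∈ S := by
  constructor
  · rintro ⟨y, hy, hyx⟩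
    rw [Ideal.Quotient.eq] at hyx
    have := sub_mem hy (hS _ hyx)
    rwa [sub_sub_cancel] at this
  · exact fun h => ⟨x, h, rfl⟩

/-- If the determinants of the endomorphisms of `H` with image in `S` generate `p`, then
`p H ≤ S`. -/
theorem extIdeal_le_of_span_det [Module.Free R H] [Module.Finite R H] {p : Ideal R}
    {S : Submodule R H}
    (hS : Ideal.span {d | ∃ f : H →ₗ[R] H, (∀ x, f x ∈ S) ∧ LinearMap.det f = d} = p) :
    ∀ x ∈ extIdeal H p, x ∈ S := by
  classical
  have key : ∀ f : H →ₗ[R] H, (∀ x, f x ∈ S) → ∀ x, LinearMap.det f • x ∈ S := by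
    intro f hf x
    let b := Module.Free.chooseBasis R H
    let g : H →ₗ[R] H := Matrix.toLin b b (LinearMap.toMatrix b b f).adjugate
    have h1 : f ∘ₗ g = LinearMap.det f • LinearMap.id := by
      apply (LinearMap.toMatrix b b).injective
      rw [LinearMap.toMatrix_comp b b b, LinearMap.toMatrix_toLin, Matrix.mul_adjugate, map_smul,
        LinearMap.toMatrix_id, LinearMap.det_toMatrix]
    have h2 : LinearMap.det f • x = f (g x) := by
      have := LinearMap.congr_fun h1 x
      simpa using this.symm
    rw [h2]
    exact hf _
  intro x hx
  rw [mem_extIdeal] at hx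
  refine Submodule.smul_induction_on hx (fun r hr n _ => ?_) (fun a b ha hb => add_mem ha hb)
  rw [← hS] at hr
  refine Submodule.span_induction ?_ ?_ ?_ ?_ hr
  · rintro _ ⟨f, hf, rfl⟩
    exact key f hf n
  · rw [zero_smul]; exact zero_mem _
  · intro a b _ _ ha hb
    rw [add_smul]
    exact add_mem ha hb
  · intro a b _ hb
    rw [smul_eq_mul, mul_smul]
    exact S.smul_mem _ hb

/-- If the determinants of the endomorphisms of `H` with image in `S` generate the prime `p`, then
`S / p H` has codimension at most one. -/
theorem two_lt_finrank_barSubmodule [IsDedekindDomain R] [Module.Free R H] [Module.Finite R H]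
    (hrank : Module.finrank R H = 4) {p : Ideal R} [hpm : p.IsMaximal] (hp0 : p ≠ ⊥)
    {S : Submodule R H} [Finite (R ⧸ p)]
    (hS : Ideal.span {d | ∃ f : H →ₗ[R] H, (∀ x, f x ∈ S) ∧ LinearMap.det f = d} = p) :
    letI := Ideal.Quotient.field p
    2 < Module.finrank (R ⧸ p) (barSubmodule p S) := by
  let _ := Ideal.Quotient.field p
  by_contra! hle
  have hfin : Module.Finite (R ⧸ p) (H ⧸ extIdeal H p) :=
    Module.finite_of_finrank_pos (by rw [finrank_quotient_extIdeal, hrank]; norm_num)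
  have b : Module.Basis (Fin 4) R H := Module.finBasisOfFinrankEq R H hrank
  let φ : H →+ (Fin 4 → R ⧸ p) :=
    { toFun := fun x i => Ideal.Quotient.mk p (b.repr x i)
      map_zero' := by ext; simp
      map_add' := fun x y => by ext; simp }
  have hφ : ∀ x ∈ extIdeal H p, φ x = 0 := by
    intro x hx
    rw [mem_extIdeal] at hx
    refine Submodule.smul_induction_on hx (fun r hr n _ => ?_) (fun x y ha hb => ?_)
    · funext i
      change Ideal.Quotient.mk p (b.repr (r • n) i) = 0
      rw [map_smul, Finsupp.smul_apply, smul_eq_mul, Ideal.Quotient.eq_zero_iff_mem]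
      exact p.mul_mem_right _ hr
    · rw [map_add, ha, hb, add_zero]
  let ψ' : (H ⧸ extIdeal H p) →+ (Fin 4 → R ⧸ p) :=
    QuotientAddGroup.lift (Submodule.toAddSubgroup (extIdeal H p)) φ hφ
  have hψ' : ∀ x, ψ' (Ideal.Quotient.mk _ x) = φ x := fun x => rfl
  let ψ : (H ⧸ extIdeal H p) →ₗ[R ⧸ p] (Fin 4 → R ⧸ p) :=
    { ψ' with
      map_smul' := by
        intro r x
        obtain ⟨r, rfl⟩ := Ideal.Quotient.mk_surjective r
        obtain ⟨x, rfl⟩ := Ideal.Quotient.mk_surjective x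
        change ψ' _ = _ • ψ' _
        rw [mk_smul_mk, hψ', hψ']
        funext i
        change Ideal.Quotient.mk p (b.repr (r • x) i) = _
        rw [map_smul, Finsupp.smul_apply, smul_eq_mul, map_mul]
        rfl }
  have hdet : ∀ f : H →ₗ[R] H, (∀ x, f x ∈ S) → LinearMap.det f ∈ p ^ 2 := by
    intro f hf
    rw [← LinearMap.det_toMatrix b]
    apply det_mem_sq_of_rank_le hp0
    rw [Matrix.rank_eq_finrank_span_cols]
    refine le_trans (le_trans (Submodule.finrank_mono (t := (barSubmodule p S).map ψ) ?_)
      (Submodule.finrank_map_le ψ _)) hle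
    rw [Submodule.span_le]
    rintro _ ⟨j, rfl⟩
    refine ⟨Ideal.Quotient.mk _ (f (b j)), ⟨_, hf _, rfl⟩, ?_⟩
    funext i
    change Ideal.Quotient.mk p (b.repr (f (b j)) i) = _
    rw [Matrix.col_apply, Matrix.map_apply, LinearMap.toMatrix_apply]
  have hlt := Ideal.pow_lt_self p hp0 hpm.ne_top 2 le_rfl
  refine hlt.not_ge ?_
  conv_lhs => rw [← hS]
  rw [Ideal.span_le]
  rintro _ ⟨f, hf, rfl⟩
  exact hdet f hf

end Suborder

end StandardInvolution

namespace StandardInvolution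

section Perceptive

open Module

variable {K : Type*} [Field K] [NumberField K] [IsTotallyReal K] {H : Type*} [Ring H]
  [Algebra (𝓞 K) H] [FaithfulSMul (𝓞 K) H]
  {D : StandardInvolution (𝓞 K) H} {q : Ideal (𝓞 K)}

/-- The square of the prime over a ramified `q` is `q H`. -/
theorem IsDefinitePrincipal.mul_mem_extIdeal (h : D.IsDefinitePrincipal) (hq : q.IsPrime)
    (hq0 : q ≠ ⊥) (hram : D.IsRamified q) {x y : H} (hx : D.nm x ∈ q) (hy : D.nm y ∈ q) :
    x * y ∈ extIdeal H q := by
  obtain ⟨⟨π, hπ, hmem⟩, -⟩ := D.exists_ramified hq hq0 h.principal hram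
  have hπq : D.nm π ∈ q := hπ ▸ Ideal.mem_span_singleton_self _
  have hπ0 := ne_zero_of_span_nm_eq hq0 hπ
  obtain ⟨w, hw⟩ := (hmem (D.conj π)).1 (by rwa [D.nm_conj])
  have hw1 : D.nm w = 1 := by
    have h1 : D.nm π * D.nm w = D.nm π * 1 := by rw [← D.nm_mul, ← hw, D.nm_conj, mul_one]
    exact mul_left_cancel₀ (fun h0 => hπ0 (h.eq_zero h0)) h1
  have hππ : π * π = D.nm π • D.conj w := by
    have h1 : π = D.conj π * D.conj w := by
      rw [hw, mul_assoc, mul_conj_self_of_nm_eq_one hw1, mul_one]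
    nth_rw 2 [h1]
    rw [← mul_assoc, ← D.algebraMap_nm, Algebra.smul_def]
  obtain ⟨a, rfl⟩ := (hmem x).1 hx
  obtain ⟨b, rfl⟩ := (hmem y).1 hy
  obtain ⟨c, hc⟩ := (hmem (a * π)).1 (by rw [D.nm_mul]; exact q.mul_mem_left _ hπq)
  have : π * a * (π * b) = D.nm π • (D.conj w * c * b) := by
    calc π * a * (π * b) = π * (a * π) * b := by noncomm_ring
      _ = π * π * (c * b) := by rw [hc]; noncomm_ring
      _ = D.nm π • (D.conj w * c * b) := by rw [hππ, smul_mul_assoc, mul_assoc]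
  rw [this]
  exact smul_mem_extIdeal H q hπq _

variable [Module.Flat (𝓞 K) H] [Module.Finite (𝓞 K) H]

/-- The prime over a ramified `q` has index `N ^ 2` in `H`: left multiplication by a generator
of it, modulo `q`, has it both as image and as kernel. -/
theorem IsDefinitePrincipal.finrank_bar_ramified (h : D.IsDefinitePrincipal) [hqm : q.IsMaximal]
    (hq0 : q ≠ ⊥) (hram : D.IsRamified q) {P : Submodule (𝓞 K) H} (hP : ∀ x, x ∈ P ↔ D.nm x ∈ q)
    [Finite (𝓞 K ⧸ q)] :
    letI := Ideal.Quotient.field q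
    finrank (𝓞 K ⧸ q) (barSubmodule q P) = 2 := by
  let _ := Ideal.Quotient.field q
  obtain ⟨⟨π, hπ, hmem⟩, -⟩ := D.exists_ramified hqm.isPrime hq0 h.principal hram
  have hπq : D.nm π ∈ q := hπ ▸ Ideal.mem_span_singleton_self _
  have hext : ∀ x ∈ extIdeal H q, x ∈ P := fun x hx =>
    (hP x).2 (D.nm_mem_of_mem_extIdeal q hx).1
  have hr : finrank (𝓞 K ⧸ q) (H ⧸ extIdeal H q) = 4 :=
    (finrank_quotient_extIdeal H q).trans h.finrank_eq
  have hfin : Module.Finite (𝓞 K ⧸ q) (H ⧸ extIdeal H q) :=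
    Module.finite_of_finrank_pos (by rw [hr]; norm_num)
  let f : (H ⧸ extIdeal H q) →ₗ[𝓞 K ⧸ q] (H ⧸ extIdeal H q) :=
    LinearMap.mulLeft _ (Ideal.Quotient.mk _ π)
  have hf : ∀ x, f (Ideal.Quotient.mk _ x) = Ideal.Quotient.mk _ (π * x) := fun x => rfl
  have hrange : LinearMap.range f = barSubmodule q P := by
    ext b
    obtain ⟨x, rfl⟩ := Ideal.Quotient.mk_surjective b
    rw [mk_mem_barSubmodule hext, hP]
    constructor
    · rintro ⟨c, hc⟩
      obtain ⟨y, rfl⟩ := Ideal.Quotient.mk_surjective c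
      rw [hf, Ideal.Quotient.eq] at hc
      rw [← hP]
      have h1 : π * y ∈ P := (hP _).2 ((hmem _).2 ⟨y, rfl⟩)
      have := sub_mem h1 (hext _ hc)
      rwa [sub_sub_cancel] at this
    · intro hx
      obtain ⟨y, rfl⟩ := (hmem x).1 hx
      exact ⟨Ideal.Quotient.mk _ y, hf y⟩
  have hker : LinearMap.ker f = barSubmodule q P := by
    ext b
    obtain ⟨x, rfl⟩ := Ideal.Quotient.mk_surjective b
    rw [mk_mem_barSubmodule hext, hP, LinearMap.mem_ker, hf, Ideal.Quotient.eq_zero_iff_mem]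
    constructor
    · intro hx
      rw [mem_extIdeal, ← hπ, Submodule.ideal_span_singleton_smul] at hx
      obtain ⟨y, -, hy⟩ := (Submodule.mem_smul_pointwise_iff_exists _ _ _).1 hx
      have h1 := congrArg D.nm hy
      rw [D.nm_smul, D.nm_mul, sq, mul_assoc] at h1
      have h2 := mul_left_cancel₀ (fun h0 => ne_zero_of_span_nm_eq hq0 hπ (h.eq_zero h0)) h1
      rw [← h2]
      exact q.mul_mem_right _ hπq
    · exact fun hx => h.mul_mem_extIdeal hqm.isPrime hq0 hram hπq hx
  have hsum := LinearMap.finrank_range_add_finrank_ker f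
  rw [hrange, hker, hr] at hsum
  omega

variable {G : Subalgebra (𝓞 K) H}

/-- A suborder whose determinant ideal is a ramified prime and whose translates by units of norm one
cover `H` contains the prime over it, and is an intermediate space of codimension one. -/
theorem IsDefinitePrincipal.suborder_structure (h : D.IsDefinitePrincipal) [hqm : q.IsMaximal]
    (hq0 : q ≠ ⊥) (hram : D.IsRamified q) [Finite (𝓞 K ⧸ q)]
    (hperc : ∀ x, ∃ u, D.nm u = 1 ∧ u * x ∈ G)
    (hG : Ideal.span {d | ∃ f : H →ₗ[𝓞 K] H, (∀ x, f x ∈ G) ∧ LinearMap.det f = d} = q) :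
    letI := Ideal.Quotient.field q
    (∀ x ∈ extIdeal H q, x ∈ G) ∧ (∀ x, D.nm x ∈ q → x ∈ G) ∧
      finrank (𝓞 K ⧸ q) (barSubmodule q (Subalgebra.toSubmodule G)) = 3 := by
  let _ := Ideal.Quotient.field q
  have hprin : IsPrincipalIdealRing (𝓞 K) := ⟨fun I => by
    by_cases hI : I = ⊥
    · rw [hI]; exact bot_isPrincipal
    · obtain ⟨α, -, hα⟩ := h.exists_generator I hI
      exact ⟨α, hα.symm⟩⟩
  have hfree : Module.Free (𝓞 K) H := Module.free_of_finite_type_torsion_free'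
  have hr : finrank (𝓞 K ⧸ q) (H ⧸ extIdeal H q) = 4 :=
    (finrank_quotient_extIdeal H q).trans h.finrank_eq
  have hfin : Module.Finite (𝓞 K ⧸ q) (H ⧸ extIdeal H q) :=
    Module.finite_of_finrank_pos (by rw [hr]; norm_num)
  obtain ⟨P, hP⟩ := D.exists_ramifiedSubmodule hqm.isPrime hq0 h.principal hram
  obtain ⟨⟨π, hπ, hmem⟩, -⟩ := D.exists_ramified hqm.isPrime hq0 h.principal hram
  have hπq : D.nm π ∈ q := hπ ▸ Ideal.mem_span_singleton_self _
  have hextG : ∀ x ∈ extIdeal H q, x ∈ Subalgebra.toSubmodule G :=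
    extIdeal_le_of_span_det (S := Subalgebra.toSubmodule G) hG
  have hextP : ∀ x ∈ extIdeal H q, x ∈ P := fun x hx =>
    (hP x).2 (D.nm_mem_of_mem_extIdeal q hx).1
  have h3 := two_lt_finrank_barSubmodule h.finrank_eq hq0 (S := Subalgebra.toSubmodule G) hG
  have hGne : ¬ ∀ x, x ∈ G := by
    intro hall
    apply hqm.ne_top
    rw [← hG, Ideal.eq_top_iff_one]
    exact Ideal.subset_span ⟨LinearMap.id, fun x => hall x, LinearMap.det_id⟩
  have hsup : barSubmodule q (Subalgebra.toSubmodule G) ⊔ barSubmodule q P ≠ ⊤ := by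
    intro htop
    have hdec : ∀ x, ∃ g ∈ G, ∃ p ∈ P, x = g + p := by
      intro x
      have hx : Ideal.Quotient.mk (extIdeal H q) x ∈
          barSubmodule q (Subalgebra.toSubmodule G) ⊔ barSubmodule q P := htop ▸ trivial
      obtain ⟨_, ⟨g, hg, rfl⟩, _, ⟨p, hp, rfl⟩, hgp⟩ := Submodule.mem_sup.1 hx
      rw [← map_add, Ideal.Quotient.eq] at hgp
      refine ⟨g, hg, p - (g + p - x), sub_mem hp (hextP _ hgp), ?_⟩
      abel
    -- `G` contains a generator `u * π` of the prime over `q`, so it would contain that prime.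
    obtain ⟨u, hu, huπ⟩ := hperc π
    have hPG : ∀ y ∈ P, y ∈ G := by
      intro y hy
      obtain ⟨z, hz⟩ := (hmem (D.conj u * y)).1 (by
        rw [D.nm_mul, D.nm_conj, hu, one_mul, ← hP]
        exact hy)
      have hyz : y = u * π * z := by
        rw [mul_assoc, ← hz, ← mul_assoc, mul_conj_self_of_nm_eq_one hu, one_mul]
      obtain ⟨g, hg, p, hp, rfl⟩ := hdec z
      rw [hyz, mul_add]
      refine add_mem (mul_mem huπ hg) (hextG _ ?_)
      refine h.mul_mem_extIdeal hqm.isPrime hq0 hram ?_ ((hP p).1 hp)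
      rw [D.nm_mul]
      exact q.mul_mem_left _ hπq
    apply hGne
    intro x
    obtain ⟨g, hg, p, hp, rfl⟩ := hdec x
    exact add_mem hg (hPG p hp)
  have hlt := Submodule.finrank_lt (lt_top_iff_ne_top.2 hsup).ne
  rw [hr] at hlt
  have heq : barSubmodule q (Subalgebra.toSubmodule G) =
      barSubmodule q (Subalgebra.toSubmodule G) ⊔ barSubmodule q P :=
    Submodule.eq_of_le_of_finrank_le le_sup_left (by omega)
  refine ⟨hextG, fun x hx => ?_, ?_⟩
  · have h4 : Ideal.Quotient.mk (extIdeal H q) x ∈ barSubmodule q (Subalgebra.toSubmodule G) := by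
      rw [heq]
      exact Submodule.mem_sup_right ((mk_mem_barSubmodule hextP).2 ((hP x).2 hx))
    exact (mk_mem_barSubmodule hextG).1 h4
  · have h5 := Submodule.finrank_mono (heq.ge)
    have h6 := Submodule.finrank_mono (heq.le)
    omega

end Perceptive

end StandardInvolution

namespace StandardInvolution

/-! ### Counting in a perceptive suborder -/

section PerceptiveCount

open Module

variable {K : Type*} [Field K] {H : Type*} [Ring H]
  [Algebra (𝓞 K) H] {D : StandardInvolution (𝓞 K) H} {q : Ideal (𝓞 K)} {G : Subalgebra (𝓞 K) H}

/-- Left multiplication by an element of norm one. -/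
def unitPerm (D : StandardInvolution (𝓞 K) H) (u : {u // D.nm u = 1}) : Equiv.Perm H where
  toFun x := u.1 * x
  invFun x := D.conj u.1 * x
  left_inv x := by beta_reduce; rw [← mul_assoc, conj_mul_self_of_nm_eq_one u.2, one_mul]
  right_inv x := by beta_reduce; rw [← mul_assoc, mul_conj_self_of_nm_eq_one u.2, one_mul]

/-- Left multiplication by an element of norm one, modulo `q`. -/
def unitPermBar (D : StandardInvolution (𝓞 K) H) (q : Ideal (𝓞 K)) (u : {u // D.nm u = 1}) :
    Equiv.Perm (H ⧸ extIdeal H q) where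
  toFun x := Ideal.Quotient.mk _ u.1 * x
  invFun x := Ideal.Quotient.mk _ (D.conj u.1) * x
  left_inv x := by
    beta_reduce
    rw [← mul_assoc, ← map_mul, conj_mul_self_of_nm_eq_one u.2, map_one, one_mul]
  right_inv x := by
    beta_reduce
    rw [← mul_assoc, ← map_mul, mul_conj_self_of_nm_eq_one u.2, map_one, one_mul]

variable [FaithfulSMul (𝓞 K) H]

/-- If `u₀ x ∈ G` and the norm of `x` is prime to `q`, then the `u` of norm one with `u x ∈ G` form
the coset `G¹ u₀`, because `G` agrees with `H` away from `q`. -/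
theorem ncard_unit_mul_mem [hqm : q.IsMaximal] (hext : ∀ x ∈ extIdeal H q, x ∈ G)
    (hperc : ∀ x, ∃ u, D.nm u = 1 ∧ u * x ∈ G) {x : H} (hx : D.nm x ∉ q) :
    {u | D.nm u = 1 ∧ u * x ∈ G}.ncard = {u | u ∈ G ∧ D.nm u = 1}.ncard := by
  obtain ⟨v, hv, hvx⟩ := hperc x
  have hinj : Function.Injective (fun w : H => w * v) := by
    intro w w' hw
    have h1 : w * v * D.conj v = w' * v * D.conj v := congrArg (· * D.conj v) hw
    rwa [mul_assoc, mul_assoc, mul_conj_self_of_nm_eq_one hv, mul_one, mul_one] at h1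
  rw [← Set.ncard_image_of_injective {u | u ∈ G ∧ D.nm u = 1} hinj]
  congr 1
  ext u
  constructor
  · rintro ⟨hu, hux⟩
    refine ⟨u * D.conj v, ⟨?_, ?_⟩, ?_⟩
    · have h1 : D.nm x • (u * D.conj v) ∈ G := by
        have h2 : D.nm x • (u * D.conj v) = u * x * D.conj (v * x) := by
          rw [D.conj_mul, mul_assoc, ← mul_assoc x, ← D.algebraMap_nm, Algebra.commutes,
            ← mul_assoc, Algebra.smul_def, Algebra.commutes]
        rw [h2]
        exact mul_mem hux (D.conj_mem G hvx)
      obtain ⟨s, t, ht, hst⟩ := hqm.exists_inv hx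
      rw [← one_smul (𝓞 K) (u * D.conj v), ← hst, add_smul, mul_smul]
      exact add_mem (G.smul_mem h1 s) (hext _ (smul_mem_extIdeal H q ht _))
    · rw [D.nm_mul, D.nm_conj, hu, hv, mul_one]
    · change u * D.conj v * v = u
      rw [mul_assoc, conj_mul_self_of_nm_eq_one hv, mul_one]
  · rintro ⟨w, ⟨hwG, hw⟩, rfl⟩
    refine ⟨?_, ?_⟩
    · change D.nm (w * v) = 1
      rw [D.nm_mul, hw, hv, mul_one]
    · change w * v * x ∈ G
      rw [mul_assoc]
      exact mul_mem hwG hvx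

/-- For `α` prime to `q`, count the pairs `(u, x)` with `u x ∈ G`, where `u` has norm one and `x`
has norm `α`. -/
theorem IsDefinitePrincipal.count_mul_ncard_unit (h : D.IsDefinitePrincipal) [hqm : q.IsMaximal]
    (hext : ∀ x ∈ extIdeal H q, x ∈ G) (hperc : ∀ x, ∃ u, D.nm u = 1 ∧ u * x ∈ G)
    {α : 𝓞 K} (hα : α ∉ q) :
    D.count α * {u | u ∈ G ∧ D.nm u = 1}.ncard = D.count 1 * {x | x ∈ G ∧ D.nm x = α}.ncard := by
  classical
  have hι : Finite {u // D.nm u = 1} := h.finite 1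
  have hιf := Fintype.ofFinite {u // D.nm u = 1}
  have hmem : ∀ x, x ∈ (h.finite α).toFinset ↔ D.nm x = α := fun x => by simp
  have key := card_mul_eq_of_translates D.unitPerm (h.finite α).toFinset ?_ (· ∈ G)
    {u | u ∈ G ∧ D.nm u = 1}.ncard ?_
  · rw [← Set.ncard_eq_toFinset_card _ (h.finite α), ← Nat.card_eq_fintype_card] at key
    rw [count, key]
    congr 1
    rw [← Set.ncard_coe_finset]
    congr 1
    ext x
    simp [and_comm]
  · intro u x
    rw [hmem, hmem]
    change D.nm (u.1 * x) = α ↔ _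
    rw [D.nm_mul, u.2, one_mul]
  · intro x hx
    rw [← ncard_unit_mul_mem hext hperc (x := x) (by rwa [(hmem x).1 hx]), ← Set.ncard_coe_finset,
      ← Set.ncard_image_of_injective _ Subtype.val_injective]
    congr 1
    ext u
    constructor
    · rintro ⟨u, hu, rfl⟩
      exact ⟨u.2, (Finset.mem_filter.1 hu).2⟩
    · rintro ⟨hu, hux⟩
      exact ⟨⟨u, hu⟩, Finset.mem_filter.2 ⟨Finset.mem_univ _, hux⟩, rfl⟩

variable [NumberField K] [IsTotallyReal K] [Module.Flat (𝓞 K) H] [Module.Finite (𝓞 K) H]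

/-- The index of `G¹` in `H¹`, from counting modulo `q` the pairs of a unit `u` of norm one and a
class `x` of norm prime to `q` with `u x ∈ G`. -/
theorem IsDefinitePrincipal.count_one_eq (h : D.IsDefinitePrincipal) [hqm : q.IsMaximal]
    (hq0 : q ≠ ⊥) (hram : D.IsRamified q)
    (hperc : ∀ x, ∃ u, D.nm u = 1 ∧ u * x ∈ G)
    (hG : Ideal.span {d | ∃ f : H →ₗ[𝓞 K] H, (∀ x, f x ∈ G) ∧ LinearMap.det f = d} = q) :
    D.count 1 = (Ideal.absNorm q + 1) * {u | u ∈ G ∧ D.nm u = 1}.ncard := by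
  classical
  let _ := Ideal.Quotient.field q
  have hfinq : Finite (𝓞 K ⧸ q) := Ideal.finiteQuotientOfFreeOfNeBot q hq0
  obtain ⟨hext, hPG, hdim⟩ := h.suborder_structure hq0 hram hperc hG
  obtain ⟨P, hP⟩ := D.exists_ramifiedSubmodule hqm.isPrime hq0 h.principal hram
  have hdimP := h.finrank_bar_ramified hq0 hram hP
  have hextP : ∀ x ∈ extIdeal H q, x ∈ P := fun x hx =>
    (hP x).2 (D.nm_mem_of_mem_extIdeal q hx).1
  have hextG : ∀ x ∈ extIdeal H q, x ∈ Subalgebra.toSubmodule G := hext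
  have hr : finrank (𝓞 K ⧸ q) (H ⧸ extIdeal H q) = 4 :=
    (finrank_quotient_extIdeal H q).trans h.finrank_eq
  have hfin : Module.Finite (𝓞 K ⧸ q) (H ⧸ extIdeal H q) :=
    Module.finite_of_finrank_pos (by rw [hr]; norm_num)
  have hfinT : Finite (H ⧸ extIdeal H q) := Module.finite_of_finite (𝓞 K ⧸ q)
  have := Fintype.ofFinite (H ⧸ extIdeal H q)
  have hι : Finite {u // D.nm u = 1} := h.finite 1
  have hιf := Fintype.ofFinite {u // D.nm u = 1}
  set N := Ideal.absNorm q with hNdef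
  have hN : Nat.card (𝓞 K ⧸ q) = N := rfl
  have hle : barSubmodule q P ≤ barSubmodule q (Subalgebra.toSubmodule G) :=
    fun _ ⟨x, hx, hxb⟩ => ⟨x, hPG x ((hP x).1 hx), hxb⟩
  have hcard : ∀ W : Submodule (𝓞 K ⧸ q) (H ⧸ extIdeal H q),
      (Finset.univ.filter (· ∈ W)).card = N ^ finrank (𝓞 K ⧸ q) W := by
    intro W
    rw [← hN, ← Module.natCard_eq_pow_finrank, Nat.card_eq_fintype_card, Fintype.card_subtype]
  have hT : Fintype.card (H ⧸ extIdeal H q) = N ^ 4 := by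
    rw [← hr, ← hN, ← Module.natCard_eq_pow_finrank, Nat.card_eq_fintype_card]
  have hmemX : ∀ x, Ideal.Quotient.mk (extIdeal H q) x ∈
      Finset.univ.filter (fun b => b ∉ barSubmodule q P) ↔ D.nm x ∉ q := by
    intro x
    rw [Finset.mem_filter, mk_mem_barSubmodule hextP, hP]
    simp
  have key := card_mul_eq_of_translates (D.unitPermBar q)
    (Finset.univ.filter (fun b => b ∉ barSubmodule q P)) ?_
    (· ∈ barSubmodule q (Subalgebra.toSubmodule G)) {u | u ∈ G ∧ D.nm u = 1}.ncard ?_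
  · have hX : (Finset.univ.filter (fun b => b ∉ barSubmodule q P)).card = N ^ 4 - N ^ 2 := by
      rw [← hdimP, ← hcard, ← hT, ← Finset.card_univ,
        ← Finset.card_sdiff_of_subset (Finset.filter_subset _ _)]
      congr 1
      ext b
      simp
    have hXs : ((Finset.univ.filter (fun b => b ∉ barSubmodule q P)).filter
        (· ∈ barSubmodule q (Subalgebra.toSubmodule G))).card = N ^ 3 - N ^ 2 := by
      rw [← hdimP, ← hdim, ← hcard, ← hcard, ← Finset.card_sdiff_of_subset]
      · congr 1
        ext b
        simp [and_comm]
      · intro b hb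
        rw [Finset.mem_filter] at hb ⊢
        exact ⟨hb.1, hle hb.2⟩
    rw [hX, hXs, ← Nat.card_eq_fintype_card] at key
    have hN1 : 1 < N := by
      have h1 : N ≠ 1 := by
        rw [ne_eq, Ideal.absNorm_eq_one_iff]
        exact hqm.ne_top
      have h2 : N ≠ 0 := by rwa [ne_eq, Ideal.absNorm_eq_zero_iff]
      omega
    obtain ⟨M, hM⟩ : ∃ M, N = M + 1 := ⟨N - 1, by omega⟩
    have e1 : N ^ 4 - N ^ 2 = N ^ 2 * M * (N + 1) := by
      rw [hM]
      apply Nat.sub_eq_of_eq_add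
      ring
    have e2 : N ^ 3 - N ^ 2 = N ^ 2 * M := by
      rw [hM]
      apply Nat.sub_eq_of_eq_add
      ring
    rw [e1, e2, mul_assoc, mul_comm (Nat.card _)] at key
    have hpos : 0 < N ^ 2 * M := by
      have : 0 < M := by omega
      positivity
    exact (Nat.eq_of_mul_eq_mul_left hpos key).symm
  · intro u b
    obtain ⟨x, rfl⟩ := Ideal.Quotient.mk_surjective b
    change Ideal.Quotient.mk _ (u.1 * x) ∈ _ ↔ _
    rw [hmemX, hmemX, D.nm_mul, u.2, one_mul]
  · intro b hb
    obtain ⟨x, rfl⟩ := Ideal.Quotient.mk_surjective b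
    rw [hmemX] at hb
    rw [← ncard_unit_mul_mem hext hperc hb, ← Set.ncard_coe_finset,
      ← Set.ncard_image_of_injective _ Subtype.val_injective]
    congr 1
    have hiff : ∀ u : {u // D.nm u = 1}, D.unitPermBar q u (Ideal.Quotient.mk _ x) ∈
        barSubmodule q (Subalgebra.toSubmodule G) ↔ u.1 * x ∈ G := fun u =>
      mk_mem_barSubmodule hextG (x := u.1 * x)
    ext u
    constructor
    · rintro ⟨u, hu, rfl⟩
      exact ⟨u.2, (hiff u).1 (Finset.mem_filter.1 hu).2⟩
    · rintro ⟨hu, hux⟩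
      exact ⟨⟨u, hu⟩, Finset.mem_filter.2 ⟨Finset.mem_univ _, (hiff ⟨u, hu⟩).2 hux⟩, rfl⟩

/-- The number of elements of norm `α` in a perceptive suborder of index `q`. If `q` divides `α`
they are all the elements of norm `α` of `H`, otherwise their proportion is that of `G¹` in `H¹`. -/
theorem IsDefinitePrincipal.ncard_suborder (h : D.IsDefinitePrincipal) (hq : q.IsPrime)
    {𝔇 : Ideal (𝓞 K)} (h𝔇 : 𝔇 ≠ ⊥) (hq𝔇 : q ∣ 𝔇)
    (hram : ∀ q : Ideal (𝓞 K), q.IsPrime → q ≠ ⊥ → (D.IsRamified q ↔ q ∣ 𝔇))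
    (hperc : ∀ x, ∃ u, D.nm u = 1 ∧ u * x ∈ G)
    (hG : Ideal.span {d | ∃ f : H →ₗ[𝓞 K] H, (∀ x, f x ∈ G) ∧ LinearMap.det f = d} = q)
    {α : 𝓞 K} (hα : IsTotallyPositive (α : K)) :
    {x | x ∈ G ∧ D.nm x = α}.ncard = {x | x ∈ G ∧ D.nm x = 1}.ncard *
      normSum (IsAdmissible 𝔇 q) (Ideal.span {α}) := by
  have hq0 : q ≠ ⊥ := by
    rintro rfl
    exact h𝔇 (zero_dvd_iff.1 hq𝔇)
  have hqm : q.IsMaximal := hq.isMaximal hq0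
  have hqP := Ideal.prime_of_isPrime hq0 hq
  have hfinq : Finite (𝓞 K ⧸ q) := Ideal.finiteQuotientOfFreeOfNeBot q hq0
  have hqr := (hram q hq hq0).2 hq𝔇
  obtain ⟨hext, hPG, -⟩ := h.suborder_structure hq0 hqr hperc hG
  by_cases hαq : α ∈ q
  · have hset : {x | x ∈ G ∧ D.nm x = α} = {x | D.nm x = α} := by
      ext x
      exact ⟨fun hx => hx.2, fun hx => ⟨hPG x (by rwa [show D.nm x = α from hx]), hx⟩⟩
    rw [hset, ← count, h.count_eq h𝔇 hram α hα, h.count_one_eq hq0 hqr hperc hG]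
    obtain ⟨I, hI⟩ : q ∣ Ideal.span {α} := by
      rwa [Ideal.dvd_iff_le, Ideal.span_singleton_le_iff_mem]
    have hI0 : I ≠ ⊥ := by
      rintro rfl
      rw [← Ideal.zero_eq_bot, mul_zero, Ideal.zero_eq_bot, Ideal.span_singleton_eq_bot] at hI
      exact ne_zero_of_totallyPositive hα hI
    rw [hI, normSum_isAdmissible_mul hqP hq𝔇 h𝔇 hI0]
    ring
  · have h1 := h.count_mul_ncard_unit hext hperc hαq
    rw [h.count_eq h𝔇 hram α hα, mul_assoc] at h1
    have h2 : 0 < D.count 1 := (Set.ncard_pos (h.finite 1)).2 ⟨1, D.nm_one⟩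
    rw [← Nat.eq_of_mul_eq_mul_left h2 h1, normSum_isAdmissible_of_not_dvd, mul_comm]
    rwa [Ideal.dvd_iff_le, Ideal.span_singleton_le_iff_mem]

end PerceptiveCount

end StandardInvolution

/-! ### Orders in a totally definite quaternion algebra -/

section Algebra

variable {K : Type*} [Field K] {a b : K}

/-- The standard involution of a quaternion algebra. -/
def quatInvolution (a b : K) : StandardInvolution K ℍ[K,a,b] where
  conj :=
    { toFun := star
      map_add' := star_add
      map_smul' := fun r x => QuaternionAlgebra.star_smul' r x }
  conj_one := star_one _
  conj_mul := star_mul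
  tr := trd
  algebraMap_tr := algebraMap_trd
  nm := nrd
  algebraMap_nm := algebraMap_nrd

theorem nrd_mul (x y : ℍ[K,a,b]) : nrd (x * y) = nrd x * nrd y := (quatInvolution a b).nm_mul x y

theorem trd_add (x y : ℍ[K,a,b]) : trd (x + y) = trd x + trd y := (quatInvolution a b).tr_add x y

theorem trd_sub (x y : ℍ[K,a,b]) : trd (x - y) = trd x - trd y := (quatInvolution a b).tr_sub x y

theorem trd_smul (r : K) (x : ℍ[K,a,b]) : trd (r • x) = r * trd x :=
  (quatInvolution a b).tr_smul r x

theorem trd_zero : trd (0 : ℍ[K,a,b]) = 0 := (quatInvolution a b).tr_zero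

/-- The difference of the two sides is the norm of `x - star x`. -/
theorem trd_sq_le (hdef : IsDefinite a b) (σ : K →+* ℝ) (x : ℍ[K,a,b]) :
    σ (trd x) ^ 2 ≤ 4 * σ (nrd x) := by
  have h1 : 4 * nrd x - trd x ^ 2 = nrd (x - star x) := by
    simp [nrd_eq, trd]
    ring
  have h2 : 0 ≤ σ (nrd (x - star x)) := by
    by_cases h : x - star x = 0
    · rw [h]; simp [nrd]
    · exact (hdef _ h σ).le
  rw [← h1, map_sub, map_mul, map_pow, map_ofNat] at h2
  linarith

/-- The elements `x` and `star x` are integral and commute, so that their sum and product are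
integral. -/
theorem isIntegral_trd_nrd {R : Type*} [CommRing R] [Algebra R K]
    {x : ℍ[K,a,b]} (hx : IsIntegral R x) :
    IsIntegral R (trd x) ∧ IsIntegral R (nrd x) := by
  have hcomm : ∀ y ∈ ({x} : Set ℍ[K,a,b]), ∀ z ∈ ({x} : Set ℍ[K,a,b]), y * z = z * y := by
    rintro _ rfl _ rfl; rfl
  let C := Algebra.adjoin K ({x} : Set ℍ[K,a,b])
  have _ : IsMulCommutative C := Algebra.isMulCommutative_adjoin K hcomm
  have hxC : x ∈ C := Algebra.self_mem_adjoin_singleton K x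
  have hsC : star x ∈ C := by
    have : star x = algebraMap K _ (trd x) - x := by rw [algebraMap_trd]; abel
    rw [this]
    exact sub_mem (C.algebraMap_mem _) hxC
  have hs : IsIntegral R (star x) := by
    obtain ⟨p, hp, hpx⟩ := hx
    refine ⟨p, hp, ?_⟩
    rw [← Polynomial.aeval_def] at hpx ⊢
    have key : ∀ p : Polynomial R, Polynomial.aeval (star x) p = star (Polynomial.aeval x p) := by
      intro p
      induction p using Polynomial.induction_on' with
      | add p q hp hq => rw [map_add, map_add, hp, hq, star_add]
      | monomial n r =>
        rw [Polynomial.aeval_monomial, Polynomial.aeval_monomial, star_mul, star_pow,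
          IsScalarTower.algebraMap_apply R K ℍ[K,a,b]]
        rw [show star (algebraMap K ℍ[K,a,b] (algebraMap R K r)) = algebraMap K _ (algebraMap R K r)
          from (quatInvolution a b).conj_algebraMap _, Algebra.commutes]
    rw [key, hpx, star_zero]
  let f : C →ₐ[R] ℍ[K,a,b] := C.val.restrictScalars R
  have hf : Function.Injective f := Subtype.val_injective
  have h1 : IsIntegral R (⟨x, hxC⟩ : C) := (isIntegral_algHom_iff f hf).1 hx
  have h2 : IsIntegral R (⟨star x, hsC⟩ : C) := (isIntegral_algHom_iff f hf).1 hs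
  have hinj : Function.Injective (algebraMap K C) := (algebraMap K C).injective
  constructor
  · have h3 := h1.add h2
    rwa [show (⟨x, hxC⟩ : C) + ⟨star x, hsC⟩ = algebraMap K C (trd x) from
      Subtype.ext (algebraMap_trd x).symm, isIntegral_algebraMap_iff hinj] at h3
  · have h3 := h1.mul h2
    rwa [show (⟨x, hxC⟩ : C) * ⟨star x, hsC⟩ = algebraMap K C (nrd x) from
      Subtype.ext (algebraMap_nrd x).symm, isIntegral_algebraMap_iff hinj] at h3

end Algebra

section OrderInvolution

variable {K : Type*} [Field K] {a b : K} {H : Subalgebra (𝓞 K) ℍ[K,a,b]}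

theorem IsOrder.fg (hH : IsOrder H) : (Subalgebra.toSubmodule H).FG := by
  have : Submodule.IsLattice K (Subalgebra.toSubmodule H) := hH
  exact Submodule.IsLattice.fg (A := K)

theorem IsOrder.span_eq_top (hH : IsOrder H) : Submodule.span K (H : Set ℍ[K,a,b]) = ⊤ :=
  Submodule.IsLattice.span_eq_top (self := hH)

theorem faithfulSMul_integers (H : Subalgebra (𝓞 K) ℍ[K,a,b]) : FaithfulSMul (𝓞 K) H := by
  rw [faithfulSMul_iff_algebraMap_injective]
  intro r s h
  have h1 : algebraMap K ℍ[K,a,b] (r : K) = algebraMap K ℍ[K,a,b] (s : K) :=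
    congrArg Subtype.val h
  exact RingOfIntegers.coe_injective ((algebraMap K ℍ[K,a,b]).injective h1)

theorem isTorsionFree_integers (H : Subalgebra (𝓞 K) ℍ[K,a,b]) : Module.IsTorsionFree (𝓞 K) H := by
  have := Module.IsTorsionFree.trans_faithfulSMul (𝓞 K) K ℍ[K,a,b]
  refine Function.Injective.moduleIsTorsionFree (fun x : H => (x : ℍ[K,a,b]))
    Subtype.val_injective (fun r x => rfl)

theorem IsOrder.moduleFinite (hH : IsOrder H) : Module.Finite (𝓞 K) H :=
  Module.Finite.iff_fg.2 hH.fg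

/-- An order contains a basis of the algebra. -/
theorem IsOrder.exists_basis (hH : IsOrder H) :
    ∃ v : Module.Basis (Fin 4) K ℍ[K,a,b], ∀ i, v i ∈ H := by
  have h := Submodule.exists_fun_fin_finrank_span_eq K (H : Set ℍ[K,a,b])
  rw [hH.span_eq_top, finrank_top, QuaternionAlgebra.finrank_eq_four] at h
  obtain ⟨f, hf, hspan, hli⟩ := h
  exact ⟨Module.Basis.mk hli hspan.ge, fun i => by rw [Module.Basis.mk_apply]; exact hf i⟩

/-- The reduced trace and norm of an element of an order are integral. -/
theorem IsOrder.exists_trd_nrd [NumberField K] (hH : IsOrder H) {x : ℍ[K,a,b]} (hx : x ∈ H) :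
    (∃ t : 𝓞 K, (t : K) = trd x) ∧ ∃ n : 𝓞 K, (n : K) = nrd x := by
  have hint : IsIntegral (𝓞 K) x := IsIntegral.of_mem_of_fg H hH.fg x hx
  obtain ⟨h1, h2⟩ := isIntegral_trd_nrd hint
  exact ⟨IsIntegrallyClosed.isIntegral_iff.1 h1, IsIntegrallyClosed.isIntegral_iff.1 h2⟩

theorem IsOrder.star_mem [NumberField K] (hH : IsOrder H) {x : ℍ[K,a,b]} (hx : x ∈ H) :
    star x ∈ H := by
  obtain ⟨t, ht⟩ := (hH.exists_trd_nrd hx).1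
  have : star x = algebraMap (𝓞 K) ℍ[K,a,b] t - x := by
    rw [algebraMap_integers, ht, algebraMap_trd]; abel
  rw [this]
  exact sub_mem (H.algebraMap_mem t) hx

/-- The standard involution of an order, with integral reduced trace and norm. -/
noncomputable def orderInvolution [NumberField K] (hH : IsOrder H) :
    StandardInvolution (𝓞 K) H where
  conj :=
    { toFun := fun x => ⟨star x.1, hH.star_mem x.2⟩
      map_add' := fun x y => Subtype.ext (star_add _ _)
      map_smul' := fun r x => Subtype.ext ((quatInvolution a b).conj.map_smul (r : K) x.1) }
  conj_one := Subtype.ext (star_one _)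
  conj_mul x y := Subtype.ext (star_mul _ _)
  tr x := (hH.exists_trd_nrd x.2).1.choose
  algebraMap_tr x := Subtype.ext (by
    change algebraMap (𝓞 K) ℍ[K,a,b] _ = _
    rw [algebraMap_integers, (hH.exists_trd_nrd x.2).1.choose_spec]
    exact algebraMap_trd _)
  nm x := (hH.exists_trd_nrd x.2).2.choose
  algebraMap_nm x := Subtype.ext (by
    change algebraMap (𝓞 K) ℍ[K,a,b] _ = _
    rw [algebraMap_integers, (hH.exists_trd_nrd x.2).2.choose_spec]
    exact algebraMap_nrd _)

variable [NumberField K] (hH : IsOrder H)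

@[simp] theorem coe_orderInvolution_tr (x : H) :
    (((orderInvolution hH).tr x : 𝓞 K) : K) = trd x.1 :=
  (hH.exists_trd_nrd x.2).1.choose_spec

@[simp] theorem coe_orderInvolution_nm (x : H) :
    (((orderInvolution hH).nm x : 𝓞 K) : K) = nrd x.1 :=
  (hH.exists_trd_nrd x.2).2.choose_spec

theorem IsOrder.finrank_eq (hH : IsOrder H) : Module.finrank (𝓞 K) H = 4 := by
  apply Module.finrank_eq_of_rank_eq
  apply le_antisymm
  · have h1 := LinearMap.rank_le_of_injective (Subalgebra.toSubmodule H).subtype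
      Subtype.val_injective
    refine h1.trans ?_
    rw [← IsLocalization.rank_eq K (nonZeroDivisors (𝓞 K)) le_rfl,
      QuaternionAlgebra.rank_eq_four]
    rfl
  · obtain ⟨v, hv⟩ := hH.exists_basis
    have h1 : LinearIndependent (𝓞 K) (fun i => (⟨v i, hv i⟩ : H)) := by
      refine LinearIndependent.of_comp (Subalgebra.toSubmodule H).subtype ?_
      exact v.linearIndependent.restrict_scalars' (𝓞 K)
    have h2 := h1.cardinal_lift_le_rank
    simpa using h2

end OrderInvolution

/-! ### Maximal orders of class number one -/

section ClassNumberOne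

variable {K : Type*} [Field K] {a b : K} {H : Subalgebra (𝓞 K) ℍ[K,a,b]}

theorem rightOrder_toSubmodule (H : Subalgebra (𝓞 K) ℍ[K,a,b]) :
    rightOrder (Subalgebra.toSubmodule H) = H := by
  ext x
  refine ⟨fun hx => ?_, fun hx y hy => mul_mem (S := Subalgebra (𝓞 K) ℍ[K,a,b]) hy hx⟩
  simpa using hx 1 (one_mem H)

/-- The order itself, as an element of its class set. -/
def IsOrder.selfLattice (hH : IsOrder H) : RightLattice H :=
  ⟨Subalgebra.toSubmodule H, hH, rightOrder_toSubmodule H⟩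

theorem IsDefinite.nrd_ne_zero [NumberField K] [IsTotallyReal K] (hdef : IsDefinite a b)
    {x : ℍ[K,a,b]} (hx : x ≠ 0) : nrd x ≠ 0 := by
  obtain ⟨σ⟩ := StandardInvolution.exists_real_embedding (K := K)
  intro h
  have := hdef x hx σ
  rw [h, map_zero] at this
  exact this.false

variable [NumberField K] [IsTotallyReal K]

/-- A nonzero right ideal of a maximal order is a lattice whose right order is that order; class
number one says that it is a left multiple of the order. -/
theorem isRightPrincipal_of_classNumber (hdef : IsDefinite a b) (hmax : IsMaximalOrder H)
    (hcl : classNumber H = 1) : StandardInvolution.IsRightPrincipal (𝓞 K) H := by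
  have hH : IsOrder H := hmax.prop
  intro I hI hI0
  have hfinH := hH.moduleFinite
  obtain ⟨y, hyI, hy0⟩ := Submodule.exists_mem_ne_zero_of_ne_bot hI0
  obtain ⟨n, hn⟩ := (hH.exists_trd_nrd y.2).2
  have hn0 : (n : K) ≠ 0 := by
    rw [hn]
    exact hdef.nrd_ne_zero fun h => hy0 (Subtype.ext h)
  let L : Submodule (𝓞 K) ℍ[K,a,b] := I.map (Subalgebra.toSubmodule H).subtype
  have memL : ∀ x : H, (x : ℍ[K,a,b]) ∈ L ↔ x ∈ I := by
    intro x
    constructor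
    · rintro ⟨z, hz, hzx⟩
      rwa [← Subtype.ext (a1 := z) (a2 := x) hzx]
    · exact fun h => ⟨x, h, rfl⟩
  have hLH : ∀ x ∈ L, x ∈ H := by
    rintro _ ⟨z, -, rfl⟩
    exact z.2
  have hnL : ∀ x ∈ H, n • x ∈ L := by
    intro x hx
    have h1 := (memL _).2 (hI y hyI (⟨star y.1, hH.star_mem y.2⟩ * ⟨x, hx⟩))
    have h2 : n • x = y.1 * (star y.1 * x) := by
      rw [← mul_assoc, ← algebraMap_nrd, ← hn, ← algebraMap_integers, Algebra.smul_def]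
    rw [h2]
    exact h1
  have hLfg : L.FG := Submodule.FG.map _ (IsNoetherian.noetherian I)
  have hscale : ∀ M : Submodule (𝓞 K) ℍ[K,a,b], (∀ x ∈ H, n • x ∈ M) →
      Submodule.span K (M : Set ℍ[K,a,b]) = ⊤ := by
    intro M hM
    rw [eq_top_iff, ← hH.span_eq_top, Submodule.span_le]
    intro x hx
    have h1 : x = (n : K)⁻¹ • (n • x) := by
      have : n • x = (n : K) • x := rfl
      rw [this, inv_smul_smul₀ hn0]
    rw [h1]
    exact Submodule.smul_mem _ _ (Submodule.subset_span (hM x hx))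
  have hLlat : Submodule.IsLattice K L := ⟨hLfg, hscale L hnL⟩
  have hHO : H ≤ rightOrder L := by
    intro h hh x hx
    have hx' := hLH x hx
    exact (memL (⟨x, hx'⟩ * ⟨h, hh⟩)).2 (hI _ ((memL ⟨x, hx'⟩).1 hx) _)
  have hO : IsOrder (rightOrder L) := by
    refine ⟨?_, hscale _ fun x hx => Subalgebra.smul_mem _ (hHO hx) n⟩
    -- Multiplication by `n ∈ L` embeds the right order into `L`.
    have : Module.Finite (𝓞 K) L := Module.Finite.iff_fg.2 hLfg
    let f : Subalgebra.toSubmodule (rightOrder L) →ₗ[𝓞 K] L :=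
      { toFun := fun x => ⟨n • x.1, by
          have h1 := x.2 _ (hnL 1 (one_mem H))
          rwa [smul_mul_assoc, one_mul] at h1⟩
        map_add' := fun x y => Subtype.ext (smul_add n x.1 y.1)
        map_smul' := fun r x => Subtype.ext (smul_comm n r x.1) }
    have hf : Function.Injective f := by
      intro x z hxz
      have h1 : (n : K) • x.1 = (n : K) • z.1 := congrArg Subtype.val hxz
      exact Subtype.ext (smul_right_injective _ hn0 h1)
    exact Module.Finite.iff_fg.1 (Module.Finite.of_injective f hf)
  have hOH : rightOrder L = H := le_antisymm (hmax.le_of_ge hO hHO) hHO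
  have hsub := (Nat.card_eq_one_iff_unique.1 hcl).1
  have hrel : (rightEquiv H).r ⟨L, hLlat, hOH⟩ hH.selfLattice :=
    Quotient.exact (Subsingleton.elim (α := ClassSet H) (Quotient.mk _ _) (Quotient.mk _ _))
  obtain ⟨x, hx⟩ := hrel
  have hx' : L = leftMul (x : ℍ[K,a,b]) (Subalgebra.toSubmodule H) := hx
  have hxL : (x : ℍ[K,a,b]) ∈ L := by
    rw [hx']
    exact ⟨1, one_mem H, mul_one _⟩
  refine ⟨⟨x, hLH _ hxL⟩, fun z => ?_⟩
  rw [← memL, hx']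
  constructor
  · rintro ⟨h, hh, hz⟩
    exact ⟨⟨h, hh⟩, Subtype.ext hz.symm⟩
  · rintro ⟨h, rfl⟩
    exact ⟨h, h.2, rfl⟩

/-- An order of a definite algebra has finitely many elements of given norm: the reduced traces of
their products with a basis are algebraic integers that are bounded at all real places. -/
theorem finite_normSet (hdef : IsDefinite a b) (hH : IsOrder H) (α : K) :
    (normSet H α).Finite := by
  obtain ⟨v, hv⟩ := hH.exists_basis
  let T : ℍ[K,a,b] → Fin 4 → K := fun x i => trd (x * v i)
  have hT : Function.Injective T := by
    intro x y hxy
    rw [← sub_eq_zero]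
    by_contra hne
    have h1 : ∀ z, trd ((x - y) * z) = 0 := by
      intro z
      induction v.mem_span z using Submodule.span_induction with
      | mem z hz =>
        obtain ⟨i, rfl⟩ := hz
        have h2 : trd (x * v i) = trd (y * v i) := congrFun hxy i
        rw [sub_mul, trd_sub, sub_eq_zero]
        exact h2
      | zero => rw [mul_zero, trd_zero]
      | add z w _ _ hz hw => rw [mul_add, trd_add, hz, hw, add_zero]
      | smul r z _ hz => rw [mul_smul_comm, trd_smul, hz, mul_zero]
    have h2 := h1 (star (x - y))
    rw [← algebraMap_nrd] at h2
    have h3 : trd (algebraMap K ℍ[K,a,b] (nrd (x - y))) = 2 * nrd (x - y) := by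
      rw [QuaternionAlgebra.algebraMap_eq]
      simp [trd]
      ring
    rw [h3] at h2
    exact hdef.nrd_ne_zero hne ((mul_eq_zero.1 h2).resolve_left two_ne_zero)
  -- `trd (x * v i) ^ 2 ≤ 4 * nrd (x * v i) = 4 * α * nrd (v i)` at every real place.
  have hB : ∃ B : ℝ, ∀ (i : Fin 4) (σ : K →+* ℝ), 4 * σ (α * nrd (v i)) ≤ B := by
    have hfin : Finite (Fin 4 × (K →+* ℝ)) := by
      have : Finite (K →+* ℝ) := Finite.of_injective
        (fun σ : K →+* ℝ => (Complex.ofRealHom.comp σ : K →+* ℂ)) (by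
          intro σ τ h
          ext x
          exact Complex.ofReal_injective (DFunLike.congr_fun h x))
      infer_instance
    obtain ⟨B, hB⟩ := (Set.finite_range fun p : Fin 4 × (K →+* ℝ) =>
      4 * p.2 (α * nrd (v p.1))).bddAbove
    exact ⟨B, fun i σ => hB ⟨(i, σ), rfl⟩⟩
  obtain ⟨B, hB⟩ := hB
  refine Set.Finite.of_finite_image ?_ hT.injOn
  refine (Set.Finite.pi' fun _ : Fin 4 => Embeddings.finite_of_norm_le K ℂ (B + 1)).subset ?_
  rintro _ ⟨x, ⟨hxH, hx⟩, rfl⟩ i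
  obtain ⟨t, ht⟩ := (hH.exists_trd_nrd (mul_mem hxH (hv i))).1
  refine ⟨?_, fun φ => ?_⟩
  · rw [show T x i = trd (x * v i) from rfl, ← ht]
    exact t.isIntegral_coe
  · have hφ : ComplexEmbedding.IsReal φ := IsTotallyReal.complexEmbedding_isReal φ
    rw [← ComplexEmbedding.IsReal.coe_embedding_apply hφ, Complex.norm_real, Real.norm_eq_abs]
    have h1 := trd_sq_le hdef hφ.embedding (x * v i)
    rw [nrd_mul, hx] at h1
    have h2 := h1.trans (hB i hφ.embedding)
    have h3 : 0 ≤ B := (sq_nonneg _).trans h2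
    exact abs_le_of_sq_le_sq (h2.trans (by nlinarith)) (by linarith)

theorem isDefinitePrincipal (hdef : IsDefinite a b) (hmax : IsMaximalOrder H)
    (hcl : classNumber H = 1) : (orderInvolution hmax.prop).IsDefinitePrincipal where
  finrank_eq := hmax.prop.finrank_eq
  principal := isRightPrincipal_of_classNumber hdef hmax hcl
  pos x hx := by
    rw [coe_orderInvolution_nm]
    exact hdef _ fun h => hx (Subtype.ext h)
  finite α := by
    refine Set.Finite.of_finite_image ((finite_normSet hdef hmax.prop (α : K)).subset ?_)
      (Subtype.val_injective.injOn)
    rintro _ ⟨x, hx, rfl⟩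
    refine ⟨x.2, ?_⟩
    rw [← coe_orderInvolution_nm hmax.prop, show (orderInvolution hmax.prop).nm x = α from hx]

end ClassNumberOne

/-! ### The reduced discriminant and the index -/

section DiscriminantIndex

variable {K : Type*} [Field K] {a b : K} {H G : Subalgebra (𝓞 K) ℍ[K,a,b]}

theorem coe_mem_coeSubmodule {I : Ideal (𝓞 K)} {x : 𝓞 K} :
    (x : K) ∈ IsLocalization.coeSubmodule K I ↔ x ∈ I := by
  rw [IsLocalization.mem_coeSubmodule]
  constructor
  · rintro ⟨y, hy, h⟩
    rwa [← RingOfIntegers.coe_injective h]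
  · exact fun h => ⟨x, h, rfl⟩

/-- A quaternion algebra over a field of characteristic zero is not commutative, so that an order
contains two elements which do not commute. -/
theorem IsOrder.exists_not_commute [CharZero K] (hH : IsOrder H) :
    ∃ x ∈ H, ∃ y ∈ H, x * y - y * x ≠ 0 := by
  by_contra! h
  have h1 : ∀ x y : ℍ[K,a,b], x * y - y * x = 0 := by
    intro x y
    induction hH.span_eq_top.ge (Submodule.mem_top (x := x)) using Submodule.span_induction with
    | mem x hx =>
      induction hH.span_eq_top.ge (Submodule.mem_top (x := y)) using Submodule.span_induction with
      | mem y hy => exact h x hx y hy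
      | zero => simp
      | add y z _ _ hy hz =>
        rw [mul_add, add_mul, add_sub_add_comm, hy, hz, add_zero]
      | smul r y _ hy => rw [mul_smul_comm, smul_mul_assoc, ← smul_sub, hy, smul_zero]
    | zero => simp
    | add x z _ _ hx hz => rw [mul_add, add_mul, add_sub_add_comm, hx, hz, add_zero]
    | smul r x _ hx => rw [mul_smul_comm, smul_mul_assoc, ← smul_sub, hx, smul_zero]
  have h2 := congrArg QuaternionAlgebra.imK (h1 ⟨0, 1, 0, 0⟩ ⟨0, 0, 1, 0⟩)
  norm_num at h2

variable [NumberField K]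

theorem orderInvolution_discrd_mem (hH : IsOrder H) {𝔇 : Ideal (𝓞 K)} (hD : HasDiscrd H 𝔇)
    (x y z : H) :
    (orderInvolution hH).tr ((x * y - y * x) * (orderInvolution hH).conj z) ∈ 𝔇 := by
  rw [← coe_mem_coeSubmodule (K := K), ← hD, coe_orderInvolution_tr]
  exact Submodule.subset_span ⟨x, x.2, y, y.2, z, z.2, rfl⟩

theorem dvd_discrd_iff (hH : IsOrder H) {𝔇 : Ideal (𝓞 K)} (hD : HasDiscrd H 𝔇)
    (q : Ideal (𝓞 K)) :
    q ∣ 𝔇 ↔ ∀ x y z : H, (orderInvolution hH).tr ((x * y - y * x) * z) ∈ q := by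
  rw [Ideal.dvd_iff_le]
  constructor
  · intro h x y z
    have h1 := orderInvolution_discrd_mem hH hD x y ((orderInvolution hH).conj z)
    rw [(orderInvolution hH).conj_conj] at h1
    exact h h1
  · intro h d hd
    rw [← coe_mem_coeSubmodule (K := K)] at hd ⊢
    rw [← hD] at hd
    refine (Submodule.span_le.2 ?_) hd
    rintro _ ⟨x, hx, y, hy, z, hz, rfl⟩
    have h1 := h ⟨x, hx⟩ ⟨y, hy⟩ ((orderInvolution hH).conj ⟨z, hz⟩)
    rw [← coe_mem_coeSubmodule (K := K), coe_orderInvolution_tr] at h1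
    exact h1

theorem discrd_ne_bot [IsTotallyReal K] (hdef : IsDefinite a b) (hH : IsOrder H)
    {𝔇 : Ideal (𝓞 K)} (hD : HasDiscrd H 𝔇) : 𝔇 ≠ ⊥ := by
  rintro rfl
  obtain ⟨x, hx, y, hy, hxy⟩ := hH.exists_not_commute
  have hz : x * y - y * x ∈ H := sub_mem (mul_mem hx hy) (mul_mem hy hx)
  have h1 := orderInvolution_discrd_mem hH hD ⟨x, hx⟩ ⟨y, hy⟩ ⟨_, hz⟩
  rw [← coe_mem_coeSubmodule (K := K), coe_orderInvolution_tr] at h1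
  have h2 : trd ((x * y - y * x) * star (x * y - y * x)) = 0 := by
    obtain ⟨d, hd, h3⟩ := (IsLocalization.mem_coeSubmodule K _).1 h1
    rw [(Submodule.mem_bot _).1 hd, map_zero] at h3
    exact h3.symm
  rw [← algebraMap_nrd, QuaternionAlgebra.algebraMap_eq] at h2
  have h3 : nrd (x * y - y * x) + nrd (x * y - y * x) = 0 := by simpa [trd] using h2
  exact hdef.nrd_ne_zero hxy (by linear_combination h3 / 2)

/-- The determinant of an endomorphism of an order is that of its extension to the algebra. -/
theorem det_extend [Module.Free (𝓞 K) H] (hH : IsOrder H) {f : H →ₗ[𝓞 K] H}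
    {δ : ℍ[K,a,b] →ₗ[K] ℍ[K,a,b]} (hδ : ∀ x : H, δ x = f x) :
    LinearMap.det δ = ((LinearMap.det f : 𝓞 K) : K) := by
  classical
  have : Module.Finite (𝓞 K) H := hH.moduleFinite
  have hlat : Submodule.IsLattice K (Subalgebra.toSubmodule H) := hH
  let v := Module.Free.chooseBasis (𝓞 K) H
  let w : Module.Basis _ K ℍ[K,a,b] :=
    Module.Basis.extendOfIsLattice (M := Subalgebra.toSubmodule H) K v
  have hw : ∀ i, w i = (v i : ℍ[K,a,b]) := fun i =>
    Module.Basis.extendOfIsLattice_apply (M := Subalgebra.toSubmodule H) K v i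
  have hrepr : ∀ (y : H) i, w.repr (y : ℍ[K,a,b]) i = ((v.repr y i : 𝓞 K) : K) := by
    intro y i
    have h1 : (y : ℍ[K,a,b]) = ∑ j, ((v.repr y j : 𝓞 K) : K) • w j := by
      have h2 := congrArg (Subalgebra.toSubmodule H).subtype (v.sum_repr y)
      rw [map_sum] at h2
      rw [← show (Subalgebra.toSubmodule H).subtype y = (y : ℍ[K,a,b]) from rfl, ← h2]
      refine Finset.sum_congr rfl fun j _ => ?_
      rw [hw]
      rfl
    rw [h1, w.repr_sum_self]
  rw [← LinearMap.det_toMatrix w, ← LinearMap.det_toMatrix v, RingOfIntegers.coe_eq_algebraMap,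
    RingHom.map_det]
  congr 1
  ext i j
  rw [LinearMap.toMatrix_apply, hw, hδ, hrepr, RingHom.mapMatrix_apply, Matrix.map_apply,
    LinearMap.toMatrix_apply]

/-- The index ideal, computed with endomorphisms of the larger order. -/
theorem span_det_eq [Module.Free (𝓞 K) H] (hH : IsOrder H) (hGH : G ≤ H) {I : Ideal (𝓞 K)}
    (hI : HasIndex H G I) :
    Ideal.span {d | ∃ f : H →ₗ[𝓞 K] H, (∀ x, f x ∈ G.comap H.val) ∧ LinearMap.det f = d} = I := by
  have : Module.Finite (𝓞 K) H := hH.moduleFinite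
  have hlat : Submodule.IsLattice K (Subalgebra.toSubmodule H) := hH
  apply le_antisymm
  · rw [Ideal.span_le]
    rintro _ ⟨f, hf, rfl⟩
    let v := Module.Free.chooseBasis (𝓞 K) H
    let w : Module.Basis _ K ℍ[K,a,b] :=
      Module.Basis.extendOfIsLattice (M := Subalgebra.toSubmodule H) K v
    have hw : ∀ i, w i = (v i : ℍ[K,a,b]) := fun i =>
      Module.Basis.extendOfIsLattice_apply (M := Subalgebra.toSubmodule H) K v i
    let δ := w.constr ℕ fun i => (f (v i) : ℍ[K,a,b])
    have hδ : ∀ x : H, δ x = f x := by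
      have h1 : (δ.restrictScalars (𝓞 K)).comp (Subalgebra.toSubmodule H).subtype =
          (Subalgebra.toSubmodule H).subtype.comp f := by
        refine v.ext fun i => ?_
        change δ (v i : ℍ[K,a,b]) = f (v i)
        rw [← hw, Module.Basis.constr_basis]
      exact fun x => LinearMap.congr_fun h1 x
    rw [SetLike.mem_coe, ← coe_mem_coeSubmodule (K := K), ← hI, ← det_extend hH hδ]
    refine Submodule.subset_span ⟨δ, fun x hx => ?_, rfl⟩
    have h2 := hδ ⟨x, hx⟩
    rw [show δ x = f ⟨x, hx⟩ from h2]
    exact hf ⟨x, hx⟩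
  · intro d hd
    rw [← coe_mem_coeSubmodule (K := K)] at hd ⊢
    rw [← hI] at hd
    refine (Submodule.span_le.2 ?_) hd
    rintro _ ⟨δ, hδ, rfl⟩
    let f : H →ₗ[𝓞 K] H :=
      { toFun := fun x => ⟨δ x, hGH (hδ x x.2)⟩
        map_add' := fun x y => Subtype.ext (δ.map_add _ _)
        map_smul' := fun r x => Subtype.ext (δ.map_smul (r : K) x.1) }
    rw [det_extend hH (f := f) (δ := δ) (fun x => rfl), SetLike.mem_coe, coe_mem_coeSubmodule]
    exact Ideal.subset_span ⟨f, fun x => hδ x x.2, rfl⟩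

/-- The representation numbers of a perceptive suborder of prime index of an order of class number
one. -/
theorem repCount_eq [IsTotallyReal K] (hdef : IsDefinite a b) {𝔇 𝔭 : Ideal (𝓞 K)}
    (hmax : IsMaximalOrder H) (hcl : classNumber H = 1) (hD : HasDiscrd H 𝔇)
    (hperc : IsPerceptive G H) (h𝔭 : 𝔭.IsPrime) (h𝔭𝔇 : 𝔭 ∣ 𝔇) (hI : HasIndex H G 𝔭)
    {α : 𝓞 K} (hα : IsTotallyPositive (α : K)) :
    (normSet G (α : K)).Finite ∧
      repCount G (α : K) = (normSet G 1).ncard * divisorSum 𝔇 𝔭 α := by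
  have hH : IsOrder H := hmax.prop
  have h := isDefinitePrincipal hdef hmax hcl
  have hfin := hH.moduleFinite
  have hfaith := faithfulSMul_integers H
  have htf := isTorsionFree_integers H
  have hflat : Module.Flat (𝓞 K) H := inferInstance
  have hprin : ∀ I : Ideal (𝓞 K), I ≠ ⊥ → I.IsPrincipal := fun I hI => by
    obtain ⟨β, -, hβ⟩ := h.exists_generator I hI
    exact ⟨β, hβ.symm⟩
  have hPID : IsPrincipalIdealRing (𝓞 K) := ⟨fun I => by
    by_cases hI : I = ⊥
    · rw [hI]; exact bot_isPrincipal
    · exact hprin I hI⟩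
  have hfree : Module.Free (𝓞 K) H := Module.free_of_finite_type_torsion_free'
  have h𝔇 := discrd_ne_bot hdef hH hD
  have hram : ∀ q : Ideal (𝓞 K), q.IsPrime → q ≠ ⊥ →
      ((orderInvolution hH).IsRamified q ↔ q ∣ 𝔇) := fun q hq hq0 => by
    rw [dvd_discrd_iff hH hD]
    exact (orderInvolution hH).isRamified_iff hq hq0 (Ideal.finiteQuotientOfFreeOfNeBot q hq0)
      h.finrank_eq h.principal
  have hperc' : ∀ x : H, ∃ u, (orderInvolution hH).nm u = 1 ∧ u * x ∈ G.comap H.val := by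
    intro x
    obtain ⟨u, ⟨huH, hu⟩, hux⟩ := hperc.2 x x.2
    refine ⟨⟨u, huH⟩, RingOfIntegers.coe_injective ?_, hux⟩
    rw [← RingOfIntegers.coe_eq_algebraMap, coe_orderInvolution_nm, hu, map_one]
  have hcount : ∀ β : 𝓞 K, {x : H | x ∈ G.comap H.val ∧ (orderInvolution hH).nm x = β}.ncard =
      (normSet G (β : K)).ncard := by
    intro β
    rw [← Set.ncard_image_of_injective _ Subtype.val_injective]
    congr 1
    ext x
    constructor
    · rintro ⟨y, ⟨hyG, hy⟩, rfl⟩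
      exact ⟨hyG, by rw [← coe_orderInvolution_nm hH, hy]⟩
    · rintro ⟨hxG, hx⟩
      refine ⟨⟨x, hperc.1 hxG⟩, ⟨hxG, RingOfIntegers.coe_injective ?_⟩, rfl⟩
      rw [← RingOfIntegers.coe_eq_algebraMap, coe_orderInvolution_nm, hx]
  refine ⟨(finite_normSet hdef hH (α : K)).subset fun x hx => ⟨hperc.1 hx.1, hx.2⟩, ?_⟩
  have key := h.ncard_suborder h𝔭 h𝔇 h𝔭𝔇 hram hperc' (span_det_eq hH hperc.1 hI) hα
  rw [hcount, hcount, RingOfIntegers.coe_eq_algebraMap (1 : 𝓞 K), map_one] at key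
  rw [repCount, key,
    divisorSum_eq_normSum hprin _ _ (StandardInvolution.ne_zero_of_totallyPositive hα)]

end DiscriminantIndex

/-! ### The Hurwitz and Lipschitz orders -/

section HurwitzLipschitz

theorem exists_int_of_integers (r : 𝓞 ℚ) : ∃ n : ℤ, r = n := by
  obtain ⟨n, hn⟩ := IsIntegrallyClosed.isIntegral_iff.1 r.isIntegral_coe
  exact ⟨n, RingOfIntegers.coe_injective (by rw [← hn]; simp)⟩

theorem integers_smul_eq (n : ℤ) (q : ℍ[ℚ,-1,-1]) : ((n : ℤ) : 𝓞 ℚ) • q = (n : ℚ) • q := by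
  rw [Algebra.smul_def, algebraMap_integers, ← Algebra.smul_def]
  simp

theorem mem_lipschitzOrder {q : ℍ[ℚ,-1,-1]} :
    q ∈ lipschitzOrder ↔ ∃ t x y z : ℤ, q = ⟨t, x, y, z⟩ := by
  constructor
  · intro h
    have h' : q ∈ Submodule.span (𝓞 ℚ) lipschitzBasis := h
    induction h' using Submodule.span_induction with
    | mem q hq => exact exists_of_mem_lipschitzBasis hq
    | zero => exact ⟨0, 0, 0, 0, by ext <;> simp⟩
    | add p q _ _ hp hq =>
      obtain ⟨t, x, y, z, rfl⟩ := hp ‹_›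
      obtain ⟨t', x', y', z', rfl⟩ := hq ‹_›
      exact ⟨t + t', x + x', y + y', z + z', by ext <;> simp⟩
    | smul r q _ hq =>
      obtain ⟨t, x, y, z, rfl⟩ := hq ‹_›
      obtain ⟨n, rfl⟩ := exists_int_of_integers r
      exact ⟨n * t, n * x, n * y, n * z, by rw [integers_smul_eq]; ext <;> simp⟩
  · rintro ⟨t, x, y, z, rfl⟩
    exact int_comb_mem _ t x y z (by ext <;> simp)

theorem mem_hurwitzOrder {q : ℍ[ℚ,-1,-1]} :
    q ∈ hurwitzOrder ↔ ∃ t x y z : ℤ, q = ⟨t + z / 2, x + z / 2, y + z / 2, z / 2⟩ := by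
  constructor
  · intro h
    have h' : q ∈ Submodule.span (𝓞 ℚ) hurwitzBasis := h
    induction h' using Submodule.span_induction with
    | mem q hq => exact exists_of_mem_hurwitzBasis hq
    | zero => exact ⟨0, 0, 0, 0, by ext <;> simp⟩
    | add p q _ _ hp hq =>
      obtain ⟨t, x, y, z, rfl⟩ := hp ‹_›
      obtain ⟨t', x', y', z', rfl⟩ := hq ‹_›
      exact ⟨t + t', x + x', y + y', z + z', by ext <;> simp <;> ring⟩
    | smul r q _ hq =>
      obtain ⟨t, x, y, z, rfl⟩ := hq ‹_›
      obtain ⟨n, rfl⟩ := exists_int_of_integers r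
      exact ⟨n * t, n * x, n * y, n * z, by rw [integers_smul_eq]; ext <;> simp <;> ring⟩
  · rintro ⟨t, x, y, z, rfl⟩
    exact int_comb_mem _ t x y z (by ext <;> simp <;> ring)

/-- The Hurwitz quaternions are those with half-integral coordinates of equal parity. -/
theorem mem_hurwitzOrder_iff_parity {q : ℍ[ℚ,-1,-1]} :
    q ∈ hurwitzOrder ↔ ∃ t x y z : ℤ, q = ⟨t / 2, x / 2, y / 2, z / 2⟩ ∧
      2 ∣ t - z ∧ 2 ∣ x - z ∧ 2 ∣ y - z := by
  rw [mem_hurwitzOrder]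
  constructor
  · rintro ⟨t, x, y, z, rfl⟩
    refine ⟨2 * t + z, 2 * x + z, 2 * y + z, z, ?_, by simp, by simp, by simp⟩
    ext <;> simp <;> ring
  · rintro ⟨t, x, y, z, rfl, ⟨t', ht⟩, ⟨x', hx⟩, ⟨y', hy⟩⟩
    obtain rfl : t = 2 * t' + z := by omega
    obtain rfl : x = 2 * x' + z := by omega
    obtain rfl : y = 2 * y' + z := by omega
    refine ⟨t', x', y', z, ?_⟩
    ext <;> simp <;> ring

theorem lipschitzOrder_le : lipschitzOrder ≤ hurwitzOrder := by
  intro q hq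
  obtain ⟨t, x, y, z, rfl⟩ := mem_lipschitzOrder.1 hq
  refine mem_hurwitzOrder_iff_parity.2 ⟨2 * t, 2 * x, 2 * y, 2 * z, ?_, ?_, ?_, ?_⟩
  · ext <;> simp
  all_goals exact ⟨_, (mul_sub 2 _ _).symm⟩

theorem nrd_eq_sum_sq (q : ℍ[ℚ,-1,-1]) :
    nrd q = q.re ^ 2 + q.imI ^ 2 + q.imJ ^ 2 + q.imK ^ 2 := by
  rw [nrd_eq]; ring

theorem nrd_pos {q : ℍ[ℚ,-1,-1]} (hq : q ≠ 0) : 0 < nrd q := by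
  rw [nrd_eq_sum_sq]
  by_contra! h
  apply hq
  have h1 := sq_nonneg q.re
  have h2 := sq_nonneg q.imI
  have h3 := sq_nonneg q.imJ
  have h4 := sq_nonneg q.imK
  ext
  · exact pow_eq_zero_iff two_ne_zero |>.1 (by linarith)
  · exact pow_eq_zero_iff two_ne_zero |>.1 (by linarith)
  · exact pow_eq_zero_iff two_ne_zero |>.1 (by linarith)
  · exact pow_eq_zero_iff two_ne_zero |>.1 (by linarith)

theorem isDefinite_rat : IsDefinite (-1 : ℚ) (-1) := by
  intro q hq σ
  rw [eq_ratCast]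
  exact_mod_cast nrd_pos hq

theorem isOrder_lipschitzOrder : IsOrder lipschitzOrder := by
  refine ⟨Submodule.fg_span (by simp [lipschitzBasis]), eq_top_iff.2 fun q _ => ?_⟩
  have h : ∀ t x y z : ℤ, (⟨t, x, y, z⟩ : ℍ[ℚ,-1,-1]) ∈
      Submodule.span ℚ (Subalgebra.toSubmodule lipschitzOrder : Set ℍ[ℚ,-1,-1]) :=
    fun t x y z => Submodule.subset_span (mem_lipschitzOrder.2 ⟨t, x, y, z, rfl⟩)
  have h1 : q = q.re • (⟨(1 : ℤ), (0 : ℤ), (0 : ℤ), (0 : ℤ)⟩ : ℍ[ℚ,-1,-1]) +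
      q.imI • (⟨(0 : ℤ), (1 : ℤ), (0 : ℤ), (0 : ℤ)⟩ : ℍ[ℚ,-1,-1]) +
      q.imJ • (⟨(0 : ℤ), (0 : ℤ), (1 : ℤ), (0 : ℤ)⟩ : ℍ[ℚ,-1,-1]) +
      q.imK • (⟨(0 : ℤ), (0 : ℤ), (0 : ℤ), (1 : ℤ)⟩ : ℍ[ℚ,-1,-1]) := by
    ext <;> simp
  rw [h1]
  exact add_mem (add_mem (add_mem (Submodule.smul_mem _ _ (h _ _ _ _))
    (Submodule.smul_mem _ _ (h _ _ _ _))) (Submodule.smul_mem _ _ (h _ _ _ _)))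
    (Submodule.smul_mem _ _ (h _ _ _ _))

theorem isOrder_hurwitzOrder : IsOrder hurwitzOrder := by
  refine ⟨Submodule.fg_span (by simp [hurwitzBasis]), eq_top_iff.2 ?_⟩
  rw [← isOrder_lipschitzOrder.span_eq_top]
  exact Submodule.span_mono lipschitzOrder_le

/-- An order containing the Hurwitz order has integral reduced traces against `1`, `i`, `j`, `k`
and `(1 + i + j + k) / 2`, and integral reduced norms, which forces the parity condition. -/
theorem isMaximalOrder_hurwitzOrder : IsMaximalOrder hurwitzOrder := by
  refine ⟨isOrder_hurwitzOrder, fun O hO hle q hq => ?_⟩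
  have htr : ∀ h ∈ hurwitzOrder, ∃ n : ℤ, trd (q * h) = n := by
    intro h hh
    obtain ⟨r, hr⟩ := (hO.exists_trd_nrd (mul_mem hq (hle hh))).1
    obtain ⟨n, rfl⟩ := exists_int_of_integers r
    exact ⟨n, by rw [← hr]; simp⟩
  have hl : ∀ t x y z : ℤ, (⟨t, x, y, z⟩ : ℍ[ℚ,-1,-1]) ∈ hurwitzOrder := fun t x y z =>
    lipschitzOrder_le (mem_lipschitzOrder.2 ⟨t, x, y, z, rfl⟩)
  obtain ⟨t, ht⟩ := htr _ (hl 1 0 0 0)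
  obtain ⟨x, hx⟩ := htr _ (hl 0 (-1) 0 0)
  obtain ⟨y, hy⟩ := htr _ (hl 0 0 (-1) 0)
  obtain ⟨z, hz⟩ := htr _ (hl 0 0 0 (-1))
  obtain ⟨s, hs⟩ := htr ⟨1 / 2, -1 / 2, -1 / 2, -1 / 2⟩
    (mem_hurwitzOrder_iff_parity.2 ⟨1, -1, -1, -1, by ext <;> simp, by norm_num, by norm_num,
      by norm_num⟩)
  obtain ⟨m, hm⟩ := (hO.exists_trd_nrd hq).2
  obtain ⟨m, rfl⟩ := exists_int_of_integers m
  have hm' : (m : ℚ) = nrd q := by rw [← hm]; simp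
  rw [nrd_eq_sum_sq] at hm'
  simp [trd] at ht hx hy hz hs
  have e1 : q.re = t / 2 := by linarith
  have e2 : q.imI = x / 2 := by linarith
  have e3 : q.imJ = y / 2 := by linarith
  have e4 : q.imK = z / 2 := by linarith
  rw [e1, e2, e3, e4] at hm' hs
  have h1 : t + x + y + z = 2 * s := by
    have : ((t + x + y + z : ℤ) : ℚ) = ((2 * s : ℤ) : ℚ) := by push_cast; linarith
    exact_mod_cast this
  have h2 : t ^ 2 + x ^ 2 + y ^ 2 + z ^ 2 = 4 * m := by
    have : ((t ^ 2 + x ^ 2 + y ^ 2 + z ^ 2 : ℤ) : ℚ) = ((4 * m : ℤ) : ℚ) := by push_cast; linarith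
    exact_mod_cast this
  have hsq : ∀ w : ℤ, w ^ 2 % 4 = w % 2 := by
    intro w
    obtain ⟨v, rfl | rfl⟩ := Int.even_or_odd' w
    · rw [show (2 * v) ^ 2 = 4 * v ^ 2 by ring]; omega
    · rw [show (2 * v + 1) ^ 2 = 4 * (v ^ 2 + v) + 1 by ring]; omega
  have s1 := hsq t
  have s2 := hsq x
  have s3 := hsq y
  have s4 := hsq z
  refine mem_hurwitzOrder_iff_parity.2 ⟨t, x, y, z, ?_, by omega, by omega, by omega⟩
  ext <;> assumption

end HurwitzLipschitz

section HurwitzClassNumber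

/-- Rounding the coordinates gives a remainder with coordinates at most `1 / 2`; when they all are
`1 / 2` in absolute value, the quaternion itself is a Hurwitz quaternion. -/
theorem exists_hurwitz_nrd_sub_lt (q : ℍ[ℚ,-1,-1]) : ∃ h ∈ hurwitzOrder, nrd (q - h) < 1 := by
  have habs : ∀ r : ℚ, (r - round r) ^ 2 ≤ 1 / 4 := fun r => by
    have h1 := abs_le.1 (abs_sub_round r)
    nlinarith
  have hhalf : ∀ r : ℚ, (r - round r) ^ 2 = 1 / 4 → ∃ n : ℤ, r = (n : ℚ) / 2 ∧ n % 2 = 1 := by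
    intro r hr
    have h1 : (r - round r - 1 / 2) * (r - round r + 1 / 2) = 0 := by linarith
    rcases mul_eq_zero.1 h1 with h2 | h2
    · exact ⟨2 * round r + 1, by push_cast; linarith, by omega⟩
    · exact ⟨2 * round r - 1, by push_cast; linarith, by omega⟩
  have h1 := habs q.re
  have h2 := habs q.imI
  have h3 := habs q.imJ
  have h4 := habs q.imK
  by_cases h : (q.re - round q.re) ^ 2 = 1 / 4 ∧ (q.imI - round q.imI) ^ 2 = 1 / 4 ∧
      (q.imJ - round q.imJ) ^ 2 = 1 / 4 ∧ (q.imK - round q.imK) ^ 2 = 1 / 4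
  · obtain ⟨t, ht, ht'⟩ := hhalf _ h.1
    obtain ⟨x, hx, hx'⟩ := hhalf _ h.2.1
    obtain ⟨y, hy, hy'⟩ := hhalf _ h.2.2.1
    obtain ⟨z, hz, hz'⟩ := hhalf _ h.2.2.2
    refine ⟨q, mem_hurwitzOrder_iff_parity.2 ⟨t, x, y, z, ?_, by omega, by omega, by omega⟩, ?_⟩
    · ext <;> assumption
    · rw [sub_self, nrd_eq_sum_sq]
      norm_num
  · refine ⟨⟨round q.re, round q.imI, round q.imJ, round q.imK⟩,
      lipschitzOrder_le (mem_lipschitzOrder.2 ⟨_, _, _, _, rfl⟩), ?_⟩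
    rw [nrd_eq_sum_sq]
    simp only [QuaternionAlgebra.re_sub, QuaternionAlgebra.imI_sub, QuaternionAlgebra.imJ_sub,
      QuaternionAlgebra.imK_sub]
    by_contra! hge
    exact h ⟨by linarith, by linarith, by linarith, by linarith⟩

theorem exists_nsmul_mem_hurwitzOrder {L : Submodule (𝓞 ℚ) ℍ[ℚ,-1,-1]} (hL : L.FG) :
    ∃ n : ℕ, n ≠ 0 ∧ ∀ x ∈ L, n • x ∈ hurwitzOrder := by
  induction L, hL using Submodule.fg_induction with
  | singleton q =>
    refine ⟨q.re.den * q.imI.den * q.imJ.den * q.imK.den, by simp, fun x hx => ?_⟩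
    obtain ⟨r, rfl⟩ := Submodule.mem_span_singleton.1 hx
    rw [smul_comm, ← Nat.cast_smul_eq_nsmul ℚ]
    refine Subalgebra.smul_mem _ (lipschitzOrder_le (mem_lipschitzOrder.2
      ⟨q.re.num * q.imI.den * q.imJ.den * q.imK.den, q.re.den * q.imI.num * q.imJ.den * q.imK.den,
       q.re.den * q.imI.den * q.imJ.num * q.imK.den, q.re.den * q.imI.den * q.imJ.den * q.imK.num,
       ?_⟩)) r
    have h1 := q.re.mul_den_eq_num
    have h2 := q.imI.mul_den_eq_num
    have h3 := q.imJ.mul_den_eq_num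
    have h4 := q.imK.mul_den_eq_num
    ext <;> simp only [QuaternionAlgebra.re_smul, QuaternionAlgebra.imI_smul,
      QuaternionAlgebra.imJ_smul, QuaternionAlgebra.imK_smul, smul_eq_mul] <;> push_cast
    · rw [← h1]; ring
    · rw [← h2]; ring
    · rw [← h3]; ring
    · rw [← h4]; ring
  | sup M N _ _ hM hN =>
    obtain ⟨m, hm0, hm⟩ := hM
    obtain ⟨n, hn0, hn⟩ := hN
    refine ⟨m * n, mul_ne_zero hm0 hn0, fun x hx => ?_⟩
    obtain ⟨y, hy, z, hz, rfl⟩ := Submodule.mem_sup.1 hx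
    rw [smul_add]
    refine add_mem ?_ ?_
    · rw [mul_comm, mul_smul]
      exact nsmul_mem (hm y hy) n
    · rw [mul_smul]
      exact nsmul_mem (hn z hz) m

theorem nrd_hurwitz_nat {q : ℍ[ℚ,-1,-1]} (hq : q ∈ hurwitzOrder) : ∃ n : ℕ, nrd q = n := by
  obtain ⟨r, hr⟩ := (isOrder_hurwitzOrder.exists_trd_nrd hq).2
  obtain ⟨m, rfl⟩ := exists_int_of_integers r
  have hm : (m : ℚ) = nrd q := by rw [← hr]; simp
  have h0 : 0 ≤ m := by
    have : (0 : ℚ) ≤ m := by rw [hm, nrd_eq_sum_sq]; positivity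
    exact_mod_cast this
  refine ⟨m.toNat, ?_⟩
  rw [← hm]
  exact_mod_cast (Int.toNat_of_nonneg h0).symm

/-- A lattice with right order the Hurwitz order is generated by an element of minimal norm. -/
theorem exists_eq_leftMul {L : Submodule (𝓞 ℚ) ℍ[ℚ,-1,-1]} (hL : Submodule.IsLattice ℚ L)
    (hLH : rightOrder L = hurwitzOrder) :
    ∃ x : (ℍ[ℚ,-1,-1])ˣ, L = leftMul (x : ℍ[ℚ,-1,-1]) (Subalgebra.toSubmodule hurwitzOrder) := by
  classical
  obtain ⟨n, hn0, hn⟩ := exists_nsmul_mem_hurwitzOrder (Submodule.IsLattice.fg (A := ℚ) (M := L))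
  have hn0' : (n : ℚ) ≠ 0 := Nat.cast_ne_zero.2 hn0
  have hne : ∃ x ∈ L, x ≠ 0 := by
    by_contra! h
    have h1 := Submodule.IsLattice.span_eq_top (A := ℚ) (M := L)
    have h2 : (1 : ℍ[ℚ,-1,-1]) ∈ Submodule.span ℚ (L : Set ℍ[ℚ,-1,-1]) := by rw [h1]; trivial
    have h3 : (L : Set ℍ[ℚ,-1,-1]) ⊆ {0} := fun x hx => h x hx
    have h4 := Submodule.span_mono (R := ℚ) h3 h2
    rw [Submodule.mem_span_singleton] at h4
    obtain ⟨r, hr⟩ := h4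
    rw [smul_zero] at hr
    exact zero_ne_one hr
  have hnrd : ∀ x : ℍ[ℚ,-1,-1], nrd (n • x) = n ^ 2 * nrd x := fun x => by
    rw [nrd_eq_sum_sq, nrd_eq_sum_sq]
    simp
    ring
  have hex : ∃ m : ℕ, ∃ x ∈ L, x ≠ 0 ∧ nrd (n • x) = m := by
    obtain ⟨x, hx, hx0⟩ := hne
    obtain ⟨m, hm⟩ := nrd_hurwitz_nat (hn x hx)
    exact ⟨m, x, hx, hx0, hm⟩
  obtain ⟨x, hxL, hx0, hx⟩ := Nat.find_spec hex
  have hmin : ∀ y ∈ L, nrd y < nrd x → y = 0 := by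
    intro y hy hlt
    by_contra hy0
    obtain ⟨m, hm⟩ := nrd_hurwitz_nat (hn y hy)
    have h1 := Nat.find_min' hex ⟨y, hy, hy0, hm⟩
    have h2 : (Nat.find hex : ℚ) ≤ m := by exact_mod_cast h1
    rw [← hx, ← hm, hnrd, hnrd] at h2
    have h3 : (0 : ℚ) < n ^ 2 := by positivity
    exact absurd (le_of_mul_le_mul_left h2 h3) (not_le.2 hlt)
  have hnx := (nrd_pos hx0).ne'
  have hxx : x * ((nrd x)⁻¹ • star x) = 1 := by
    rw [mul_smul_comm, ← algebraMap_nrd, Algebra.smul_def, ← map_mul, inv_mul_cancel₀ hnx, map_one]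
  have hxx' : ((nrd x)⁻¹ • star x) * x = 1 := by
    have h1 : star x * x = algebraMap ℚ ℍ[ℚ,-1,-1] (nrd x) :=
      (quatInvolution (-1) (-1)).conj_mul_self x
    rw [smul_mul_assoc, h1, Algebra.smul_def, ← map_mul, inv_mul_cancel₀ hnx, map_one]
  have hstable : ∀ y ∈ L, ∀ h ∈ hurwitzOrder, y * h ∈ L := by
    intro y hy h hh
    rw [← hLH] at hh
    exact hh y hy
  refine ⟨⟨x, _, hxx, hxx'⟩, le_antisymm (fun y hy => ?_) ?_⟩
  · obtain ⟨h, hh, hlt⟩ := exists_hurwitz_nrd_sub_lt (((nrd x)⁻¹ • star x) * y)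
    refine ⟨h, hh, ?_⟩
    have hy' : y = x * (((nrd x)⁻¹ • star x) * y) := by rw [← mul_assoc, hxx, one_mul]
    have h1 : y - x * h = 0 := by
      apply hmin _ (sub_mem hy (hstable x hxL h hh))
      nth_rw 1 [hy']
      rw [← mul_sub, nrd_mul]
      exact mul_lt_of_lt_one_right (nrd_pos hx0) hlt
    exact (sub_eq_zero.1 h1).symm
  · rintro _ ⟨h, hh, rfl⟩
    exact hstable x hxL h hh

theorem classNumber_hurwitzOrder : classNumber hurwitzOrder = 1 := by
  have hc : ∀ c : ClassSet hurwitzOrder,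
      c = Quotient.mk (rightEquiv hurwitzOrder) isOrder_hurwitzOrder.selfLattice := by
    intro c
    induction c using Quotient.inductionOn with
    | h L => exact Quotient.sound (exists_eq_leftMul L.2.1 L.2.2)
  refine Nat.card_eq_one_iff_unique.2 ⟨⟨fun c d => (hc c).trans (hc d).symm⟩, ⟨?_⟩⟩
  exact Quotient.mk (rightEquiv hurwitzOrder) isOrder_hurwitzOrder.selfLattice

end HurwitzClassNumber

section HurwitzInvariants

theorem coeSubmodule_span_two : IsLocalization.coeSubmodule ℚ (Ideal.span {(2 : 𝓞 ℚ)}) =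
    Submodule.span (𝓞 ℚ) {(2 : ℚ)} := by
  rw [IsLocalization.coeSubmodule_span_singleton, map_ofNat]

theorem two_mul_int_mem (n : ℤ) : (2 * n : ℚ) ∈ Submodule.span (𝓞 ℚ) {(2 : ℚ)} := by
  rw [mul_comm, ← zsmul_eq_mul]
  exact zsmul_mem (Submodule.mem_span_singleton_self _) n

theorem hasDiscrd_hurwitzOrder : HasDiscrd hurwitzOrder (Ideal.span {2}) := by
  rw [HasDiscrd, coeSubmodule_span_two]
  apply le_antisymm
  · refine Submodule.span_le.2 ?_
    rintro _ ⟨p, hp, q, hq, r, hr, rfl⟩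
    obtain ⟨t₁, x₁, y₁, z₁, rfl⟩ := mem_hurwitzOrder.1 hp
    obtain ⟨t₂, x₂, y₂, z₂, rfl⟩ := mem_hurwitzOrder.1 hq
    obtain ⟨t₃, x₃, y₃, z₃, rfl⟩ := mem_hurwitzOrder.1 hr
    have h := two_mul_int_mem (x₁ * (y₂ * z₃ - z₂ * y₃) - y₁ * (x₂ * z₃ - z₂ * x₃) +
      z₁ * (x₂ * y₃ - y₂ * x₃))
    convert! h using 1
    simp [trd]
    ring
  · refine Submodule.span_le.2 ?_
    rintro _ rfl
    refine Submodule.subset_span ⟨⟨0, 1, 0, 0⟩, ?_, ⟨0, 0, 1, 0⟩, ?_,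
      ⟨1 / 2, 1 / 2, 1 / 2, 1 / 2⟩, ?_, ?_⟩
    · exact mem_hurwitzOrder.2 ⟨0, 1, 0, 0, by simp⟩
    · exact mem_hurwitzOrder.2 ⟨0, 0, 1, 0, by simp⟩
    · exact mem_hurwitzOrder.2 ⟨0, 0, 0, 1, by simp⟩
    · simp [trd]
      norm_num

/-- A Hurwitz quaternion outside the Lipschitz order is congruent modulo `2` times the Lipschitz
order to a unit `e`; multiplication by the conjugate of `e` moves it into the Lipschitz order. -/
theorem isPerceptive_lipschitzOrder : IsPerceptive lipschitzOrder hurwitzOrder := by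
  refine ⟨lipschitzOrder_le, fun q hq => ?_⟩
  obtain ⟨t, x, y, z, rfl, h1, h2, h3⟩ := mem_hurwitzOrder_iff_parity.1 hq
  obtain hz | hz := Int.emod_two_eq_zero_or_one z
  · refine ⟨1, ⟨one_mem _, by simp [nrd]⟩, ?_⟩
    rw [one_mul]
    obtain ⟨t', rfl⟩ : 2 ∣ t := by omega
    obtain ⟨x', rfl⟩ : 2 ∣ x := by omega
    obtain ⟨y', rfl⟩ : 2 ∣ y := by omega
    obtain ⟨z', rfl⟩ : 2 ∣ z := by omega
    exact mem_lipschitzOrder.2 ⟨t', x', y', z', by ext <;> simp⟩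
  · -- The unit `e` has the coordinates `ε / 2`, where `ε = ±1` is congruent to `2 q` modulo `4`.
    have hε : ∀ w : ℤ, w % 2 = 1 → ∃ ε v : ℤ, w = ε + 4 * v ∧ ε ^ 2 = 1 := by
      intro w hw
      obtain h | h : w % 4 = 1 ∨ w % 4 = 3 := by omega
      · exact ⟨1, w / 4, by omega, by norm_num⟩
      · exact ⟨-1, w / 4 + 1, by omega, by norm_num⟩
    obtain ⟨ε₀, t, rfl, e0⟩ := hε t (by omega)
    obtain ⟨ε₁, x, rfl, e1⟩ := hε x (by omega)
    obtain ⟨ε₂, y, rfl, e2⟩ := hε y (by omega)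
    obtain ⟨ε₃, z, rfl, e3⟩ := hε z hz
    have f0 : (ε₀ : ℚ) ^ 2 = 1 := by exact_mod_cast e0
    have f1 : (ε₁ : ℚ) ^ 2 = 1 := by exact_mod_cast e1
    have f2 : (ε₂ : ℚ) ^ 2 = 1 := by exact_mod_cast e2
    have f3 : (ε₃ : ℚ) ^ 2 = 1 := by exact_mod_cast e3
    refine ⟨⟨ε₀ / 2, -ε₁ / 2, -ε₂ / 2, -ε₃ / 2⟩, ⟨?_, ?_⟩, ?_⟩
    · refine mem_hurwitzOrder_iff_parity.2 ⟨ε₀, -ε₁, -ε₂, -ε₃, ?_, by omega, by omega, by omega⟩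
      ext <;> simp
    · rw [nrd_eq_sum_sq]
      linear_combination (f0 + f1 + f2 + f3) / 4
    · refine mem_lipschitzOrder.2 ⟨1 + ε₀ * t + ε₁ * x + ε₂ * y + ε₃ * z,
        ε₀ * x - ε₁ * t - ε₂ * z + ε₃ * y, ε₀ * y - ε₂ * t - ε₃ * x + ε₁ * z,
        ε₀ * z - ε₃ * t - ε₁ * y + ε₂ * x, ?_⟩
      ext <;> simp
      · linear_combination (f0 + f1 + f2 + f3) / 4
      · ring
      · ring
      · ring

theorem isPrime_span_two : (Ideal.span {2} : Ideal (𝓞 ℚ)).IsPrime := by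
  have h2 : (2 : 𝓞 ℚ) ≠ 0 := two_ne_zero
  rw [Ideal.span_singleton_prime h2, ← MulEquiv.prime_iff Rat.ringOfIntegersEquiv, map_ofNat]
  exact Int.prime_two

/-- The linear map fixing `1`, `i`, `j` and sending `(1 + i + j + k) / 2` to `k`, which maps the
Hurwitz order onto the Lipschitz order. -/
def hurwitzToLipschitz : ℍ[ℚ,-1,-1] →ₗ[ℚ] ℍ[ℚ,-1,-1] where
  toFun q := ⟨q.re - q.imK, q.imI - q.imK, q.imJ - q.imK, 2 * q.imK⟩
  map_add' p q := by ext <;> simp <;> ring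
  map_smul' r q := by ext <;> simp <;> ring

/-- The inverse of `hurwitzToLipschitz`. -/
def lipschitzToHurwitz : ℍ[ℚ,-1,-1] →ₗ[ℚ] ℍ[ℚ,-1,-1] where
  toFun q := ⟨q.re + q.imK / 2, q.imI + q.imK / 2, q.imJ + q.imK / 2, q.imK / 2⟩
  map_add' p q := by ext <;> simp <;> ring
  map_smul' r q := by ext <;> simp <;> ring

theorem hurwitzToLipschitz_comp : hurwitzToLipschitz ∘ₗ lipschitzToHurwitz = LinearMap.id := by
  ext q <;> simp [hurwitzToLipschitz, lipschitzToHurwitz]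
  ring

theorem det_hurwitzToLipschitz : LinearMap.det hurwitzToLipschitz = 2 := by
  have h : LinearMap.toMatrix (QuaternionAlgebra.basisOneIJK (-1 : ℚ) 0 (-1))
      (QuaternionAlgebra.basisOneIJK (-1 : ℚ) 0 (-1)) hurwitzToLipschitz =
      !![1, 0, 0, -1; 0, 1, 0, -1; 0, 0, 1, -1; 0, 0, 0, 2] := by
    ext i j
    rw [LinearMap.toMatrix_apply, QuaternionAlgebra.coe_basisOneIJK_repr]
    fin_cases i <;> fin_cases j <;>
      simp [hurwitzToLipschitz, QuaternionAlgebra.basisOneIJK]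
  rw [← LinearMap.det_toMatrix (QuaternionAlgebra.basisOneIJK (-1 : ℚ) 0 (-1)), h]
  simp [Matrix.det_succ_row_zero, Fin.sum_univ_succ]

theorem hasIndex_hurwitz_lipschitz :
    HasIndex hurwitzOrder lipschitzOrder (Ideal.span {2}) := by
  rw [HasIndex, coeSubmodule_span_two]
  have hPID : IsPrincipalIdealRing (𝓞 ℚ) :=
    IsPrincipalIdealRing.of_surjective (Rat.ringOfIntegersEquiv.symm : ℤ →+* 𝓞 ℚ)
      Rat.ringOfIntegersEquiv.symm.surjective
  have hfin := isOrder_hurwitzOrder.moduleFinite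
  have htf := isTorsionFree_integers hurwitzOrder
  have hfree : Module.Free (𝓞 ℚ) hurwitzOrder := Module.free_of_finite_type_torsion_free'
  apply le_antisymm
  · -- A map of the Hurwitz into the Lipschitz order factors through `hurwitzToLipschitz`.
    refine Submodule.span_le.2 ?_
    rintro _ ⟨δ, hδ, rfl⟩
    have hmem : ∀ x ∈ hurwitzOrder, lipschitzToHurwitz (δ x) ∈ hurwitzOrder := by
      intro x hx
      obtain ⟨t, x, y, z, h⟩ := mem_lipschitzOrder.1 (hδ x hx)
      rw [h]
      exact mem_hurwitzOrder.2 ⟨t, x, y, z, rfl⟩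
    let f : hurwitzOrder →ₗ[𝓞 ℚ] hurwitzOrder :=
      { toFun := fun x => ⟨lipschitzToHurwitz (δ x), hmem x x.2⟩
        map_add' := fun x y => Subtype.ext ((lipschitzToHurwitz ∘ₗ δ).map_add _ _)
        map_smul' := fun r x => Subtype.ext ((lipschitzToHurwitz ∘ₗ δ).map_smul (r : ℚ) x.1) }
    have h1 := det_extend isOrder_hurwitzOrder (f := f) (δ := lipschitzToHurwitz ∘ₗ δ)
      (fun x => rfl)
    obtain ⟨n, hn⟩ := exists_int_of_integers (LinearMap.det f)
    have h2 : δ = hurwitzToLipschitz ∘ₗ (lipschitzToHurwitz ∘ₗ δ) := by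
      rw [← LinearMap.comp_assoc, hurwitzToLipschitz_comp, LinearMap.id_comp]
    rw [h2, LinearMap.det_comp, det_hurwitzToLipschitz, h1, hn]
    simpa using two_mul_int_mem n
  · refine Submodule.span_le.2 ?_
    rintro _ rfl
    refine Submodule.subset_span ⟨hurwitzToLipschitz, fun x hx => ?_, det_hurwitzToLipschitz⟩
    obtain ⟨t, x, y, z, rfl⟩ := mem_hurwitzOrder.1 hx
    refine mem_lipschitzOrder.2 ⟨t, x, y, z, ?_⟩
    ext <;> simp [hurwitzToLipschitz]
    ring

end HurwitzInvariants

/-! ### Sums of four squares -/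

section Jacobi

theorem intCast_dvd_intCast {m n : ℤ} : (m : 𝓞 ℚ) ∣ n ↔ m ∣ n := by
  rw [← map_dvd_iff Rat.ringOfIntegersEquiv, map_intCast, map_intCast, Int.cast_id, Int.cast_id]

theorem natCast_dvd_natCast {m n : ℕ} : (m : 𝓞 ℚ) ∣ n ↔ m ∣ n := by
  rw [← Int.natCast_dvd_natCast, ← intCast_dvd_intCast, Int.cast_natCast, Int.cast_natCast]

theorem absNorm_span_natCast (n : ℕ) : Ideal.absNorm (Ideal.span {(n : 𝓞 ℚ)}) = n := by
  rw [Ideal.absNorm_span_natCast, RingOfIntegers.rank, Module.finrank_self, pow_one]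

theorem divisorSum_rat {n : ℕ} (hn : 0 < n) :
    divisorSum (Ideal.span {2}) (Ideal.span {2}) (n : 𝓞 ℚ) =
      ∑ d ∈ n.divisors.filter (fun d => ¬ 4 ∣ d), d := by
  have h4 : (Ideal.span {2} : Ideal (𝓞 ℚ)) ^ 2 = Ideal.span {((4 : ℕ) : 𝓞 ℚ)} := by
    rw [Ideal.span_singleton_pow]
    norm_num
  have hset : admissibleDivisors (Ideal.span {2}) (Ideal.span {2}) (n : 𝓞 ℚ) =
      (fun d : ℕ => Ideal.span {(d : 𝓞 ℚ)}) ''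
        (n.divisors.filter (fun d => ¬ 4 ∣ d) : Finset ℕ) := by
    ext δ
    constructor
    · rintro ⟨⟨r, rfl⟩, h1, h2, -⟩
      obtain ⟨m, rfl⟩ := exists_int_of_integers r
      have hm : Ideal.span {((m.natAbs : ℕ) : 𝓞 ℚ)} = Submodule.span (𝓞 ℚ) {(m : 𝓞 ℚ)} := by
        refine Ideal.span_singleton_eq_span_singleton.2 (associated_of_dvd_dvd ?_ ?_)
        · rw [← Int.cast_natCast, intCast_dvd_intCast]
          exact Int.natAbs_dvd.2 dvd_rfl
        · rw [← Int.cast_natCast, intCast_dvd_intCast]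
          exact Int.dvd_natAbs.2 dvd_rfl
      refine ⟨m.natAbs, ?_, hm⟩
      rw [← hm, Ideal.dvd_span_singleton, Ideal.mem_span_singleton, natCast_dvd_natCast] at h1
      rw [← hm, h4, Ideal.dvd_span_singleton, Ideal.mem_span_singleton, natCast_dvd_natCast] at h2
      simp only [Finset.coe_filter, Nat.mem_divisors]
      exact ⟨⟨h1, hn.ne'⟩, h2⟩
    · rintro ⟨d, hd, rfl⟩
      simp only [Finset.coe_filter, Nat.mem_divisors] at hd
      obtain ⟨⟨h1, -⟩, h2⟩ := hd
      refine ⟨⟨_, rfl⟩, ?_, ?_, fun q hq hq2 hne => ?_⟩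
      · rwa [Ideal.dvd_span_singleton, Ideal.mem_span_singleton, natCast_dvd_natCast]
      · rwa [h4, Ideal.dvd_span_singleton, Ideal.mem_span_singleton, natCast_dvd_natCast]
      · have hmax : (Ideal.span {2} : Ideal (𝓞 ℚ)).IsMaximal :=
          isPrime_span_two.isMaximal (by rw [ne_eq, Ideal.span_singleton_eq_bot]; exact two_ne_zero)
        exact absurd (hmax.eq_of_le hq.ne_top (Ideal.dvd_iff_le.1 hq2)).symm hne
  rw [divisorSum, hset, finsum_mem_image, finsum_mem_coe_finset]
  · exact Finset.sum_congr rfl fun d _ => absNorm_span_natCast d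
  · intro d _ e _ h
    rw [← absNorm_span_natCast d, ← absNorm_span_natCast e]
    exact congrArg Ideal.absNorm h

/-- The Lipschitz quaternion with given coordinates. -/
def lipschitzOfInt (v : ℤ × ℤ × ℤ × ℤ) : ℍ[ℚ,-1,-1] := ⟨v.1, v.2.1, v.2.2.1, v.2.2.2⟩

theorem lipschitzOfInt_injective : Function.Injective lipschitzOfInt := by
  rintro ⟨t, x, y, z⟩ ⟨t', x', y', z'⟩ h
  simpa [lipschitzOfInt, QuaternionAlgebra.ext_iff] using h

theorem image_lipschitzOfInt (n : ℤ) :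
    lipschitzOfInt '' {v : ℤ × ℤ × ℤ × ℤ |
      v.1 ^ 2 + v.2.1 ^ 2 + v.2.2.1 ^ 2 + v.2.2.2 ^ 2 = n} = normSet lipschitzOrder n := by
  ext q
  constructor
  · rintro ⟨⟨t, x, y, z⟩, h, rfl⟩
    refine ⟨mem_lipschitzOrder.2 ⟨t, x, y, z, rfl⟩, ?_⟩
    have h' : t ^ 2 + x ^ 2 + y ^ 2 + z ^ 2 = n := h
    rw [nrd_eq_sum_sq]
    change (t : ℚ) ^ 2 + (x : ℚ) ^ 2 + (y : ℚ) ^ 2 + (z : ℚ) ^ 2 = n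
    exact_mod_cast h'
  · rintro ⟨hq, h⟩
    obtain ⟨t, x, y, z, rfl⟩ := mem_lipschitzOrder.1 hq
    rw [nrd_eq_sum_sq] at h
    change (t : ℚ) ^ 2 + (x : ℚ) ^ 2 + (y : ℚ) ^ 2 + (z : ℚ) ^ 2 = n at h
    have h' : t ^ 2 + x ^ 2 + y ^ 2 + z ^ 2 = n := by exact_mod_cast h
    exact ⟨(t, x, y, z), h', rfl⟩

theorem ncard_normSet_lipschitzOrder_one : (normSet lipschitzOrder 1).ncard = 8 := by
  have h := image_lipschitzOfInt 1
  rw [Int.cast_one] at h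
  rw [← h, Set.ncard_image_of_injective _ lipschitzOfInt_injective]
  have hI : ∀ w : ℤ, w ∈ Finset.Icc (-1 : ℤ) 1 ↔ w ^ 2 ≤ 1 := fun w => by
    rw [Finset.mem_Icc, sq_le_one_iff_abs_le_one, abs_le]
  have hset : {v : ℤ × ℤ × ℤ × ℤ | v.1 ^ 2 + v.2.1 ^ 2 + v.2.2.1 ^ 2 + v.2.2.2 ^ 2 = 1} =
      ((Finset.Icc (-1) 1 ×ˢ Finset.Icc (-1) 1 ×ˢ Finset.Icc (-1) 1 ×ˢ Finset.Icc (-1) 1).filter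
        (fun v : ℤ × ℤ × ℤ × ℤ => v.1 ^ 2 + v.2.1 ^ 2 + v.2.2.1 ^ 2 + v.2.2.2 ^ 2 = 1) :
        Finset (ℤ × ℤ × ℤ × ℤ)) := by
    ext ⟨t, x, y, z⟩
    simp only [Finset.coe_filter, Finset.mem_product, hI, Set.mem_ofPred_eq]
    refine ⟨fun h => ⟨⟨?_, ?_, ?_, ?_⟩, h⟩, fun h => h.2⟩ <;>
      nlinarith [sq_nonneg t, sq_nonneg x, sq_nonneg y, sq_nonneg z]
  rw [hset, Set.ncard_coe_finset]
  decide

end Jacobi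

end QuatOrder

theorem mainTheorem5 :
    -- The general formula.
    (∀ (K : Type*) [Field K] [NumberField K] [NumberField.IsTotallyReal K] (a b : K)
      (_ : QuatOrder.IsDefinite a b)
      (H G : Subalgebra (𝓞 K) ℍ[K,a,b]) (𝔇 𝔭 : Ideal (𝓞 K)),
      QuatOrder.IsMaximalOrder H →
      QuatOrder.classNumber H = 1 →
      QuatOrder.HasDiscrd H 𝔇 →
      QuatOrder.IsOrder G →
      QuatOrder.IsPerceptive G H →
      𝔭.IsPrime →
      𝔭 ∣ 𝔇 →
      QuatOrder.HasIndex H G 𝔭 →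
      ∀ α : 𝓞 K, QuatOrder.IsTotallyPositive (α : K) →
        (QuatOrder.normSet G (α : K)).Finite ∧
        QuatOrder.repCount G (α : K) =
          (QuatOrder.normSet G 1).ncard * QuatOrder.divisorSum 𝔇 𝔭 α) ∧
    -- The Hurwitz and Lipschitz orders are an instance of it,
    (QuatOrder.IsDefinite (-1 : ℚ) (-1) ∧
      QuatOrder.IsMaximalOrder QuatOrder.hurwitzOrder ∧
      QuatOrder.classNumber QuatOrder.hurwitzOrder = 1 ∧
      QuatOrder.HasDiscrd QuatOrder.hurwitzOrder (Ideal.span {2}) ∧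
      QuatOrder.IsOrder QuatOrder.lipschitzOrder ∧
      QuatOrder.IsPerceptive QuatOrder.lipschitzOrder QuatOrder.hurwitzOrder ∧
      (Ideal.span {2} : Ideal (𝓞 ℚ)).IsPrime ∧
      QuatOrder.HasIndex QuatOrder.hurwitzOrder QuatOrder.lipschitzOrder (Ideal.span {2}) ∧
      (QuatOrder.normSet QuatOrder.lipschitzOrder 1).ncard = 8) ∧
    -- which yields Jacobi's four-square theorem.
    (∀ n : ℕ, 0 < n →
      {v : ℤ × ℤ × ℤ × ℤ |
          v.1 ^ 2 + v.2.1 ^ 2 + v.2.2.1 ^ 2 + v.2.2.2 ^ 2 = (n : ℤ)}.Finite ∧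
      {v : ℤ × ℤ × ℤ × ℤ |
          v.1 ^ 2 + v.2.1 ^ 2 + v.2.2.1 ^ 2 + v.2.2.2 ^ 2 = (n : ℤ)}.ncard =
        8 * ∑ d ∈ n.divisors.filter (fun d => ¬ 4 ∣ d), d) := by
  refine ⟨?_, ?_, ?_⟩
  · intro K _ _ _ a b hdef H G 𝔇 𝔭 hmax hcl hD _ hperc h𝔭 h𝔭𝔇 hI α hα
    exact QuatOrder.repCount_eq hdef hmax hcl hD hperc h𝔭 h𝔭𝔇 hI hα
  · exact ⟨QuatOrder.isDefinite_rat, QuatOrder.isMaximalOrder_hurwitzOrder,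
      QuatOrder.classNumber_hurwitzOrder, QuatOrder.hasDiscrd_hurwitzOrder,
      QuatOrder.isOrder_lipschitzOrder, QuatOrder.isPerceptive_lipschitzOrder,
      QuatOrder.isPrime_span_two, QuatOrder.hasIndex_hurwitz_lipschitz,
      QuatOrder.ncard_normSet_lipschitzOrder_one⟩
  · intro n hn
    have hα : QuatOrder.IsTotallyPositive (((n : 𝓞 ℚ) : 𝓞 ℚ) : ℚ) := by
      intro σ
      simpa using hn
    obtain ⟨hfin, hcount⟩ := QuatOrder.repCount_eq QuatOrder.isDefinite_rat
      QuatOrder.isMaximalOrder_hurwitzOrder QuatOrder.classNumber_hurwitzOrder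
      QuatOrder.hasDiscrd_hurwitzOrder QuatOrder.isPerceptive_lipschitzOrder
      QuatOrder.isPrime_span_two dvd_rfl QuatOrder.hasIndex_hurwitz_lipschitz hα
    have himage := QuatOrder.image_lipschitzOfInt (n : ℤ)
    have hcast : (((n : 𝓞 ℚ) : 𝓞 ℚ) : ℚ) = ((n : ℤ) : ℚ) := by simp
    rw [QuatOrder.repCount, QuatOrder.ncard_normSet_lipschitzOrder_one, hcast, ← himage,
      Set.ncard_image_of_injective _ QuatOrder.lipschitzOfInt_injective,
      QuatOrder.divisorSum_rat hn] at hcount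
    rw [hcast, ← himage] at hfin
    exact ⟨hfin.of_finite_image QuatOrder.lipschitzOfInt_injective.injOn, hcount⟩
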